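/- **Theorem.** There is a universal constant $C>0$ such that the following holds. Let $K\ge 1$, let $\boldsymbol\pi=(\pi_1,\dots,\pi_K)$ be a probability vector with $\pi_\ell>0$ for all $\ell$, and let $\mathbf B$ be a symmetric $K\times K$ matrix with entries in $[0,1]$ and pairwise distinct rows; put $d=\mathrm{rk}(\mathbf B)$. Let $\rho_n\ge 0$ be such that $\rho_nB_{k\ell}\le 1$ for all $n,k,\ell$, and assume that for some $\beta\in(0,1]$ and some constant $c$ one has $n^\beta\le c\,n\rho_n$ for all sufficiently large $n$. For each $n$ let $(\mathbf A,\boldsymbol\tau)$ be a $K$-block stochastic blockmodel graph on $n$ vertices with sparsity factor $\rho_n$: the labels $\tau_1,\dots,\tau_n$ are iid with $\mathbb P(\tau_i=\ell)=\pi_\ell$, and, conditionally on $\boldsymbol\tau$, $\mathbf A$ is a symmetric $n\times n$ matrix whose entries $A_{ij}$, $i\le j$, are independent Bernoulli variables with $\mathbb E[A_{ij}]=\rho_nB_{\tau_i\tau_j}$. Let $\tilde k=\tilde k_n$, $a_n$ and $g$ be integers, $g$ not depending on $n$, with (i) $\tilde k\ge d$, (ii) $a_n\ge\max\{C\tilde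 k^{-1}\log n,\,1\}$, (iii) $g>\beta^{-1}$. RSVD-based spectral clustering computes $\hat{\boldsymbol\tau}$ from $\mathbf A$ as follows: draw $n\times\tilde k$ matrices $\mathbf G_1,\dots,\mathbf G_{a_n}$ with iid standard Gaussian entries, independent of each other and of $(\mathbf A,\boldsymbol\tau)$; choose $\tilde a\in\{1,\dots,a_n\}$ maximizing the $d$-th largest singular value of $\mathbf A^g\mathbf G_a$ over $a$; let $\hat{\mathbf U}_g$ be the $n\times d$ matrix of left singular vectors of $\mathbf A^g\mathbf G_{\tilde a}$ for its $d$ leading singular values; and let $\hat{\boldsymbol\tau}\in\{1,\dots,K\}^n$ be an (exact) $K$-means or $K$-medians clustering of the rows of $\hat{\mathbf U}_g$, i.e. a clustering that, together with some centres $c_1,\dots,c_K\in\mathbb R^d$, minimizes $\sum_i\|[\hat{\mathbf U}_g]_i-c_{\hat\tau_i}\|^2$, respectively $\sum_i\|[\hat{\mathbf U}_g]_i-c_{\hat\tau_i}\|$ (Euclidean norms). Then, for all sufficiently large $n$, with probability at least $1-n^{-5}$, $\hat{\boldsymbol\tau}$ exactly recovers $\boldsymbol\tau$, i.e. there is a permutation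 $\varsigma$ of $\{1,\dots,K\}$ with $\hat\tau_i=\varsigma(\tau_i)$ for all $i$ (whichever maximizer $\tilde a$, singular vectors and optimal clustering the algorithm picks in case of ties). -/

import Mathlib

open MeasureTheory ProbabilityTheory Filter Topology

/-! ### The stochastic blockmodel -/

/-- The probability vector `π` on the `K` blocks, as a measure: `ℓ` has mass `π ℓ`. -/
noncomputable def blockLaw {K : ℕ} (π : Fin K → ℝ) : Measure (Fin K) :=
  ∑ ℓ, ENNReal.ofReal (π ℓ) • Measure.dirac ℓ

/-- The law on `{0, 1} ⊆ ℝ` of a Bernoulli variable with mean `p` (for `p ∈ [0, 1]`). -/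
noncomputable def bernoulliReal (p : ℝ) : Measure ℝ :=
  bernoulliMeasure (1 : ℝ) 0 (Set.projIcc 0 1 zero_le_one p)

/-- The symmetric matrix with prescribed entries `x (i, j)`, `i ≤ j`. -/
def symmMatrix {n : ℕ} (x : {p : Fin n × Fin n // p.1 ≤ p.2} → ℝ) : Fin n → Fin n → ℝ :=
  fun i j => x ⟨(min i j, max i j), min_le_max⟩

/-- The law of the adjacency matrix given the labels `t`: the entries `A i j`, `i ≤ j`, are
independent, `A i j` is Bernoulli with mean `ρ * B (t i) (t j)`, and `A` is symmetric. -/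
noncomputable def adjacencyLaw {K n : ℕ} (ρ : ℝ) (B : Matrix (Fin K) (Fin K) ℝ)
    (t : Fin n → Fin K) : Measure (Fin n → Fin n → ℝ) :=
  (Measure.pi fun p : {p : Fin n × Fin n // p.1 ≤ p.2} =>
    bernoulliReal (ρ * B (t p.1.1) (t p.1.2))).map symmMatrix

/-- The joint law of `(A, τ) ∼ SBM(B, π)` on `n` vertices with sparsity factor `ρ`: the labels
`τ i` are iid with law `π`, and given `τ` the adjacency matrix has law `adjacencyLaw ρ B τ`. -/
noncomputable def sbmLaw {K : ℕ} (n : ℕ) (B : Matrix (Fin K) (Fin K) ℝ) (π : Fin K → ℝ)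
    (ρ : ℝ) : Measure ((Fin n → Fin n → ℝ) × (Fin n → Fin K)) :=
  (Measure.pi fun _ : Fin n => blockLaw π).bind fun t =>
    (adjacencyLaw ρ B t).map fun A => (A, t)

/-! ### Randomized SVD with repeated sampling -/

/-- The law of `a` independent `n × kt` matrices with iid standard Gaussian entries. -/
noncomputable def sketchLaw (a n kt : ℕ) : Measure (Fin a → Fin n → Fin kt → ℝ) :=
  Measure.pi fun _ => Measure.pi fun _ => Measure.pi fun _ => gaussianReal 0 1

/-- The `k`-th largest singular value of `Y`, counted from `k = 1`. -/
noncomputable def singularValue {n m : ℕ} (Y : Matrix (Fin n) (Fin m) ℝ) (k : ℕ) : ℝ :=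
  (Matrix.toEuclideanLin Y).singularValues (k - 1)

/-- The columns of `U` are left singular vectors of `Y` for the `k` leading singular values of
`Y`: they are orthonormal, and so are the columns of some matrix `V` of right singular vectors,
where the `j`-th columns `u`, `v` of `U`, `V` satisfy `Y v = σ u` and `Yᵀ u = σ v` with `σ` the
`j`-th largest singular value of `Y`. -/
def IsLeadingLeftSingular {n m k : ℕ} (Y : Matrix (Fin n) (Fin m) ℝ)
    (U : Matrix (Fin n) (Fin k) ℝ) : Prop :=
  U.transpose * U = 1 ∧ ∃ V : Matrix (Fin m) (Fin k) ℝ, V.transpose * V = 1 ∧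
    Y * V = U * Matrix.diagonal (fun j : Fin k => singularValue Y (j + 1)) ∧
    Y.transpose * U = V * Matrix.diagonal (fun j : Fin k => singularValue Y (j + 1))

/-- `U` is a possible output of repeated-sampling RSVD on the symmetric matrix `M` with rank
parameter `k`, power `g` and sketching matrices `G 0, …, G (a - 1)`: among the sketches `M ^ g * G b`
one with the largest `k`-th singular value is chosen, and `U` consists of its `k` leading left
singular vectors. -/
def IsRSVDOutput {n a kt k : ℕ} (M : Matrix (Fin n) (Fin n) ℝ) (g : ℕ)
    (G : Fin a → Fin n → Fin kt → ℝ) (U : Matrix (Fin n) (Fin k) ℝ) : Prop :=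
  ∃ s : Fin a,
    (∀ b, singularValue (M ^ g * Matrix.of (G b)) k ≤ singularValue (M ^ g * Matrix.of (G s)) k) ∧
    IsLeadingLeftSingular (M ^ g * Matrix.of (G s)) U

/-! ### Clustering -/

/-- `σ` is an (exact) `K`-means clustering of the points `x i`: together with some centres it
minimizes the sum of the squared distances of the points to the centres of their clusters. -/
def IsKMeans {n K d : ℕ} (x : Fin n → EuclideanSpace ℝ (Fin d)) (σ : Fin n → Fin K) : Prop :=
  ∃ c : Fin K → EuclideanSpace ℝ (Fin d),
    ∀ (σ' : Fin n → Fin K) (c' : Fin K → EuclideanSpace ℝ (Fin d)),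
      ∑ i, ‖x i - c (σ i)‖ ^ 2 ≤ ∑ i, ‖x i - c' (σ' i)‖ ^ 2

/-- `σ` is an (exact) `K`-medians clustering of the points `x i`: together with some centres it
minimizes the sum of the distances of the points to the centres of their clusters. -/
def IsKMedians {n K d : ℕ} (x : Fin n → EuclideanSpace ℝ (Fin d)) (σ : Fin n → Fin K) : Prop :=
  ∃ c : Fin K → EuclideanSpace ℝ (Fin d),
    ∀ (σ' : Fin n → Fin K) (c' : Fin K → EuclideanSpace ℝ (Fin d)),
      ∑ i, ‖x i - c (σ i)‖ ≤ ∑ i, ‖x i - c' (σ' i)‖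

/-- `σ` is a possible output of RSVD-based spectral clustering into `K` clusters of the graph with
adjacency matrix `A`, with embedding dimension `d`, power `g` and sketching matrices `G`. -/
def IsRSVDClustering {n a kt K : ℕ} (A : Fin n → Fin n → ℝ) (d g : ℕ)
    (G : Fin a → Fin n → Fin kt → ℝ) (σ : Fin n → Fin K) : Prop :=
  ∃ U : Matrix (Fin n) (Fin d) ℝ, IsRSVDOutput (Matrix.of A) g G U ∧
    (IsKMeans (fun i => WithLp.toLp 2 (U i)) σ ∨ IsKMedians (fun i => WithLp.toLp 2 (U i)) σ)

/-- `σ` recovers `τ` exactly, i.e. up to a permutation of the labels. -/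
def ExactlyRecovers {n K : ℕ} (σ τ : Fin n → Fin K) : Prop :=
  ∃ ς : Equiv.Perm (Fin K), ∀ i, σ i = ς (τ i)

/-! Let `Z` be the membership matrix, `P = ρ B`-valued mean matrix `Z (ρ B) Zᵀ`, `E = A - P` and `q
= n ρ`. The computed singular vectors have the form `U = A ^ g F` with `F = G H`, where `G` is the
selected sketch and `H` consists of its right singular vectors divided by the singular values
(`IsLeadingLeftSingular.exists_right_factor`). The identity `A ^ g = E ^ g + ∑ E ^ j P A ^ (g - 1 -
j)`, `j < g`, exhibits the rows of `U`: since `P` factors through `Z`, the term `j = 0` is constant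
on blocks. Exact recovery follows once all other terms are, in every row, a small multiple of `n ^
(-1/2)`, because the block values are themselves separated on the scale `n ^ (-1/2)`
(`exists_pos_forall_row_separation`) and all blocks are large (`exactlyRecovers_of_separated`). No
perturbation theory for eigenvectors enters.

The errors are controlled by three facts, up to factors `D = n ^ δ`. The entries of `E ^ j Z` are at
most `q ^ (j/2)`, and the rows of `E ^ g` have squared norm at most `q ^ g`; this is the moment
method for walk sums (`IsWalkSum.abs_integral_le`, `measure_pow_mulVec_ge_le`). For vectors `v`
depending only on the graph and the labels, `vᵀ G` has norm at most `T |v|`. Finally `H` has norm at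
most `1 / (s (c₁ q) ^ g)`: the matrix `A` has `d` eigenvalues of order `q`, and a sketch whose
compression to their eigenvectors has smallest singular value `s` yields `σ_d (A ^ g G) ≥ s (c₁ q) ^
g`, a bound inherited by the maximizing sketch. The terms `1 ≤ j < g` are then of order `D ^ 2 q ^
(-j/2) n ^ (-1/2)`, and the term `E ^ g F` is of order `D ^ (3/2) q ^ (-g/2)`. The latter is small
against `n ^ (-1/2)` because `q ^ g` exceeds `n` by a power of `n`, which is the condition `g >
1/β`.

Repetition of the sketches makes `T ≤ n ^ δ s` possible: one sketch fails to be well conditioned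
with probability `exp (-k)` only, but `a` independent ones all fail with probability `exp (-a k)`,
and `a k ≥ 7 log n`. When `a` is so large that the maximum of the sketch norms is dominated by `log
a`, the best conditioned sketch improves accordingly (`eventually_exists_wellConditioned_level`). -/

/-! ### Moments of walk sums -/

/-- The unordered pairs of vertices, loops included, on which the entries of `symmMatrix` live. -/
abbrev EdgeIndex (n : ℕ) : Type := {p : Fin n × Fin n // p.1 ≤ p.2}

/-- The edge joining `i` and `j`. -/
def edge {n : ℕ} (i j : Fin n) : EdgeIndex n := ⟨(min i j, max i j), min_le_max⟩

lemma edge_injective {n : ℕ} (i : Fin n) : Function.Injective (edge i) := by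
  intro a b h
  simp only [edge, Subtype.mk.injEq, Prod.mk.injEq] at h
  obtain ⟨h1, h2⟩ := h
  rcases le_total i a with ha | ha <;> rcases le_total i b with hb | hb <;> simp_all
  exact le_antisymm h2 ha

/-- `X` is a polynomial of degree `N` in the edge variables with coefficients in `[-1, 1]`,
whose monomials, weighted by `n⁻¹` for each edge outside a given small set, are few. -/
def IsWalkSum {n : ℕ} (T N : ℕ) (X : (EdgeIndex n → ℝ) → ℝ) : Prop :=
  ∃ (Ω : Type) (_ : Fintype Ω) (c : Ω → ℝ) (L : Ω → EdgeIndex n → ℕ),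
    (∀ ω, |c ω| ≤ 1) ∧ (∀ ω, ∑ p, L ω p = N) ∧
    (∀ e, X e = ∑ ω, c ω * ∏ p, e p ^ L ω p) ∧
    ∀ F : Finset (EdgeIndex n), F.card + N ≤ T →
      ∑ ω, ((n : ℝ)⁻¹) ^ ((Finset.univ.filter (L ω · ≠ 0)) \ F).card ≤ ((T : ℝ) + 1) ^ N

lemma isWalkSum_const {n : ℕ} (T : ℕ) {c : ℝ} (hc : |c| ≤ 1) :
    IsWalkSum (n := n) T 0 (fun _ => c) :=
  ⟨Unit, inferInstance, fun _ => c, fun _ _ => 0, fun _ => hc, by simp, by simp, by simp⟩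

/-- The edges of the first factor are added to `F` before the second factor is counted, so the
weights factorize. This is the reason for the quantifier over `F` in `IsWalkSum`; the at most `N₁`
added edges are paid for by the budget `T`. -/
lemma IsWalkSum.mul {n T N₁ N₂ : ℕ} {X₁ X₂ : (EdgeIndex n → ℝ) → ℝ}
    (h₁ : IsWalkSum T N₁ X₁) (h₂ : IsWalkSum T N₂ X₂) :
    IsWalkSum T (N₁ + N₂) (fun e => X₁ e * X₂ e) := by
  obtain ⟨Ω₁, _, c₁, L₁, hc₁, hN₁, hX₁, hF₁⟩ := h₁
  obtain ⟨Ω₂, _, c₂, L₂, hc₂, hN₂, hX₂, hF₂⟩ := h₂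
  refine ⟨Ω₁ × Ω₂, inferInstance, fun w => c₁ w.1 * c₂ w.2, fun w p => L₁ w.1 p + L₂ w.2 p,
    ?_, ?_, ?_, ?_⟩
  · intro w
    rw [abs_mul]
    exact mul_le_one₀ (hc₁ _) (abs_nonneg _) (hc₂ _)
  · intro w
    rw [Finset.sum_add_distrib, hN₁, hN₂]
  · intro e
    beta_reduce
    rw [hX₁, hX₂, Finset.sum_mul_sum, Fintype.sum_prod_type]
    refine Finset.sum_congr rfl fun a _ => Finset.sum_congr rfl fun b _ => ?_
    simp only [pow_add, Finset.prod_mul_distrib]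
    ring
  · intro F hF
    have key : ∀ w : Ω₁ × Ω₂,
        ((Finset.univ.filter (fun p => L₁ w.1 p + L₂ w.2 p ≠ 0)) \ F).card =
        ((Finset.univ.filter (L₁ w.1 · ≠ 0)) \ F).card +
        ((Finset.univ.filter (L₂ w.2 · ≠ 0)) \
          (F ∪ (Finset.univ.filter (L₁ w.1 · ≠ 0)))).card := by
      intro w
      rw [← Finset.card_union_of_disjoint]
      · congr 1
        ext p
        simp only [Finset.mem_sdiff, Finset.mem_filter, Finset.mem_univ, true_and,
          Finset.mem_union]
        by_cases h1 : L₁ w.1 p = 0 <;> by_cases h2 : L₂ w.2 p = 0 <;> simp [h1, h2]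
      · rw [Finset.disjoint_left]
        intro p
        simp only [Finset.mem_sdiff, Finset.mem_filter, Finset.mem_univ, true_and,
          Finset.mem_union]
        tauto
    rw [Fintype.sum_prod_type]
    calc ∑ a, ∑ b, ((n : ℝ)⁻¹) ^
          ((Finset.univ.filter (fun p => L₁ a p + L₂ b p ≠ 0)) \ F).card
        = ∑ a, ((n : ℝ)⁻¹) ^ ((Finset.univ.filter (L₁ a · ≠ 0)) \ F).card *
            ∑ b, ((n : ℝ)⁻¹) ^ ((Finset.univ.filter (L₂ b · ≠ 0)) \
              (F ∪ (Finset.univ.filter (L₁ a · ≠ 0)))).card := by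
          refine Finset.sum_congr rfl fun a _ => ?_
          rw [Finset.mul_sum]
          refine Finset.sum_congr rfl fun b _ => ?_
          rw [key (a, b), pow_add]
      _ ≤ ∑ a, ((n : ℝ)⁻¹) ^ ((Finset.univ.filter (L₁ a · ≠ 0)) \ F).card *
            ((T : ℝ) + 1) ^ N₂ := by
          refine Finset.sum_le_sum fun a _ => mul_le_mul_of_nonneg_left (hF₂ _ ?_) (by positivity)
          have h1 : (Finset.univ.filter (L₁ a · ≠ 0)).card ≤ N₁ := by
            rw [← hN₁ a, Finset.card_eq_sum_ones, Finset.sum_filter]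
            refine Finset.sum_le_sum fun p _ => ?_
            split_ifs <;> omega
          have h2 := Finset.card_union_le F (Finset.univ.filter (L₁ a · ≠ 0))
          omega
      _ ≤ ((T : ℝ) + 1) ^ (N₁ + N₂) := by
          rw [← Finset.sum_mul, pow_add]
          exact mul_le_mul_of_nonneg_right (hF₁ F (by omega)) (by positivity)

lemma IsWalkSum.pow {n T N : ℕ} {X : (EdgeIndex n → ℝ) → ℝ} (h : IsWalkSum T N X) (k : ℕ) :
    IsWalkSum T (k * N) (fun e => X e ^ k) := by
  induction k with
  | zero => simpa using isWalkSum_const (n := n) T (c := 1) (by simp)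
  | succ k ih =>
    have := ih.mul h
    simpa [pow_succ, Nat.succ_mul] using this

/-- Either the new edge lies in `F`, which by `edge_injective` happens for at most `T` vertices `v`,
or it carries the weight `n⁻¹`, which offsets the `n` choices of `v`. One step thus costs a factor
`T + 1`. -/
lemma IsWalkSum.step {n T N : ℕ} (i : Fin n) {X : Fin n → (EdgeIndex n → ℝ) → ℝ}
    (h : ∀ v, IsWalkSum T N (X v)) :
    IsWalkSum T (N + 1) (fun e => ∑ v, e (edge i v) * X v e) := by
  choose Ω hΩ c L hc hN hX hF using h
  have hn : (n : ℝ) ≠ 0 := by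
    have := i.pos
    positivity
  refine ⟨Σ v, Ω v, inferInstance, fun w => c w.1 w.2,
    fun w p => L w.1 w.2 p + if p = edge i w.1 then 1 else 0, fun w => hc _ _, ?_, ?_, ?_⟩
  · intro w
    rw [Finset.sum_add_distrib, hN]
    simp
  · intro e
    rw [Fintype.sum_sigma]
    refine Finset.sum_congr rfl fun v _ => ?_
    rw [hX, Finset.mul_sum]
    refine Finset.sum_congr rfl fun w _ => ?_
    simp only [pow_add, Finset.prod_mul_distrib, pow_ite, pow_one, pow_zero]
    rw [Finset.prod_ite_eq' Finset.univ (edge i v)]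
    simp only [Finset.mem_univ, if_true]
    ring
  · intro F hcard
    have key : ∀ v (w : Ω v),
        ((Finset.univ.filter (fun p => L v w p + (if p = edge i v then 1 else 0) ≠ 0)) \ F).card =
        (if edge i v ∈ F then 0 else 1) +
        ((Finset.univ.filter (L v w · ≠ 0)) \ (insert (edge i v) F)).card := by
      intro v w
      split_ifs with hv
      · rw [zero_add]
        congr 1
        ext p
        simp only [Finset.mem_sdiff, Finset.mem_filter, Finset.mem_univ, true_and,
          Finset.mem_insert]
        by_cases hp : p = edge i v
        · subst hp; simp [hv]
        · simp [hp]
      · rw [add_comm, ← Finset.card_insert_of_notMem (a := edge i v)]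
        · congr 1
          ext p
          simp only [Finset.mem_sdiff, Finset.mem_filter, Finset.mem_univ, true_and,
            Finset.mem_insert]
          by_cases hp : p = edge i v
          · subst hp; simp [hv]
          · simp [hp]
        · simp
    rw [Fintype.sum_sigma]
    calc ∑ v, ∑ w : Ω v, ((n : ℝ)⁻¹) ^ ((Finset.univ.filter
          (fun p => L v w p + (if p = edge i v then 1 else 0) ≠ 0)) \ F).card
        = ∑ v, ((n : ℝ)⁻¹) ^ (if edge i v ∈ F then 0 else 1) * ∑ w : Ω v, ((n : ℝ)⁻¹) ^
            ((Finset.univ.filter (L v w · ≠ 0)) \ (insert (edge i v) F)).card := by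
          refine Finset.sum_congr rfl fun v _ => ?_
          rw [Finset.mul_sum]
          refine Finset.sum_congr rfl fun w _ => ?_
          rw [key v w, pow_add]
      _ ≤ ∑ v, ((n : ℝ)⁻¹) ^ (if edge i v ∈ F then 0 else 1) * ((T : ℝ) + 1) ^ N := by
          refine Finset.sum_le_sum fun v _ => mul_le_mul_of_nonneg_left (hF v _ ?_) (by positivity)
          have := Finset.card_insert_le (edge i v) F
          omega
      _ ≤ ((T : ℝ) + 1) ^ (N + 1) := by
          rw [← Finset.sum_mul, pow_succ, mul_comm]
          refine mul_le_mul_of_nonneg_left ?_ (by positivity)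
          have h1 : ∀ v, ((n : ℝ)⁻¹) ^ (if edge i v ∈ F then 0 else 1) ≤
              (if edge i v ∈ F then 1 else 0) + (n : ℝ)⁻¹ := by
            intro v
            split_ifs <;> simp
          calc ∑ v, ((n : ℝ)⁻¹) ^ (if edge i v ∈ F then 0 else 1)
              ≤ ∑ v, ((if edge i v ∈ F then (1 : ℝ) else 0) + (n : ℝ)⁻¹) :=
                Finset.sum_le_sum fun v _ => h1 v
            _ = ((Finset.univ.filter (fun v => edge i v ∈ F)).card : ℝ) + 1 := by
                rw [Finset.sum_add_distrib]
                simp [hn]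
            _ ≤ (T : ℝ) + 1 := by
                have h2 : (Finset.univ.filter (fun v => edge i v ∈ F)).card ≤ F.card :=
                  Finset.card_le_card_of_injOn (edge i) (by intro v; simp)
                    (edge_injective i).injOn
                have : (Finset.univ.filter (fun v => edge i v ∈ F)).card ≤ T := by omega
                gcongr

/-- The entries of `E ^ j z` are walk sums of length `j`. -/
lemma isWalkSum_pow_mulVec {n : ℕ} (T : ℕ) (z : Fin n → ℝ) (hz : ∀ i, |z i| ≤ 1) (j : ℕ) :
    ∀ i, IsWalkSum T j (fun e => ((Matrix.of (symmMatrix e)) ^ j).mulVec z i) := by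
  induction j with
  | zero => intro i; simpa using isWalkSum_const T (hz i)
  | succ j ih =>
    intro i
    have := IsWalkSum.step i ih
    convert this using 2 with e
    rw [pow_succ', ← Matrix.mulVec_mulVec]
    rfl

/-- A walk sum of length `2 k` in independent centred variables with moments at most `r` has
expectation `O((n r) ^ k)`. -/
lemma IsWalkSum.abs_integral_le {n T k : ℕ} {X : (EdgeIndex n → ℝ) → ℝ}
    (h : IsWalkSum T (2 * k) X) (hT : 2 * k ≤ T) {r : ℝ} (hr : 1 ≤ n * r)
    {μ : EdgeIndex n → Measure ℝ} [∀ p, IsProbabilityMeasure (μ p)] {m : EdgeIndex n → ℝ}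
    (hint : ∀ p l, Integrable (fun x => (x - m p) ^ l) (μ p))
    (hmean : ∀ p, ∫ x, (x - m p) ∂μ p = 0)
    (hmom : ∀ p l, 2 ≤ l → |∫ x, (x - m p) ^ l ∂μ p| ≤ r) :
    Integrable (fun x => X (fun p => x p - m p)) (Measure.pi μ) ∧
    |∫ x, X (fun p => x p - m p) ∂Measure.pi μ| ≤ (n * r) ^ k * ((T : ℝ) + 1) ^ (2 * k) := by
  obtain ⟨Ω, _, c, L, hc, hN, hX, hF⟩ := h
  have hmono : ∀ w, Integrable (fun x : EdgeIndex n → ℝ => ∏ p, (x p - m p) ^ L w p)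
      (Measure.pi μ) := fun w =>
    Integrable.fintype_prod_dep (f := fun p x => (x - m p) ^ L w p) fun p => hint p _
  have hXe : (fun x : EdgeIndex n → ℝ => X (fun p => x p - m p)) =
      fun x => ∑ w, c w * ∏ p, (x p - m p) ^ L w p := by
    funext x; rw [hX]
  refine ⟨?_, ?_⟩
  · rw [hXe]
    exact integrable_finsetSum _ fun w _ => (hmono w).const_mul _
  rw [hXe, integral_finsetSum _ fun w _ => (hmono w).const_mul _]
  have hn : 0 < (n : ℝ) := by
    rcases Nat.eq_zero_or_pos n with h0 | h0
    · subst h0; norm_num at hr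
    · exact_mod_cast h0
  have hr0 : 0 < r := by
    by_contra h0
    have : n * r ≤ 0 := mul_nonpos_of_nonneg_of_nonpos hn.le (not_lt.mp h0)
    linarith
  have hterm : ∀ w, |∫ x : EdgeIndex n → ℝ, c w * ∏ p, (x p - m p) ^ L w p ∂Measure.pi μ| ≤
      (n * r) ^ k * ((n : ℝ)⁻¹) ^ ((Finset.univ.filter (L w · ≠ 0)) \ ∅).card := by
    intro w
    rw [integral_const_mul, abs_mul,
      integral_fintype_prod_eq_prod (f := fun p x => (x - m p) ^ L w p), Finset.abs_prod,
      Finset.sdiff_empty]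
    set D := Finset.univ.filter (L w · ≠ 0) with hD
    have hpos : 0 ≤ (n * r) ^ k * ((n : ℝ)⁻¹) ^ D.card := by positivity
    -- A monomial with an edge of multiplicity one has mean zero, by independence and centring. In
    -- any other monomial the `2 k` factors occupy at most `k` distinct edges, and `n r ≥ 1` allows
    -- the exponent of `n r` to be raised to `k`.
    by_cases h1 : ∃ p, L w p = 1
    · obtain ⟨p, hp⟩ := h1
      rw [Finset.prod_eq_zero (Finset.mem_univ p) (by rw [hp]; simp [hmean]), mul_zero]
      exact hpos
    · push Not at h1
      have h2 : ∏ p, |∫ x, (x - m p) ^ L w p ∂μ p| ≤ ∏ p, (if L w p ≠ 0 then r else 1) := by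
        refine Finset.prod_le_prod (fun _ _ => abs_nonneg _) fun p _ => ?_
        split_ifs with h0
        · exact hmom p _ (by have := h1 p; omega)
        · push Not at h0
          simp [h0]
      rw [← Finset.prod_filter, Finset.prod_const] at h2
      have hcard : D.card ≤ k := by
        have : 2 * D.card ≤ 2 * k := by
          rw [← hN w, Finset.card_eq_sum_ones, hD, Finset.sum_filter, Finset.mul_sum]
          refine Finset.sum_le_sum fun p _ => ?_
          have := h1 p
          split_ifs <;> omega
        omega
      calc |c w| * ∏ p, |∫ x, (x - m p) ^ L w p ∂μ p| ≤ 1 * r ^ D.card :=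
            mul_le_mul (hc w) h2 (Finset.prod_nonneg fun _ _ => abs_nonneg _) zero_le_one
        _ = (n * r) ^ D.card * ((n : ℝ)⁻¹) ^ D.card := by
            rw [← mul_pow, one_mul]; congr 1; field_simp
        _ ≤ _ := by gcongr
  calc |∑ w, ∫ x : EdgeIndex n → ℝ, c w * ∏ p, (x p - m p) ^ L w p ∂Measure.pi μ|
      ≤ ∑ w, |∫ x : EdgeIndex n → ℝ, c w * ∏ p, (x p - m p) ^ L w p ∂Measure.pi μ| :=
        Finset.abs_sum_le_sum_abs _ _
    _ ≤ ∑ w, (n * r) ^ k * ((n : ℝ)⁻¹) ^ ((Finset.univ.filter (L w · ≠ 0)) \ ∅).card :=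
        Finset.sum_le_sum fun w _ => hterm w
    _ ≤ _ := by
        rw [← Finset.mul_sum]
        refine mul_le_mul_of_nonneg_left (hF ∅ (by simpa using hT)) (by positivity)

/-- Entrywise concentration of `E ^ j z` for the noise matrix `E` with independent entries. -/
lemma measure_pow_mulVec_ge_le {n T j k : ℕ} (hT : 2 * (k * j) ≤ T) {r : ℝ} (hr : 1 ≤ n * r)
    {μ : EdgeIndex n → Measure ℝ} [∀ p, IsProbabilityMeasure (μ p)] {m : EdgeIndex n → ℝ}
    (hint : ∀ p l, Integrable (fun x => (x - m p) ^ l) (μ p))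
    (hmean : ∀ p, ∫ x, (x - m p) ∂μ p = 0)
    (hmom : ∀ p l, 2 ≤ l → |∫ x, (x - m p) ^ l ∂μ p| ≤ r)
    (z : Fin n → ℝ) (hz : ∀ i, |z i| ≤ 1) (i : Fin n) {D : ℝ} (hD : 0 < D) :
    (Measure.pi μ).real {x | Real.sqrt (n * r) ^ j * D ≤
      |((Matrix.of (symmMatrix (fun p => x p - m p))) ^ j).mulVec z i|} ≤
      ((T : ℝ) + 1) ^ T / D ^ (2 * k) := by
  have h0 := ((isWalkSum_pow_mulVec T z hz j i).pow (2 * k))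
  rw [mul_assoc] at h0
  obtain ⟨h1, h2⟩ := h0.abs_integral_le hT hr hint hmean hmom
  set Y : (EdgeIndex n → ℝ) → ℝ :=
    fun x => ((Matrix.of (symmMatrix (fun p => x p - m p))) ^ j).mulVec z i with hY
  have hpow : ∀ x, 0 ≤ Y x ^ (2 * k) := fun x => (even_two_mul k).pow_nonneg _
  have hnr : 0 < Real.sqrt (n * r) := Real.sqrt_pos.mpr (by linarith)
  set t : ℝ := Real.sqrt (n * r) ^ j * D with ht
  have htpos : 0 < t := by positivity
  -- Markov's inequality for the `2 k`-th moment; with `D` a small power of `n`, a large `k` beats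
  -- any power of `n`.
  have hM := mul_meas_ge_le_integral_of_nonneg (μ := Measure.pi μ)
    (f := fun x => Y x ^ (2 * k)) (Eventually.of_forall hpow) h1 (t ^ (2 * k))
  have hsub : {x | t ≤ |Y x|} ⊆ {x | t ^ (2 * k) ≤ Y x ^ (2 * k)} := by
    intro x hx
    simp only [Set.mem_ofPred_eq] at hx ⊢
    rw [← Even.pow_abs (even_two_mul k) (Y x)]
    exact pow_le_pow_left₀ htpos.le hx _
  have hle : (Measure.pi μ).real {x | t ≤ |Y x|} ≤
      (Measure.pi μ).real {x | t ^ (2 * k) ≤ Y x ^ (2 * k)} := measureReal_mono hsub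
  have htk : t ^ (2 * k) = (n * r) ^ (k * j) * D ^ (2 * k) := by
    rw [ht, mul_pow, ← pow_mul, show j * (2 * k) = 2 * (k * j) by ring, pow_mul,
      Real.sq_sqrt (by linarith)]
  have hpos : 0 < (n * r) ^ (k * j) := by positivity
  rw [le_div_iff₀ (by positivity)]
  refine le_of_mul_le_mul_left ?_ hpos
  have hfin := le_trans hM (le_trans (le_abs_self _) h2)
  calc (n * r) ^ (k * j) * ((Measure.pi μ).real {x | t ≤ |Y x|} * D ^ (2 * k))
      = t ^ (2 * k) * (Measure.pi μ).real {x | t ≤ |Y x|} := by rw [htk]; ring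
    _ ≤ t ^ (2 * k) * (Measure.pi μ).real {x | t ^ (2 * k) ≤ Y x ^ (2 * k)} := by gcongr
    _ ≤ (n * r) ^ (k * j) * ((T : ℝ) + 1) ^ (2 * (k * j)) := hfin
    _ ≤ (n * r) ^ (k * j) * ((T : ℝ) + 1) ^ T := by
        gcongr
        linarith [(Nat.cast_nonneg T : (0 : ℝ) ≤ T)]

/-! ### Gaussian matrices -/

/-- The law of an array of independent standard Gaussian variables. -/
noncomputable def gaussianArray (α β : Type*) [Fintype α] [Fintype β] : Measure (α → β → ℝ) :=
  Measure.pi fun _ => Measure.pi fun _ => gaussianReal 0 1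

instance (α β : Type*) [Fintype α] [Fintype β] : IsProbabilityMeasure (gaussianArray α β) := by
  unfold gaussianArray; infer_instance

/-- Only the sum of the squared coefficients of `D` enters. This is the rotation invariance behind
`map_gaussianArray`. -/
lemma charFunDual_gaussianArray {α β : Type*} [Fintype α] [Fintype β] [DecidableEq α]
    [DecidableEq β] (D : StrongDual ℝ (α → β → ℝ)) :
    charFunDual (gaussianArray α β) D =
      Complex.exp (-((∑ a, ∑ b, D (Pi.single a (Pi.single b 1)) ^ 2 : ℝ) : ℂ) / 2) := by
  have h1 : ∀ L : StrongDual ℝ ℝ, charFunDual (gaussianReal 0 1) L =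
      Complex.exp (-((L 1 ^ 2 : ℝ) : ℂ) / 2) := by
    intro L
    have := charFun_map_eq_charFunDual_smul (μ := gaussianReal 0 1) (ContinuousLinearMap.id ℝ ℝ)
      (L 1)
    have hL : L 1 • ContinuousLinearMap.id ℝ ℝ = L := by
      ext; simp
    rw [hL] at this
    have hid : (gaussianReal 0 1).map (ContinuousLinearMap.id ℝ ℝ) = gaussianReal 0 1 :=
      Measure.map_id
    rw [← this, hid, charFun_gaussianReal]
    simp [neg_div]
  unfold gaussianArray
  rw [charFunDual_pi]
  simp_rw [charFunDual_pi, h1]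
  simp_rw [← Complex.exp_sum]
  congr 1
  push_cast
  rw [← Finset.sum_neg_distrib, Finset.sum_div]
  refine Finset.sum_congr rfl fun a _ => ?_
  rw [← Finset.sum_neg_distrib, Finset.sum_div]
  rfl

/-- Orthonormal linear combinations of independent standard Gaussian variables are again
independent standard Gaussian variables. -/
lemma map_gaussianArray {α β γ δ : Type*} [Fintype α] [Fintype β] [Fintype γ] [Fintype δ]
    [DecidableEq γ] [DecidableEq δ] (c : γ → δ → α → β → ℝ)
    (hc : ∀ x y x' y', ∑ a, ∑ b, c x y a b * c x' y' a b =
      if x = x' then (if y = y' then 1 else 0) else 0) :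
    (gaussianArray α β).map (fun G x y => ∑ a, ∑ b, c x y a b * G a b) = gaussianArray γ δ := by
  classical
  let L : (α → β → ℝ) →L[ℝ] (γ → δ → ℝ) :=
    LinearMap.toContinuousLinearMap
      { toFun := fun G x y => ∑ a, ∑ b, c x y a b * G a b
        map_add' := by
          intro G H; ext x y; simp [mul_add, Finset.sum_add_distrib]
        map_smul' := by
          intro t G; ext x y
          simp only [Pi.smul_apply, smul_eq_mul, RingHom.id_apply, Finset.mul_sum]
          refine Finset.sum_congr rfl fun _ _ => Finset.sum_congr rfl fun _ _ => by ring }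
  have hL : (fun (G : α → β → ℝ) x y => ∑ a, ∑ b, c x y a b * G a b) = L := rfl
  rw [hL]
  have : IsProbabilityMeasure ((gaussianArray α β).map L) :=
    Measure.isProbabilityMeasure_map (by fun_prop)
  -- It remains to compare the sums of squared coefficients of `D` and of `D.comp L`, which agree by
  -- the orthonormality of `c`.
  refine Measure.ext_of_charFunDual ?_
  ext D
  rw [charFunDual_map, charFunDual_gaussianArray, charFunDual_gaussianArray]
  congr 4
  have hD : ∀ w : γ → δ → ℝ, D w = ∑ x, ∑ y, w x y * D (Pi.single x (Pi.single y 1)) := by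
    intro w
    have hw : w = ∑ x, ∑ y, w x y • (Pi.single x (Pi.single y 1) : γ → δ → ℝ) := by
      ext x y
      simp only [Finset.sum_apply, Pi.smul_apply, smul_eq_mul, Pi.single_apply]
      rw [Finset.sum_eq_single x, Finset.sum_eq_single y]
      · simp
      · intro b _ hb; simp [hb.symm]
      · simp
      · intro b _ hb; simp [hb.symm]
      · simp
    conv_lhs => rw [hw]
    simp [map_sum]
  set u : γ → δ → ℝ := fun x y => D (Pi.single x (Pi.single y 1)) with hu
  have hLs : ∀ a b, (D.comp L) (Pi.single a (Pi.single b 1)) = ∑ x, ∑ y, c x y a b * u x y := by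
    intro a b
    rw [ContinuousLinearMap.comp_apply, hD]
    refine Finset.sum_congr rfl fun x _ => Finset.sum_congr rfl fun y _ => ?_
    congr 1
    change ∑ a', ∑ b', c x y a' b' * (Pi.single a (Pi.single b 1) : α → β → ℝ) a' b' = _
    rw [Finset.sum_eq_single a, Finset.sum_eq_single b]
    · simp
    · intro b' _ hb; simp [hb]
    · simp
    · intro b' _ hb; simp [hb]
    · simp
  calc ∑ a, ∑ b, (D.comp L) (Pi.single a (Pi.single b 1)) ^ 2
      = ∑ a, ∑ b, ∑ p : γ × δ, ∑ p' : γ × δ,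
          (u p.1 p.2 * u p'.1 p'.2) * (c p.1 p.2 a b * c p'.1 p'.2 a b) := by
        refine Finset.sum_congr rfl fun a _ => Finset.sum_congr rfl fun b _ => ?_
        rw [hLs, ← Fintype.sum_prod_type' (f := fun x y => c x y a b * u x y), sq,
          Finset.sum_mul_sum]
        refine Finset.sum_congr rfl fun p _ => Finset.sum_congr rfl fun p' _ => by ring
    _ = ∑ p : γ × δ, ∑ p' : γ × δ, (u p.1 p.2 * u p'.1 p'.2) *
          ∑ a, ∑ b, (c p.1 p.2 a b * c p'.1 p'.2 a b) := by
        simp_rw [Finset.mul_sum]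
        rw [Finset.sum_congr rfl fun a _ => Finset.sum_comm, Finset.sum_comm]
        refine Finset.sum_congr rfl fun p _ => ?_
        rw [Finset.sum_congr rfl fun a _ => Finset.sum_comm, Finset.sum_comm]
    _ = ∑ p : γ × δ, u p.1 p.2 ^ 2 := by
        refine Finset.sum_congr rfl fun p _ => ?_
        rw [Finset.sum_eq_single p]
        · rw [hc]; simp [sq]
        · intro p' _ hp'
          rw [hc]
          by_cases h1 : p.1 = p'.1
          · by_cases h2 : p.2 = p'.2
            · exact absurd (Prod.ext h1 h2).symm hp'
            · simp [h2]
          · simp [h1]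
        · simp
    _ = _ := Fintype.sum_prod_type _

/-- Chernoff's bound for sums over a product space. -/
lemma measure_pi_sum_ge_le {ι Ω : Type*} [Fintype ι] [MeasurableSpace Ω] {μ : Measure Ω}
    [IsProbabilityMeasure μ] {f : Ω → ℝ} (hf : Integrable (fun x => Real.exp (f x)) μ) (u : ℝ) :
    (Measure.pi fun _ : ι => μ).real {x | u ≤ ∑ i, f (x i)} ≤
      Real.exp (-u) * (∫ x, Real.exp (f x) ∂μ) ^ Fintype.card ι := by
  have h1 : Integrable (fun x : ι → Ω => ∏ i, Real.exp (f (x i))) (Measure.pi fun _ : ι => μ) :=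
    Integrable.fintype_prod (f := fun _ x => Real.exp (f x)) fun _ => hf
  have h2 := mul_meas_ge_le_integral_of_nonneg (μ := Measure.pi fun _ : ι => μ)
    (f := fun x => ∏ i, Real.exp (f (x i)))
    (Eventually.of_forall fun x => Finset.prod_nonneg fun _ _ => (Real.exp_pos _).le) h1
    (Real.exp u)
  rw [integral_fintype_prod_eq_pow (f := fun x => Real.exp (f x))] at h2
  have h3 : {x : ι → Ω | u ≤ ∑ i, f (x i)} = {x | Real.exp u ≤ ∏ i, Real.exp (f (x i))} := by
    ext x
    simp only [Set.mem_ofPred_eq]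
    rw [← Real.exp_sum, Real.exp_le_exp]
  rw [h3, Real.exp_neg, ← div_eq_inv_mul, le_div_iff₀ (Real.exp_pos _), mul_comm]
  exact h2

/-- The integral equals `√2`; the weaker bound `exp 1` turns its `k`-th power into `exp k`. -/
lemma integral_exp_sq_div_four_gaussianReal :
    Integrable (fun x : ℝ => Real.exp (x ^ 2 / 4)) (gaussianReal 0 1) ∧
    ∫ x, Real.exp (x ^ 2 / 4) ∂gaussianReal 0 1 ≤ Real.exp 1 := by
  have hpdf : ∀ x : ℝ, gaussianPDFReal 0 1 x * Real.exp (x ^ 2 / 4) =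
      (√(2 * Real.pi))⁻¹ * Real.exp (-(1 / 4) * x ^ 2) := by
    intro x
    rw [gaussianPDFReal_def]
    simp only [NNReal.coe_one, mul_one, sub_zero]
    rw [mul_assoc, ← Real.exp_add]
    congr 2
    ring
  refine ⟨?_, ?_⟩
  · rw [gaussianReal_of_var_ne_zero _ one_ne_zero]
    rw [integrable_withDensity_iff (measurable_gaussianPDF 0 1)
      (Eventually.of_forall fun _ => gaussianPDF_lt_top)]
    have : (fun x : ℝ => Real.exp (x ^ 2 / 4) * (gaussianPDF 0 1 x).toReal) =
        fun x => (√(2 * Real.pi))⁻¹ * Real.exp (-(1 / 4) * x ^ 2) := by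
      funext x
      rw [toReal_gaussianPDF, mul_comm, hpdf]
    rw [this]
    exact (integrable_exp_neg_mul_sq (by norm_num)).const_mul _
  · rw [integral_gaussianReal_eq_integral_smul one_ne_zero]
    simp only [smul_eq_mul, hpdf]
    rw [integral_const_mul, integral_gaussian]
    have h2 : Real.pi / (1 / 4) = (2 * Real.pi) * 2 := by ring
    rw [h2, Real.sqrt_mul (by positivity) 2, ← mul_assoc, inv_mul_cancel₀ (by positivity), one_mul]
    have := Real.add_one_le_exp (1 : ℝ)
    have : √2 ≤ 2 := by
      rw [Real.sqrt_le_left (by norm_num)]; norm_num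
    linarith

/-- Tail bound for the norm of `vᵀ G`. -/
lemma measure_vecMul_gaussian_ge_le {n k : ℕ} (v : Fin n → ℝ) (T : ℝ) :
    (gaussianArray (Fin n) (Fin k)).real
      {G | T ^ 2 * (v ⬝ᵥ v) < ∑ q, (∑ i, v i * G i q) ^ 2} ≤ Real.exp (k - T ^ 2 / 4) := by
  rcases eq_or_ne v 0 with hv | hv
  · subst hv
    simp [Real.exp_nonneg]
  have hvv : 0 < v ⬝ᵥ v := by
    have := Matrix.dotProduct_self_star_pos_iff (v := v)
    simpa using this.mpr hv
  -- After division by the norm of `v`, the coordinates of `vᵀ G` are `k` independent standard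
  -- Gaussians. The index `Unit` only fills the second slot of `gaussianArray`.
  set c : Fin k → Unit → Fin n → Fin k → ℝ :=
    fun q _ i q' => if q = q' then v i / √(v ⬝ᵥ v) else 0 with hc
  have hmap := map_gaussianArray c (by
    intro q _ q' _
    simp only [hc, mul_ite, ite_mul, zero_mul, mul_zero]
    by_cases hq : q = q'
    · subst hq
      simp only [if_true]
      have : ∀ i, ∑ x, (if q = x then (if q = x then v i / √(v ⬝ᵥ v) * (v i / √(v ⬝ᵥ v)) else 0)
          else 0) = v i * v i / (v ⬝ᵥ v) := by
        intro i
        rw [Finset.sum_eq_single q]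
        · simp only [if_true]
          rw [div_mul_div_comm, Real.mul_self_sqrt hvv.le]
        · intro b _ hb; simp [hb.symm]
        · simp
      simp only [this]
      rw [← Finset.sum_div]
      exact div_self hvv.ne'
    · rw [if_neg hq]
      refine Finset.sum_eq_zero fun i _ => Finset.sum_eq_zero fun x _ => ?_
      split_ifs with h1 h2
      · exact absurd (h2.trans h1.symm) hq
      · rfl
      · rfl)
  have hceval : ∀ (G : Fin n → Fin k → ℝ) q y, ∑ i, ∑ q', c q y i q' * G i q' =
      (∑ i, v i * G i q) / √(v ⬝ᵥ v) := by
    intro G q y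
    rw [Finset.sum_div]
    refine Finset.sum_congr rfl fun i _ => ?_
    simp only [hc, ite_mul, zero_mul]
    rw [Finset.sum_ite_eq]
    simp only [Finset.mem_univ, if_true]
    ring
  obtain ⟨hi, hle⟩ := integral_exp_sq_div_four_gaussianReal
  have hfe : (fun x : Unit → ℝ => Real.exp (∑ y, x y ^ 2 / 4)) =
      fun x => ∏ y, Real.exp (x y ^ 2 / 4) := by
    funext x; rw [Real.exp_sum]
  have hch := measure_pi_sum_ge_le (ι := Fin k) (μ := Measure.pi fun _ : Unit => gaussianReal 0 1)
    (f := fun x => ∑ y, x y ^ 2 / 4)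
    (by rw [hfe]; exact Integrable.fintype_prod (f := fun _ x => Real.exp (x ^ 2 / 4))
          fun _ => hi) (T ^ 2 / 4)
  rw [hfe, integral_fintype_prod_eq_pow (f := fun x => Real.exp (x ^ 2 / 4))] at hch
  simp only [Fintype.card_unit, pow_one, Fintype.card_fin] at hch
  set W : Set (Fin k → Unit → ℝ) := {x | T ^ 2 / 4 ≤ ∑ q, ∑ y, x q y ^ 2 / 4} with hW
  have hWm : MeasurableSet W := by
    refine measurableSet_le measurable_const ?_
    fun_prop
  have hsub : {G : Fin n → Fin k → ℝ | T ^ 2 * (v ⬝ᵥ v) < ∑ q, (∑ i, v i * G i q) ^ 2} ⊆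
      (fun G x y => ∑ a, ∑ b, c x y a b * G a b) ⁻¹' W := by
    intro G hG
    simp only [Set.mem_ofPred_eq] at hG
    simp only [hW, Set.mem_preimage, Set.mem_ofPred_eq, hceval, Finset.univ_unique,
      Finset.sum_const, Finset.card_singleton, one_smul, ← Finset.sum_div, div_pow,
      Real.sq_sqrt hvv.le]
    refine div_le_div_of_nonneg_right ?_ (by norm_num)
    rw [le_div_iff₀ hvv]
    exact hG.le
  calc _ ≤ (gaussianArray (Fin n) (Fin k)).real
          ((fun G x y => ∑ a, ∑ b, c x y a b * G a b) ⁻¹' W) := measureReal_mono hsub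
    _ = (gaussianArray (Fin k) Unit).real W := by
        rw [← hmap, measureReal_def, measureReal_def, Measure.map_apply (by fun_prop) hWm]
    _ ≤ Real.exp (-(T ^ 2 / 4)) * (∫ x, Real.exp (x ^ 2 / 4) ∂gaussianReal 0 1) ^ k := hch
    _ ≤ Real.exp (-(T ^ 2 / 4)) * Real.exp 1 ^ k := by
        gcongr
    _ = _ := by
        rw [← Real.exp_nat_mul, ← Real.exp_add]
        ring_nf

/-! ### Well-conditioned Gaussian matrices -/

/-- The smallest singular value of the `d × k` matrix `X`, `d ≤ k`, is at least `s`. -/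
def IsWellConditioned {d k : ℕ} (s : ℝ) (X : Fin d → Fin k → ℝ) : Prop :=
  ∀ y : Fin d → ℝ, s ^ 2 * (y ⬝ᵥ y) ≤ ∑ q, (∑ x, y x * X x q) ^ 2

/-- The conditions for the uncountably many `y` are closed in `G`, hence so is their intersection.
-/
lemma measurableSet_isWellConditioned {d k n : ℕ} (s : ℝ) (R : Matrix (Fin d) (Fin n) ℝ) :
    MeasurableSet {G : Fin n → Fin k → ℝ |
      IsWellConditioned s (fun x q => ∑ i, R x i * G i q)} := by
  have : {G : Fin n → Fin k → ℝ | IsWellConditioned s (fun x q => ∑ i, R x i * G i q)} =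
      ⋂ y : Fin d → ℝ, {G | s ^ 2 * (y ⬝ᵥ y) ≤ ∑ q, (∑ x, y x * ∑ i, R x i * G i q) ^ 2} := by
    ext G; simp [IsWellConditioned]
  rw [this]
  exact (isClosed_iInter fun y => isClosed_le (by fun_prop) (by fun_prop)).measurableSet

/-- The outer measure defining a product measure is the largest one with the right bound on boxes,
so boxes suffice. The purpose is to transfer Lebesgue null sets of matrices to the Gaussian law. -/
lemma pi_le_pi {ι : Type*} [Fintype ι] {α : Type*} [MeasurableSpace α] {μ ν : Measure α}
    [SigmaFinite μ] [SigmaFinite ν] (h : μ ≤ ν) :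
    (Measure.pi fun _ : ι => μ) ≤ Measure.pi fun _ : ι => ν := by
  have h1 : (Measure.pi fun _ : ι => μ).toOuterMeasure ≤
      OuterMeasure.pi fun _ : ι => ν.toOuterMeasure := by
    rw [OuterMeasure.le_pi]
    intro s _
    calc (Measure.pi fun _ : ι => μ) (Set.pi Set.univ s) = ∏ i, μ (s i) := Measure.pi_pi _ _
      _ ≤ ∏ i, ν (s i) := Finset.prod_le_prod' fun i _ => h (s i)
  refine Measure.le_iff.mpr fun s hs => ?_
  rw [Measure.pi_def (fun _ : ι => ν), toMeasure_apply _ _ hs]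
  exact h1 s

lemma gaussianReal_le_volume : gaussianReal 0 1 ≤ (volume : Measure ℝ) := by
  refine Measure.le_iff.mpr fun s hs => ?_
  rw [gaussianReal_apply _ one_ne_zero]
  calc ∫⁻ x in s, gaussianPDF 0 1 x ≤ ∫⁻ _ in s, 1 := by
        refine lintegral_mono fun x => ?_
        rw [gaussianPDF, ← ENNReal.ofReal_one]
        refine ENNReal.ofReal_le_ofReal ?_
        rw [gaussianPDFReal_def]
        simp only [NNReal.coe_one, mul_one, sub_zero]
        refine mul_le_one₀ (inv_le_one_of_one_le₀ ?_) (Real.exp_nonneg _)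
          (Real.exp_le_one_iff.mpr ?_)
        · rw [Real.one_le_sqrt]; nlinarith [Real.pi_gt_three]
        · have := sq_nonneg x; linarith
    _ = volume s := by simp

/-- The square matrix with entries `Z`. -/
def squareOf {d : ℕ} (Z : Fin d × Fin d → ℝ) : Matrix (Fin d) (Fin d) ℝ :=
  Matrix.of fun x y => Z (x, y)

lemma measurable_det_squareOf {d : ℕ} :
    Measurable fun Z : Fin d × Fin d → ℝ => (squareOf Z).det := by
  simp only [Matrix.det_apply, squareOf, Matrix.of_apply]
  fun_prop

/-- Along the direction of the identity the determinant is a monic polynomial in the parameter `t`,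
with finitely many zeros. By Fubini some translate of the zero set in this direction is null, and
Lebesgue measure is translation invariant. -/
lemma volume_det_eq_zero {d : ℕ} :
    volume {Z : Fin d × Fin d → ℝ | (squareOf Z).det = 0} = 0 := by
  set N := {Z : Fin d × Fin d → ℝ | (squareOf Z).det = 0} with hN
  have hNm : MeasurableSet N := measurable_det_squareOf (measurableSet_singleton 0)
  let J : Fin d × Fin d → ℝ := fun p => if p.1 = p.2 then 1 else 0
  let s : Set ((Fin d × Fin d → ℝ) × ℝ) := {w | w.1 + w.2 • J ∈ N}
  have hs : MeasurableSet s := by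
    have : Measurable fun w : (Fin d × Fin d → ℝ) × ℝ => w.1 + w.2 • J := by fun_prop
    exact this hNm
  have h0 : (volume.prod volume : Measure ((Fin d × Fin d → ℝ) × ℝ)) s = 0 := by
    rw [Measure.measure_prod_null hs]
    refine Eventually.of_forall fun Z => ?_
    refine Set.Finite.measure_zero ?_ _
    have : Prod.mk Z ⁻¹' s ⊆ {t | (-(squareOf Z)).charpoly.IsRoot t} := by
      intro t ht
      have ht' : (squareOf (Z + t • J)).det = 0 := ht
      simp only [Set.mem_ofPred_eq, Polynomial.IsRoot.def, Matrix.eval_charpoly]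
      rw [← ht']
      congr 1
      ext x y
      by_cases hxy : x = y
      · subst hxy; simp [squareOf, J, add_comm]
      · simp [squareOf, J, hxy]
    exact (Polynomial.finite_setOfPred_isRoot (Matrix.charpoly_monic _).ne_zero).subset this
  have h1 : (volume.prod volume : Measure (ℝ × (Fin d × Fin d → ℝ))) (Prod.swap ⁻¹' s) = 0 := by
    rw [← Measure.map_apply measurable_swap hs, Measure.prod_swap, h0]
  have h2 := Measure.measure_ae_null_of_prod_null h1
  obtain ⟨t, ht⟩ := h2.exists
  have h3 : Prod.mk t ⁻¹' (Prod.swap ⁻¹' s) = (fun Z => Z + t • J) ⁻¹' N := rfl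
  beta_reduce at ht
  rw [h3] at ht
  simpa [measure_preimage_add_right] using ht

/-- A lower bound for the square of the smallest singular value of a square matrix. -/
noncomputable def invNormSq {d : ℕ} (Z : Fin d × Fin d → ℝ) : ℝ :=
  (∑ x, ∑ y, (squareOf Z)⁻¹ x y ^ 2)⁻¹

lemma invNormSq_nonneg {d : ℕ} (Z : Fin d × Fin d → ℝ) : 0 ≤ invNormSq Z :=
  inv_nonneg.mpr (Finset.sum_nonneg fun _ _ => Finset.sum_nonneg fun _ _ => sq_nonneg _)

lemma measurable_invNormSq {d : ℕ} : Measurable (invNormSq (d := d)) := by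
  unfold invNormSq
  refine Measurable.inv (Finset.measurable_sum _ fun x _ => Finset.measurable_sum _ fun y _ =>
    Measurable.pow_const ?_ 2)
  simp only [Matrix.inv_def, Matrix.smul_apply, smul_eq_mul, Ring.inverse_eq_inv']
  refine measurable_det_squareOf.inv.mul ?_
  have : Continuous fun Z : Fin d × Fin d → ℝ => (squareOf Z).adjugate x y := by
    have h1 : Continuous fun Z : Fin d × Fin d → ℝ => squareOf Z := by
      unfold squareOf
      refine continuous_matrix fun i j => ?_
      simp only [Matrix.of_apply]
      fun_prop
    exact (h1.matrix_adjugate).matrix_elem x y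
  exact this.measurable

lemma invNormSq_pos {d : ℕ} (hd : 0 < d) {Z : Fin d × Fin d → ℝ} (hZ : (squareOf Z).det ≠ 0) :
    0 < invNormSq Z := by
  refine inv_pos.mpr (lt_of_le_of_ne
    (Finset.sum_nonneg fun _ _ => Finset.sum_nonneg fun _ _ => sq_nonneg _) fun h => ?_)
  have h1 : (squareOf Z)⁻¹ = 0 := by
    ext x y
    have h2 := (Finset.sum_eq_zero_iff_of_nonneg (fun x _ =>
      Finset.sum_nonneg fun _ _ => sq_nonneg _)).mp h.symm x (Finset.mem_univ x)
    have h3 := (Finset.sum_eq_zero_iff_of_nonneg (fun _ _ => sq_nonneg _)).mp h2 y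
      (Finset.mem_univ y)
    simpa using h3
  have h4 := Matrix.mul_nonsing_inv (squareOf Z) (isUnit_iff_ne_zero.mpr hZ)
  rw [h1, mul_zero] at h4
  have := congrFun (congrFun h4 ⟨0, hd⟩) ⟨0, hd⟩
  simp at this

/-- Write `y = (y Z) Z⁻¹` and apply Cauchy–Schwarz. For singular `Z` the inverse is zero by
convention, so `invNormSq Z = 0` and nothing is claimed. -/
lemma invNormSq_mul_le {d : ℕ} (Z : Fin d × Fin d → ℝ) (y : Fin d → ℝ) :
    invNormSq Z * (y ⬝ᵥ y) ≤ ∑ q, (∑ x, y x * Z (x, q)) ^ 2 := by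
  set S := ∑ x, ∑ y, (squareOf Z)⁻¹ x y ^ 2 with hS
  have hS0 : 0 ≤ S := Finset.sum_nonneg fun _ _ => Finset.sum_nonneg fun _ _ => sq_nonneg _
  have hrhs : 0 ≤ ∑ q, (∑ x, y x * Z (x, q)) ^ 2 := Finset.sum_nonneg fun _ _ => sq_nonneg _
  rcases hS0.eq_or_lt with h0 | h0
  · unfold invNormSq
    rw [← hS, ← h0, inv_zero, zero_mul]
    exact hrhs
  have hdet : IsUnit (squareOf Z).det := by
    by_contra hdet
    rw [Matrix.nonsing_inv_apply_not_isUnit _ hdet] at hS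
    simp at hS
    linarith
  unfold invNormSq
  rw [← hS, inv_mul_le_iff₀ h0]
  have hy : y = Matrix.vecMul (Matrix.vecMul y (squareOf Z)) (squareOf Z)⁻¹ := by
    rw [Matrix.vecMul_vecMul, Matrix.mul_nonsing_inv _ hdet, Matrix.vecMul_one]
  have hw : ∀ q, Matrix.vecMul y (squareOf Z) q = ∑ x, y x * Z (x, q) := fun q => rfl
  calc y ⬝ᵥ y = ∑ j, (∑ q, (∑ x, y x * Z (x, q)) * (squareOf Z)⁻¹ q j) ^ 2 := by
        refine Finset.sum_congr rfl fun j _ => ?_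
        have : y j = ∑ q, (∑ x, y x * Z (x, q)) * (squareOf Z)⁻¹ q j := by
          conv_lhs => rw [hy]
          rfl
        rw [← this, sq]
    _ ≤ ∑ j, (∑ q, (∑ x, y x * Z (x, q)) ^ 2) * ∑ q, (squareOf Z)⁻¹ q j ^ 2 :=
        Finset.sum_le_sum fun j _ => Finset.sum_mul_sq_le_sq_mul_sq _ _ _
    _ = S * ∑ q, (∑ x, y x * Z (x, q)) ^ 2 := by
        rw [← Finset.mul_sum, mul_comm, hS, Finset.sum_comm]

/-- The law of an array of independent standard Gaussian `d × d` matrices is the image of the law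
of a Gaussian matrix under an orthonormal compression and a selection of columns. -/
lemma map_mul_gaussianArray {n k d m : ℕ} {R : Matrix (Fin d) (Fin n) ℝ}
    (hR : R * R.transpose = 1) {col : Fin m → Fin d → Fin k}
    (hcol : Function.Injective fun p : Fin m × Fin d => col p.1 p.2) :
    (gaussianArray (Fin n) (Fin k)).map
      (fun G b (p : Fin d × Fin d) => ∑ i, R p.1 i * G i (col b p.2)) =
    gaussianArray (Fin m) (Fin d × Fin d) := by
  set c : Fin m → Fin d × Fin d → Fin n → Fin k → ℝ :=
    fun b p i q => if q = col b p.2 then R p.1 i else 0 with hc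
  have := map_gaussianArray c (by
    intro b p b' p'
    have h1 : ∀ i, ∑ q, c b p i q * c b' p' i q =
        if col b p.2 = col b' p'.2 then R p.1 i * R p'.1 i else 0 := by
      intro i
      simp only [hc, ite_mul, zero_mul]
      rw [Finset.sum_ite_eq']
      simp
    simp only [h1]
    have h2 : ∑ i, R p.1 i * R p'.1 i = (1 : Matrix (Fin d) (Fin d) ℝ) p.1 p'.1 := by
      rw [← hR]; rfl
    by_cases h : col b p.2 = col b' p'.2
    · have h3 := hcol (a₁ := (b, p.2)) (a₂ := (b', p'.2)) h
      simp only [Prod.mk.injEq] at h3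
      simp only [if_true, h2, h3.1, Matrix.one_apply, Prod.ext_iff, h3.2, and_true]
    · simp only [if_neg h, Finset.sum_const_zero]
      split_ifs with h3 h4
      · subst h3 h4; exact absurd rfl h
      · rfl
      · rfl)
  rw [← this]
  congr 1
  funext G b p
  refine Finset.sum_congr rfl fun i _ => ?_
  simp [hc]

lemma sum_comp_le_sum_of_injective {α β : Type*} [Fintype α] [Fintype β] {f : α → β}
    (hf : Function.Injective f) {g : β → ℝ} (hg : ∀ b, 0 ≤ g b) : ∑ a, g (f a) ≤ ∑ b, g b := by
  classical
  rw [← Finset.sum_image (s := Finset.univ) (g := f) (f := g) (fun _ _ _ _ h => hf h)]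
  exact Finset.sum_le_sum_of_subset_of_nonneg (Finset.subset_univ _) fun _ _ _ => hg _

/-- The integrand tends to zero as `θ → ∞` wherever the determinant is nonzero, hence almost surely,
and dominated convergence applies. No quantitative bound on the smallest singular value is needed,
since `d` is fixed. -/
lemma exists_integral_exp_invNormSq_le {d : ℕ} (hd : 0 < d) {ε : ℝ} (hε : 0 < ε) :
    ∃ θ : ℝ, 0 < θ ∧ ∫ Z, Real.exp (-θ * invNormSq Z)
      ∂(Measure.pi fun _ : Fin d × Fin d => gaussianReal 0 1) ≤ ε := by
  set μ := Measure.pi fun _ : Fin d × Fin d => gaussianReal 0 1 with hμ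
  have hae : ∀ᵐ Z ∂μ, 0 < invNormSq Z := by
    have h1 : μ {Z | (squareOf Z).det = 0} = 0 := by
      refine le_antisymm ?_ zero_le
      rw [← volume_det_eq_zero (d := d)]
      exact (pi_le_pi (ι := Fin d × Fin d) gaussianReal_le_volume) _
    have h2 : ∀ᵐ Z ∂μ, (squareOf Z).det ≠ 0 := by
      rw [ae_iff]; simpa using h1
    filter_upwards [h2] with Z hZ using invNormSq_pos hd hZ
  have ht : Tendsto (fun θ : ℝ => ∫ Z, Real.exp (-θ * invNormSq Z) ∂μ) atTop
      (𝓝 (∫ _, (0 : ℝ) ∂μ)) := by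
    refine tendsto_integral_filter_of_dominated_convergence (fun _ => 1)
      (Eventually.of_forall fun θ => ?_) ?_ (integrable_const _) ?_
    · exact ((measurable_invNormSq.const_mul _).exp).aestronglyMeasurable
    · filter_upwards [eventually_ge_atTop 0] with θ hθ
      refine Eventually.of_forall fun Z => ?_
      rw [Real.norm_eq_abs, abs_of_pos (Real.exp_pos _), Real.exp_le_one_iff]
      have := mul_nonneg hθ (invNormSq_nonneg Z)
      linarith
    · filter_upwards [hae] with Z hZ
      refine Real.tendsto_exp_atBot.comp ?_
      simp only [neg_mul]
      exact tendsto_neg_atTop_atBot.comp (tendsto_id.atTop_mul_const hZ)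
  rw [integral_zero] at ht
  obtain ⟨θ, h1, h2⟩ := ((ht.eventually_lt_const hε).and (eventually_gt_atTop 0)).exists
  exact ⟨θ, h2, h1.le⟩

/-- A compressed Gaussian matrix is well conditioned up to an exponentially small probability. -/
lemma exists_measure_not_isWellConditioned_le {d : ℕ} (hd : 0 < d) :
    ∃ c : ℝ, 0 < c ∧ ∀ (n k : ℕ), d ≤ k → ∀ R : Matrix (Fin d) (Fin n) ℝ, R * R.transpose = 1 →
      (gaussianArray (Fin n) (Fin k)).real
        {G | ¬ IsWellConditioned √(c * k) (fun x q => ∑ i, R x i * G i q)} ≤ Real.exp (-k) := by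
  -- With `m` square blocks the Chernoff bound becomes `exp m * exp (-(2 d + 1) m) = exp (-2 d m)`,
  -- which is at most `exp (-k)` as `k ≤ 2 d m`.
  obtain ⟨θ, hθ, hint⟩ := exists_integral_exp_invNormSq_le hd (Real.exp_pos (-(2 * d + 1)))
  have hd' : (0 : ℝ) < d := by exact_mod_cast hd
  refine ⟨1 / (2 * d * θ), by positivity, fun n k hk R hR => ?_⟩
  -- The columns are cut into `m` disjoint groups of `d`, the remainder being dropped. The
  -- compressed groups are independent square Gaussian matrices, and their lower bounds `invNormSq`
  -- add up.
  set m := k / d with hm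
  have hmk : m * d ≤ k := Nat.div_mul_le_self k d
  have hm1 : 1 ≤ m := (Nat.one_le_div_iff hd).mpr hk
  have hkm : (k : ℝ) ≤ 2 * d * m := by
    have h1 : k < d * (m + 1) := by
      rw [hm]; exact Nat.lt_mul_div_succ k hd
    have h2 : d * (m + 1) ≤ 2 * d * m := by nlinarith
    exact_mod_cast h1.le.trans h2
  let col : Fin m → Fin d → Fin k := fun b y => Fin.castLE hmk (finProdFinEquiv (b, y))
  have hcol : Function.Injective fun p : Fin m × Fin d => col p.1 p.2 := by
    intro p p' h
    exact finProdFinEquiv.injective (Fin.castLE_injective hmk h)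
  have hmap := map_mul_gaussianArray hR hcol
  set W : Set (Fin m → Fin d × Fin d → ℝ) := {Z | -(m : ℝ) ≤ ∑ b, -θ * invNormSq (Z b)} with hW
  have hWm : MeasurableSet W := by
    refine measurableSet_le measurable_const (Finset.measurable_sum _ fun b _ => ?_)
    exact (measurable_invNormSq.comp (measurable_pi_apply b)).const_mul _
  have hsub : {G : Fin n → Fin k → ℝ |
      ¬ IsWellConditioned √(1 / (2 * d * θ) * k) (fun x q => ∑ i, R x i * G i q)} ⊆
      (fun G b (p : Fin d × Fin d) => ∑ i, R p.1 i * G i (col b p.2)) ⁻¹' W := by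
    intro G hG
    simp only [Set.mem_ofPred_eq] at hG
    by_contra hGW
    refine hG fun y => ?_
    set Z : Fin m → Fin d × Fin d → ℝ := fun b p => ∑ i, R p.1 i * G i (col b p.2) with hZ
    have h1 : ∑ b, -θ * invNormSq (Z b) < -(m : ℝ) := not_le.mp hGW
    rw [← Finset.mul_sum] at h1
    have h2 : (m : ℝ) / θ ≤ ∑ b, invNormSq (Z b) := by
      rw [div_le_iff₀ hθ]; linarith
    have hyy : 0 ≤ y ⬝ᵥ y := Finset.sum_nonneg fun _ _ => mul_self_nonneg _
    rw [Real.sq_sqrt (by positivity)]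
    calc 1 / (2 * d * θ) * k * (y ⬝ᵥ y) ≤ (m / θ) * (y ⬝ᵥ y) := by
          refine mul_le_mul_of_nonneg_right ?_ hyy
          rw [div_mul_eq_mul_div, one_mul, div_le_div_iff₀ (by positivity) hθ]
          nlinarith
      _ ≤ (∑ b, invNormSq (Z b)) * (y ⬝ᵥ y) := mul_le_mul_of_nonneg_right h2 hyy
      _ ≤ ∑ b, ∑ q, (∑ x, y x * Z b (x, q)) ^ 2 := by
          rw [Finset.sum_mul]
          exact Finset.sum_le_sum fun b _ => invNormSq_mul_le _ _
      _ = ∑ p : Fin m × Fin d, (∑ x, y x * ∑ i, R x i * G i (col p.1 p.2)) ^ 2 := by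
          rw [Fintype.sum_prod_type]
      _ ≤ _ := sum_comp_le_sum_of_injective hcol
          (g := fun q => (∑ x, y x * ∑ i, R x i * G i q) ^ 2) fun _ => sq_nonneg _
  have hch := measure_pi_sum_ge_le (ι := Fin m)
    (μ := Measure.pi fun _ : Fin d × Fin d => gaussianReal 0 1)
    (f := fun Z => -θ * invNormSq Z) (by
      refine Integrable.of_bound ((measurable_invNormSq.const_mul _).exp).aestronglyMeasurable 1
        (Eventually.of_forall fun Z => ?_)
      rw [Real.norm_eq_abs, abs_of_pos (Real.exp_pos _), Real.exp_le_one_iff]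
      have := mul_nonneg hθ.le (invNormSq_nonneg Z)
      linarith) (-(m : ℝ))
  calc _ ≤ (gaussianArray (Fin n) (Fin k)).real
        ((fun G b (p : Fin d × Fin d) => ∑ i, R p.1 i * G i (col b p.2)) ⁻¹' W) :=
        measureReal_mono hsub
    _ = (gaussianArray (Fin m) (Fin d × Fin d)).real W := by
        rw [← hmap, measureReal_def, measureReal_def, Measure.map_apply (by fun_prop) hWm]
    _ ≤ Real.exp (-(-(m : ℝ))) * Real.exp (-(2 * d + 1)) ^ m := by
        refine hch.trans ?_
        rw [Fintype.card_fin]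
        gcongr
    _ ≤ Real.exp (-k) := by
        rw [← Real.exp_nat_mul, ← Real.exp_add, Real.exp_le_exp]
        nlinarith

/-- On the interval `x ≤ t + 1 ≤ 2 t`, so the density is at least `exp (-1 - 2 t ^ 2)`. -/
lemma exp_le_gaussianReal_Icc {t u : ℝ} (ht : 1 ≤ t) (hu : 0 ≤ u) (hut : u ≤ t) :
    Real.exp (-3 * t ^ 2) ≤ (gaussianReal 0 1).real (Set.Icc u (u + 1)) := by
  rw [measureReal_def, gaussianReal_apply _ one_ne_zero,
    ← ENNReal.ofReal_le_iff_le_toReal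
      ((gaussianReal_apply (0 : ℝ) one_ne_zero (Set.Icc u (u + 1))) ▸ measure_ne_top _ _)]
  calc ENNReal.ofReal (Real.exp (-3 * t ^ 2))
      = ∫⁻ _ in Set.Icc u (u + 1), ENNReal.ofReal (Real.exp (-3 * t ^ 2)) := by
        simp
    _ ≤ ∫⁻ x in Set.Icc u (u + 1), gaussianPDF 0 1 x := by
        refine setLIntegral_mono' measurableSet_Icc fun x hx => ?_
        rw [gaussianPDF]
        refine ENNReal.ofReal_le_ofReal ?_
        rw [gaussianPDFReal_def]
        simp only [NNReal.coe_one, mul_one, sub_zero]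
        have hx1 := hx.1
        have hx2 := hx.2
        have h1 : Real.exp (-1) ≤ (√(2 * Real.pi))⁻¹ := by
          rw [Real.exp_neg]
          refine inv_anti₀ (by positivity) ?_
          have h2 : √(2 * Real.pi) ≤ √(2.7 ^ 2) :=
            Real.sqrt_le_sqrt (by nlinarith [Real.pi_lt_d2])
          rw [Real.sqrt_sq (by norm_num)] at h2
          linarith [Real.exp_one_gt_d9]
        calc Real.exp (-3 * t ^ 2) ≤ Real.exp (-1) * Real.exp (-x ^ 2 / 2) := by
              rw [← Real.exp_add, Real.exp_le_exp]
              nlinarith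
          _ ≤ _ := by gcongr

/-- A compressed Gaussian matrix is very well conditioned with a probability that is not too
small. -/
lemma measure_not_isWellConditioned_le {d n k : ℕ} (hk : d ≤ k) {R : Matrix (Fin d) (Fin n) ℝ}
    (hR : R * R.transpose = 1) {t : ℝ} (ht : 1 ≤ t) (htd : d ≤ t) :
    (gaussianArray (Fin n) (Fin k)).real
      {G | ¬ IsWellConditioned (t - d) (fun x q => ∑ i, R x i * G i q)} ≤
      1 - Real.exp (-3 * t ^ 2 * d ^ 2) := by
  let col : Fin 1 → Fin d → Fin k := fun _ y => Fin.castLE hk y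
  have hcol : Function.Injective fun p : Fin 1 × Fin d => col p.1 p.2 := by
    intro p p' h
    exact Prod.ext (Subsingleton.elim _ _) (Fin.castLE_injective hk h)
  have hmap := map_mul_gaussianArray hR hcol
  -- The favourable event puts the first `d` compressed columns entrywise between `t I` and `t I`
  -- plus the all-ones matrix. Such a matrix satisfies `⟨y X, y⟩ ≥ t |y| ^ 2 - (∑ |y x|) ^ 2 ≥ (t -
  -- d) |y| ^ 2`.
  let u : Fin d × Fin d → ℝ := fun p => if p.1 = p.2 then t else 0
  set W : Set (Fin 1 → Fin d × Fin d → ℝ) :=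
    Set.pi Set.univ fun _ => Set.pi Set.univ fun p => Set.Icc (u p) (u p + 1) with hW
  have hWm : MeasurableSet W := MeasurableSet.univ_pi fun _ =>
    MeasurableSet.univ_pi fun _ => measurableSet_Icc
  have hPW : Real.exp (-3 * t ^ 2 * d ^ 2) ≤ (gaussianArray (Fin 1) (Fin d × Fin d)).real W := by
    rw [gaussianArray, measureReal_def, hW, Measure.pi_pi]
    simp only [Measure.pi_pi, Finset.univ_unique, Finset.prod_const, Finset.card_singleton,
      pow_one, ENNReal.toReal_prod]
    calc Real.exp (-3 * t ^ 2 * d ^ 2) = ∏ _p : Fin d × Fin d, Real.exp (-3 * t ^ 2) := by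
          rw [Finset.prod_const, ← Real.exp_nat_mul]
          simp only [Finset.card_univ, Fintype.card_prod, Fintype.card_fin]
          push_cast
          congr 1
          ring
      _ ≤ _ := by
          refine Finset.prod_le_prod (fun _ _ => (Real.exp_pos _).le) fun p _ => ?_
          refine exp_le_gaussianReal_Icc ht ?_ ?_ <;> simp only [u] <;> split_ifs <;> linarith
  have hsub : (fun G b (p : Fin d × Fin d) => ∑ i, R p.1 i * G i (col b p.2)) ⁻¹' W ⊆
      {G : Fin n → Fin k → ℝ |
        IsWellConditioned (t - d) (fun x q => ∑ i, R x i * G i q)} := by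
    intro G hG y
    set Z : Fin d × Fin d → ℝ := fun p => ∑ i, R p.1 i * G i (col 0 p.2) with hZ
    have hZb : ∀ p, Z p ∈ Set.Icc (u p) (u p + 1) := fun p => hG 0 trivial p trivial
    set w : Fin d → ℝ := fun q => ∑ x, y x * Z (x, q) with hw
    have hyy : 0 ≤ y ⬝ᵥ y := Finset.sum_nonneg fun _ _ => mul_self_nonneg _
    have h1 : (t - d) * (y ⬝ᵥ y) ≤ w ⬝ᵥ y := by
      have hterm : ∀ q x, (if x = q then t * y q ^ 2 else 0) - |y x| * |y q| ≤
          y x * Z (x, q) * y q := by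
        intro q x
        have hz := hZb (x, q)
        by_cases hxq : x = q
        · subst hxq
          simp only [u, if_true, Set.mem_Icc] at hz ⊢
          rw [abs_mul_abs_self]
          nlinarith [mul_self_nonneg (y x), mul_le_mul_of_nonneg_left hz.1 (mul_self_nonneg (y x))]
        · simp only [u, if_neg hxq, Set.mem_Icc, zero_add, zero_sub] at hz ⊢
          rw [← abs_mul]
          have h2 : |y x * Z (x, q) * y q| ≤ |y x * y q| := by
            rw [show y x * Z (x, q) * y q = (y x * y q) * Z (x, q) by ring, abs_mul]
            exact mul_le_of_le_one_right (abs_nonneg _) (abs_le.mpr ⟨by linarith, hz.2⟩)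
          linarith [neg_abs_le (y x * Z (x, q) * y q)]
      have hsq : (∑ x, |y x|) ^ 2 ≤ d * (y ⬝ᵥ y) := by
        have := sq_sum_le_card_mul_sum_sq (s := Finset.univ) (f := fun x => |y x|)
        simpa [dotProduct, sq] using this
      calc (t - d) * (y ⬝ᵥ y) ≤ t * (y ⬝ᵥ y) - (∑ x, |y x|) ^ 2 := by linarith
        _ = ∑ q, ∑ x, ((if x = q then t * y q ^ 2 else 0) - |y x| * |y q|) := by
            simp only [Finset.sum_sub_distrib, Finset.sum_ite_eq', Finset.mem_univ, if_true]
            rw [sq, Finset.sum_mul_sum, Finset.sum_comm (f := fun q x => |y x| * |y q|),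
              ← Finset.mul_sum]
            simp [dotProduct, sq]
        _ ≤ ∑ q, ∑ x, y x * Z (x, q) * y q :=
            Finset.sum_le_sum fun q _ => Finset.sum_le_sum fun x _ => hterm q x
        _ = w ⬝ᵥ y := by
            refine Finset.sum_congr rfl fun q _ => ?_
            rw [hw, Finset.sum_mul]
    have h2 : (w ⬝ᵥ y) ^ 2 ≤ (∑ q, w q ^ 2) * (y ⬝ᵥ y) := by
      have := Finset.sum_mul_sq_le_sq_mul_sq Finset.univ w y
      simpa [dotProduct, sq] using this
    have h3 : (t - d) ^ 2 * (y ⬝ᵥ y) ≤ ∑ q, w q ^ 2 := by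
      rcases hyy.eq_or_lt with h0 | h0
      · rw [← h0, mul_zero]; exact Finset.sum_nonneg fun _ _ => sq_nonneg _
      · refine le_of_mul_le_mul_right ?_ h0
        have h4 : ((t - d) * (y ⬝ᵥ y)) ^ 2 ≤ (w ⬝ᵥ y) ^ 2 :=
          pow_le_pow_left₀ (mul_nonneg (by linarith) hyy) h1 2
        calc (t - d) ^ 2 * (y ⬝ᵥ y) * (y ⬝ᵥ y) = ((t - d) * (y ⬝ᵥ y)) ^ 2 := by ring
          _ ≤ _ := h4.trans h2
    exact h3.trans (sum_comp_le_sum_of_injective (Fin.castLE_injective hk)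
      (g := fun q => (∑ x, y x * ∑ i, R x i * G i q) ^ 2) fun _ => sq_nonneg _)
  have hcompl := probReal_compl_eq_one_sub (μ := gaussianArray (Fin n) (Fin k))
    (measurableSet_isWellConditioned (k := k) (t - d) R)
  have h5 : (gaussianArray (Fin 1) (Fin d × Fin d)).real W ≤ (gaussianArray (Fin n) (Fin k)).real
      {G | IsWellConditioned (t - d) (fun x q => ∑ i, R x i * G i q)} := by
    rw [← hmap, measureReal_def, Measure.map_apply (by fun_prop) hWm]
    exact measureReal_mono hsub
  change (gaussianArray (Fin n) (Fin k)).real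
    {G | IsWellConditioned (t - d) (fun x q => ∑ i, R x i * G i q)}ᶜ ≤ _
  rw [hcompl]
  linarith

lemma eventually_const_mul_log_le_rpow (c : ℝ) {δ : ℝ} (hδ : 0 < δ) :
    ∀ᶠ n : ℕ in atTop, c * Real.log n ≤ (n : ℝ) ^ δ := by
  have h1 := ((isLittleO_log_rpow_atTop hδ).const_mul_left c).bound (c := 1) one_pos
  filter_upwards [tendsto_natCast_atTop_atTop.eventually h1] with n hn
  rw [one_mul, Real.norm_eq_abs, Real.norm_eq_abs,
    abs_of_nonneg (Real.rpow_nonneg (Nat.cast_nonneg n) δ)] at hn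
  exact (le_abs_self _).trans hn

lemma eventually_le_natCast_rpow (M : ℝ) {δ : ℝ} (hδ : 0 < δ) :
    ∀ᶠ n : ℕ in atTop, M ≤ (n : ℝ) ^ δ :=
  ((tendsto_rpow_atTop hδ).comp tendsto_natCast_atTop_atTop).eventually_ge_atTop M

/-- Among `a` sketches of width `k`, with `a k` at least of order `log n`, some sketch has a
smallest singular value comparable with the norms of all compressed sketches. -/
lemma eventually_exists_wellConditioned_level {d : ℕ} (hd : 0 < d) {δ : ℝ} (hδ : 0 < δ) :
    ∀ᶠ n : ℕ in atTop, ∀ k a : ℕ, d ≤ k → 1 ≤ a → 7 * Real.log n ≤ a * k →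
      ∃ s : ℝ, 0 < s ∧ 4 * (k + Real.log a + 9 * Real.log n) ≤ ((n : ℝ) ^ δ * s) ^ 2 ∧
      ∀ R : Matrix (Fin d) (Fin n) ℝ, R * R.transpose = 1 →
        (gaussianArray (Fin n) (Fin k)).real
          {G | ¬ IsWellConditioned s (fun x q => ∑ i, R x i * G i q)} ^ a ≤
        Real.exp (-(7 * Real.log n)) := by
  obtain ⟨c, hc, hS1⟩ := exists_measure_not_isWellConditioned_le hd
  filter_upwards [eventually_const_mul_log_le_rpow 14 hδ, eventually_le_natCast_rpow 1 hδ,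
    eventually_le_natCast_rpow (12 / c) hδ,
    eventually_le_natCast_rpow (24 * d ^ 4 + 6 * d ^ 2 + 288 * d ^ 2) hδ,
    eventually_ge_atTop 1] with n hlog hx1 hxc hxd hn k a hk ha hak
  set x := (n : ℝ) ^ δ with hx
  have hd1 : (1 : ℝ) ≤ d := by exact_mod_cast hd
  have hk1 : (1 : ℝ) ≤ k := by exact_mod_cast hd.trans_le hk
  have hln : 0 ≤ Real.log n := Real.log_natCast_nonneg n
  have hla : 0 ≤ Real.log a := Real.log_natCast_nonneg a
  -- As long as `log a` is at most `k n ^ δ`, the typical level `√(c k)` suffices and all sketches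
  -- fail with probability at most `exp (-a k)`. For larger `a`, the norms to be matched are of
  -- order `√(log a)`, and so is the level that the best sketch reaches.
  rcases le_or_gt (Real.log a) (k * x) with hcase | hcase
  · have hck : 0 < c * k := by positivity
    refine ⟨√(c * k), Real.sqrt_pos.mpr hck, ?_, fun R hR => ?_⟩
    · rw [mul_pow, Real.sq_sqrt hck.le]
      have h12 : 12 ≤ x * c := (div_le_iff₀ hc).mp hxc
      have h9 : 9 * Real.log n ≤ k * x := by nlinarith
      calc 4 * (k + Real.log a + 9 * Real.log n) ≤ 12 * (k * x) := by nlinarith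
        _ ≤ (x * c) * (k * x) := by gcongr
        _ = x ^ 2 * (c * k) := by ring
    · calc _ ≤ Real.exp (-k) ^ a := by
            gcongr
            exact hS1 n k hk R hR
        _ = Real.exp (-(a * k)) := by rw [← Real.exp_nat_mul]; congr 1; ring
        _ ≤ _ := by rw [Real.exp_le_exp]; linarith
  · set l := Real.log a with hl
    have hxl : x ≤ l := by nlinarith
    have hkl : (k : ℝ) ≤ l := by nlinarith
    -- This choice makes the success probability `exp (-3 t ^ 2 d ^ 2)` of one sketch equal to `a ^
    -- (-1/2)`, so that all `a` sketches fail with probability at most `exp (-√a)`.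
    set t := √(l / (6 * d ^ 2)) with ht
    have ht2 : t ^ 2 = l / (6 * d ^ 2) := Real.sq_sqrt (by positivity)
    have h2d : 2 * d ≤ t := by
      refine Real.le_sqrt_of_sq_le ?_
      rw [le_div_iff₀ (by positivity)]
      nlinarith [sq_nonneg (d : ℝ)]
    have ht1 : 1 ≤ t := by linarith
    refine ⟨t - d, by linarith, ?_, fun R hR => ?_⟩
    · have h1 : t ^ 2 / 4 ≤ (t - d) ^ 2 := by nlinarith
      have h2 : 12 * l ≤ x * (t ^ 2 / 4) := by
        rw [ht2, div_div, mul_div_assoc', le_div_iff₀ (by positivity)]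
        have : 288 * (d : ℝ) ^ 2 ≤ x := by nlinarith [sq_nonneg (d : ℝ), sq_nonneg ((d : ℝ) ^ 2)]
        nlinarith
      calc 4 * (k + l + 9 * Real.log n) ≤ 12 * l := by linarith
        _ ≤ x * (t ^ 2 / 4) := h2
        _ ≤ x ^ 2 * (t ^ 2 / 4) := by
            gcongr
            nlinarith
        _ ≤ x ^ 2 * (t - d) ^ 2 := by gcongr
        _ = _ := by ring
    · have h3 : -3 * t ^ 2 * (d : ℝ) ^ 2 = -(l / 2) := by
        rw [ht2]; field_simp; ring
      have h4 := measure_not_isWellConditioned_le hk hR ht1 (by linarith)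
      rw [h3] at h4
      have hae : (a : ℝ) = Real.exp l := (Real.exp_log (by exact_mod_cast ha)).symm
      calc _ ≤ (1 - Real.exp (-(l / 2))) ^ a := by gcongr
        _ ≤ Real.exp (-Real.exp (-(l / 2))) ^ a := by
            gcongr
            · have : Real.exp (-(l / 2)) ≤ 1 := Real.exp_le_one_iff.mpr (by linarith)
              linarith
            · have := Real.add_one_le_exp (-Real.exp (-(l / 2)))
              linarith
        _ = Real.exp (-Real.exp (l / 2)) := by
            rw [← Real.exp_nat_mul, hae, mul_neg, ← Real.exp_add]
            congr 3
            ring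
        _ ≤ _ := by
            rw [Real.exp_le_exp]
            have := Real.add_one_le_exp (l / 2)
            linarith

/-- With high probability all compressed sketches have norms of at most a level `T`, and some
sketch is well conditioned at a level `s ≥ n ^ (-δ) T`. -/
lemma eventually_exists_sketch_set {d : ℕ} (hd : 0 < d) {δ : ℝ} (hδ : 0 < δ) :
    ∀ᶠ n : ℕ in atTop, ∀ k a : ℕ, d ≤ k → 1 ≤ a → 7 * Real.log n ≤ a * k →
      ∃ T s : ℝ, 0 ≤ T ∧ 0 < s ∧ T ≤ (n : ℝ) ^ δ * s ∧
      ∀ R : Matrix (Fin d) (Fin n) ℝ, R * R.transpose = 1 →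
      ∀ vs : Finset (Fin n → ℝ), vs.card ≤ n ^ 2 →
      ∃ S : Set (Fin a → Fin n → Fin k → ℝ), MeasurableSet S ∧
        (sketchLaw a n k).real Sᶜ ≤ 2 / (n : ℝ) ^ 7 ∧
        ∀ G ∈ S, (∀ b, ∀ v ∈ vs, ∑ q, (∑ i, v i * G b i q) ^ 2 ≤ T ^ 2 * (v ⬝ᵥ v)) ∧
          ∃ b, IsWellConditioned s (fun x q => ∑ i, R x i * G b i q) := by
  filter_upwards [eventually_exists_wellConditioned_level hd hδ, eventually_ge_atTop 1]
    with n hlev hn k a hk ha hak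
  obtain ⟨s, hs, hTs, hR⟩ := hlev k a hk ha hak
  have hn0 : (0 : ℝ) < n := by exact_mod_cast hn
  have ha0 : (0 : ℝ) < a := by exact_mod_cast ha
  have hln : 0 ≤ Real.log n := Real.log_natCast_nonneg n
  have hla : 0 ≤ Real.log a := Real.log_natCast_nonneg a
  -- The tail `exp (k - T ^ 2 / 4)` is then `1 / (a n ^ 9)`, which leaves `n ^ (-7)` after the union
  -- over `a` sketches and `n ^ 2` vectors.
  set T := √(4 * (k + Real.log a + 9 * Real.log n)) with hT
  have hT2 : T ^ 2 = 4 * (k + Real.log a + 9 * Real.log n) := Real.sq_sqrt (by positivity)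
  refine ⟨T, s, Real.sqrt_nonneg _, hs, ?_, fun R hRR vs hvs => ?_⟩
  · rw [hT, Real.sqrt_le_left (by positivity)]
    exact hTs
  have hexp : ∀ m : ℕ, Real.exp (-(m * Real.log n)) = 1 / (n : ℝ) ^ m := by
    intro m
    rw [Real.exp_neg, Real.exp_nat_mul, Real.exp_log hn0, one_div]
  set good : Set (Fin n → Fin k → ℝ) :=
    {G | IsWellConditioned s (fun x q => ∑ i, R x i * G i q)} with hgood
  let bad : (Fin n → ℝ) → Set (Fin n → Fin k → ℝ) :=
    fun v => {G | T ^ 2 * (v ⬝ᵥ v) < ∑ q, (∑ i, v i * G i q) ^ 2}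
  have hbadm : ∀ v, MeasurableSet (bad v) := fun v => measurableSet_lt (by fun_prop) (by fun_prop)
  set S₁ : Set (Fin a → Fin n → Fin k → ℝ) := Set.pi Set.univ fun _ => goodᶜ with hS₁
  set S₂ : Set (Fin a → Fin n → Fin k → ℝ) :=
    ⋃ p ∈ (Finset.univ ×ˢ vs : Finset (Fin a × (Fin n → ℝ))), {G | G p.1 ∈ bad p.2} with hS₂
  have hS₁m : MeasurableSet S₁ :=
    MeasurableSet.univ_pi fun _ => (measurableSet_isWellConditioned s R).compl
  have hS₂m : MeasurableSet S₂ := Finset.measurableSet_biUnion _ fun p _ =>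
    measurable_pi_apply p.1 (hbadm p.2)
  refine ⟨(S₁ ∪ S₂)ᶜ, (hS₁m.union hS₂m).compl, ?_, ?_⟩
  · rw [compl_compl]
    have hP₁ : (sketchLaw a n k).real S₁ ≤ 1 / (n : ℝ) ^ 7 := by
      have h1 : (sketchLaw a n k).real S₁ = (gaussianArray (Fin n) (Fin k)).real goodᶜ ^ a := by
        rw [measureReal_def, hS₁, sketchLaw, Measure.pi_pi, Finset.prod_const, Finset.card_univ,
          Fintype.card_fin, ENNReal.toReal_pow]
        rfl
      rw [h1, ← hexp 7]
      exact hR R hRR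
    have hP₂ : (sketchLaw a n k).real S₂ ≤ 1 / (n : ℝ) ^ 7 := by
      have h2 : ∀ p : Fin a × (Fin n → ℝ), (sketchLaw a n k).real {G | G p.1 ∈ bad p.2} ≤
          1 / a * (1 / (n : ℝ) ^ 9) := by
        intro p
        have h3 := (measurePreserving_eval
          (fun _ : Fin a => gaussianArray (Fin n) (Fin k)) p.1).measure_preimage
            (hbadm p.2).nullMeasurableSet
        have h4 : (sketchLaw a n k).real {G | G p.1 ∈ bad p.2} =
            (gaussianArray (Fin n) (Fin k)).real (bad p.2) := by
          rw [measureReal_def, measureReal_def, ← h3]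
          rfl
        rw [h4]
        refine (measure_vecMul_gaussian_ge_le p.2 T).trans (le_of_eq ?_)
        rw [hT2, ← hexp 9, one_div, ← Real.exp_log ha0, ← Real.exp_neg, ← Real.exp_add,
          Real.exp_log ha0]
        congr 1
        push_cast
        ring
      calc (sketchLaw a n k).real S₂
          ≤ ∑ p ∈ (Finset.univ ×ˢ vs : Finset (Fin a × (Fin n → ℝ))),
              (sketchLaw a n k).real {G | G p.1 ∈ bad p.2} := measureReal_biUnion_finset_le _ _
        _ ≤ ∑ p ∈ (Finset.univ ×ˢ vs : Finset (Fin a × (Fin n → ℝ))), 1 / a * (1 / (n : ℝ) ^ 9) :=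
            Finset.sum_le_sum fun p _ => h2 p
        _ = vs.card * (1 / (n : ℝ) ^ 9) := by
            rw [Finset.sum_const, Finset.card_product, Finset.card_univ, Fintype.card_fin]
            rw [nsmul_eq_mul]
            push_cast
            field_simp
        _ ≤ (n : ℝ) ^ 2 * (1 / (n : ℝ) ^ 9) := by
            gcongr
            exact_mod_cast hvs
        _ = 1 / (n : ℝ) ^ 7 := by field_simp
    calc _ ≤ (sketchLaw a n k).real S₁ + (sketchLaw a n k).real S₂ := measureReal_union_le _ _
      _ ≤ 1 / (n : ℝ) ^ 7 + 1 / (n : ℝ) ^ 7 := add_le_add hP₁ hP₂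
      _ = _ := by ring
  · intro G hG
    rw [Set.compl_union, Set.mem_inter_iff] at hG
    refine ⟨fun b v hv => ?_, ?_⟩
    · by_contra hlt
      refine hG.2 (Set.mem_biUnion (x := (b, v)) ?_ (not_le.mp hlt))
      simpa using hv
    · by_contra hne
      push Not at hne
      exact hG.1 fun b _ => hne b

/-! ### Clustering of well separated points -/

/-- Points close to well separated centres, with all clusters large, are recovered exactly by every
minimizer of the sum of the `p`-th powers of the distances, `p = 1, 2`. -/
lemma exactlyRecovers_of_separated {n K d p : ℕ} (hp : p = 1 ∨ p = 2) {τ σ : Fin n → Fin K}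
    {x : Fin n → EuclideanSpace ℝ (Fin d)} {ν c : Fin K → EuclideanSpace ℝ (Fin d)}
    {ε D c₀ : ℝ} (hc₀ : 0 < c₀) (hc₁ : c₀ ≤ 1) (hn : 0 < n) (hε : 0 ≤ ε) (hεD : ε < c₀ * (D / 8))
    (hx : ∀ i, ‖x i - ν (τ i)‖ ≤ ε) (hν : ∀ k l, k ≠ l → D ≤ ‖ν k - ν l‖)
    (hsize : ∀ k, c₀ * n ≤ ((Finset.univ.filter fun i => τ i = k).card : ℝ))
    (hσ : ∀ (σ' : Fin n → Fin K) (c' : Fin K → EuclideanSpace ℝ (Fin d)),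
      ∑ i, ‖x i - c (σ i)‖ ^ p ≤ ∑ i, ‖x i - c' (σ' i)‖ ^ p) : ExactlyRecovers σ τ := by
  have hp0 : p ≠ 0 := by omega
  have hn0 : (0 : ℝ) < n := by exact_mod_cast hn
  have hD : 0 < D := by
    by_contra h
    have : c₀ * (D / 8) ≤ 0 := mul_nonpos_of_nonneg_of_nonpos hc₀.le (by linarith)
    linarith
  have hεD8 : ε < D / 8 := hεD.trans_le (mul_le_of_le_one_left (by linarith) hc₁)
  have hcost : ∑ i, ‖x i - c (σ i)‖ ^ p ≤ n * ε ^ p := by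
    refine (hσ τ ν).trans ?_
    calc ∑ i, ‖x i - ν (τ i)‖ ^ p ≤ ∑ _i : Fin n, ε ^ p :=
          Finset.sum_le_sum fun i _ => pow_le_pow_left₀ (norm_nonneg _) (hx i) p
      _ = _ := by simp
  have hpow : ε ^ p < c₀ * (D / 8) ^ p := by
    refine (pow_lt_pow_left₀ hεD hε hp0).trans_le ?_
    rw [mul_pow]
    refine mul_le_mul_of_nonneg_right ?_ (by positivity)
    rcases hp with rfl | rfl
    · simp
    · nlinarith
  -- Without a fitted centre near `ν k`, each of the at least `c₀ n` points of block `k` would pay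
  -- at least `(D / 8) ^ p`, more than the total cost `n ε ^ p` of the true clustering.
  have hclose : ∀ k, ∃ l, ‖c l - ν k‖ < D / 4 := by
    intro k
    by_contra hfar
    push Not at hfar
    have h1 : (n : ℝ) * (c₀ * (D / 8) ^ p) ≤ ∑ i, ‖x i - c (σ i)‖ ^ p := by
      calc (n : ℝ) * (c₀ * (D / 8) ^ p)
          ≤ ((Finset.univ.filter fun i => τ i = k).card : ℝ) * (D / 8) ^ p := by
            have := mul_le_mul_of_nonneg_right (hsize k) (by positivity : 0 ≤ (D / 8) ^ p)
            linarith
        _ = ∑ i ∈ Finset.univ.filter fun i => τ i = k, (D / 8) ^ p := by simp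
        _ ≤ ∑ i ∈ Finset.univ.filter fun i => τ i = k, ‖x i - c (σ i)‖ ^ p := by
            refine Finset.sum_le_sum fun i hi => pow_le_pow_left₀ (by positivity) ?_ p
            have hτ : τ i = k := by simpa using hi
            have h2 := hfar (σ i)
            have h3 := hx i
            rw [hτ] at h3
            have h4 : ‖c (σ i) - ν k‖ ≤ ‖x i - c (σ i)‖ + ‖x i - ν k‖ := by
              rw [← norm_neg (x i - c (σ i)), neg_sub]
              exact norm_sub_le_norm_sub_add_norm_sub _ _ _
            linarith
        _ ≤ _ := Finset.sum_le_univ_sum_of_nonneg fun i => by positivity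
    have h2 := h1.trans hcost
    exact absurd (le_of_mul_le_mul_left h2 hn0) (not_le.mpr hpow)
  choose f hf using hclose
  have hinj : Function.Injective f := by
    intro k l hkl
    by_contra hne
    have h1 := hν k l hne
    have h2 := hf k
    have h3 := hf l
    rw [← hkl] at h3
    have h4 : ‖ν k - ν l‖ ≤ ‖ν k - c (f k)‖ + ‖c (f k) - ν l‖ :=
      norm_sub_le_norm_sub_add_norm_sub _ _ _
    rw [norm_sub_rev (ν k) (c (f k))] at h4
    linarith
  have hbij : Function.Bijective f := Finite.injective_iff_bijective.mp hinj
  refine ⟨Equiv.ofBijective f hbij, fun i => ?_⟩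
  change σ i = f (τ i)
  by_contra hne
  obtain ⟨k, hk⟩ := hbij.2 (σ i)
  have hkτ : k ≠ τ i := by
    rintro rfl
    exact hne hk.symm
  -- Exchange argument: moving the single point `i` to the centre of its own block, with all centres
  -- kept, would lower the cost.
  have h1 := hσ (Function.update σ i (f (τ i))) c
  rw [← Finset.add_sum_erase _ _ (Finset.mem_univ i), ← Finset.add_sum_erase _
    (fun j => ‖x j - c (Function.update σ i (f (τ i)) j)‖ ^ p) (Finset.mem_univ i)] at h1
  have h2 : ∑ j ∈ Finset.univ.erase i, ‖x j - c (Function.update σ i (f (τ i)) j)‖ ^ p =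
      ∑ j ∈ Finset.univ.erase i, ‖x j - c (σ j)‖ ^ p := by
    refine Finset.sum_congr rfl fun j hj => ?_
    rw [Function.update_of_ne (Finset.ne_of_mem_erase hj)]
  rw [h2, Function.update_self] at h1
  have h3 : ‖x i - c (σ i)‖ ^ p ≤ ‖x i - c (f (τ i))‖ ^ p := by linarith
  have h4 : ‖x i - c (σ i)‖ ≤ ‖x i - c (f (τ i))‖ :=
    (pow_le_pow_iff_left₀ (norm_nonneg _) (norm_nonneg _) hp0).mp h3
  have h5 := hν k (τ i) hkτ
  have h6 := hf k
  have h7 := hf (τ i)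
  rw [hk] at h6
  have h8 := hx i
  have h9 : ‖ν k - ν (τ i)‖ ≤ ‖ν k - c (σ i)‖ + ‖c (σ i) - ν (τ i)‖ :=
    norm_sub_le_norm_sub_add_norm_sub _ _ _
  have h10 : ‖c (σ i) - ν (τ i)‖ ≤ ‖c (σ i) - x i‖ + ‖x i - ν (τ i)‖ :=
    norm_sub_le_norm_sub_add_norm_sub _ _ _
  have h11 : ‖x i - c (f (τ i))‖ ≤ ‖x i - ν (τ i)‖ + ‖ν (τ i) - c (f (τ i))‖ :=
    norm_sub_le_norm_sub_add_norm_sub _ _ _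
  rw [norm_sub_rev (ν k) (c (σ i))] at h9
  rw [norm_sub_rev (c (σ i)) (x i)] at h10
  rw [norm_sub_rev (ν (τ i)) (c (f (τ i)))] at h11
  linarith

/-! ### Singular values and eigenvectors -/

lemma norm_toLp_sq {m : ℕ} (v : Fin m → ℝ) : ‖WithLp.toLp 2 v‖ ^ 2 = v ⬝ᵥ v := by
  rw [EuclideanSpace.real_norm_sq_eq]
  simp [dotProduct, sq]

lemma dotProduct_self_nonneg_real {m : ℕ} (v : Fin m → ℝ) : 0 ≤ v ⬝ᵥ v :=
  Finset.sum_nonneg fun _ _ => mul_self_nonneg _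

lemma exists_mem_ne_zero_forall_eq_zero {V ι : Type*} [AddCommGroup V] [Module ℝ V]
    [FiniteDimensional ℝ V] (T : Submodule ℝ V) (f : ι → V →ₗ[ℝ] ℝ) (J : Finset ι)
    (hJ : J.card < Module.finrank ℝ T) : ∃ x ∈ T, x ≠ 0 ∧ ∀ i ∈ J, f i x = 0 := by
  have h1 : LinearMap.ker ((LinearMap.pi fun i : J => f i) ∘ₗ T.subtype) ≠ ⊥ :=
    LinearMap.ker_ne_bot_of_finrank_lt (by simpa using hJ)
  obtain ⟨x, hx, hx0⟩ := Submodule.exists_mem_ne_zero_of_ne_bot h1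
  refine ⟨x, x.2, by simpa using hx0, fun i hi => ?_⟩
  have := congrFun (LinearMap.mem_ker.mp hx) ⟨i, hi⟩
  simpa using this

/-- Lower bound for a singular value from a subspace on which the matrix expands (one half of the
Courant–Fischer theorem). -/
lemma le_singularValue {n m j : ℕ} (Y : Matrix (Fin n) (Fin m) ℝ) (hj : 1 ≤ j)
    (T : Submodule ℝ (Fin m → ℝ)) (hT : j ≤ Module.finrank ℝ T) {s : ℝ}
    (h : ∀ x ∈ T, s ^ 2 * (x ⬝ᵥ x) ≤ Y.mulVec x ⬝ᵥ Y.mulVec x) : s ≤ singularValue Y j := by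
  have hm : Module.finrank ℝ (EuclideanSpace ℝ (Fin m)) = m := by simp
  have hjm : j - 1 < m := by
    have := Submodule.finrank_le T
    simp only [Module.finrank_fintype_fun_eq_card, Fintype.card_fin] at this
    omega
  set L := Matrix.toEuclideanLin Y with hL
  have hsym := L.isSymmetric_adjoint_comp_self
  set v := hsym.eigenvectorBasis hm with hv
  set μ := hsym.eigenvalues hm with hμ
  let f : Fin m → (Fin m → ℝ) →ₗ[ℝ] ℝ := fun i =>
    (innerₛₗ ℝ (v i)) ∘ₗ (WithLp.linearEquiv 2 ℝ (Fin m → ℝ)).symm.toLinearMap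
  have hf : ∀ i x, f i x = inner ℝ (v i) (WithLp.toLp 2 x) := fun i x => rfl
  -- A nonzero `x ∈ T` orthogonal to the first `j - 1` right singular vectors is expanded by at most
  -- the `j`-th singular value. Eigenvalues are indexed from zero, so the relevant one has index `j
  -- - 1`.
  obtain ⟨x, hxT, hx0, hx⟩ := exists_mem_ne_zero_forall_eq_zero T f
    (Finset.univ.filter fun i : Fin m => (i : ℕ) < j - 1) (by
      have : (Finset.univ.filter fun i : Fin m => (i : ℕ) < j - 1).card ≤ j - 1 := by
        calc _ ≤ (Finset.range (j - 1)).card :=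
              Finset.card_le_card_of_injOn (fun i : Fin m => (i : ℕ))
                (by intro i hi; simpa using hi) (fun a _ b _ hab => Fin.ext hab)
          _ = j - 1 := Finset.card_range _
      omega)
  set X := WithLp.toLp 2 x with hX
  have hXX : ‖X‖ ^ 2 = x ⬝ᵥ x := norm_toLp_sq x
  have hpos : 0 < x ⬝ᵥ x := by
    have := (Matrix.dotProduct_self_star_pos_iff (v := x)).mpr hx0
    simpa using this
  have hLX : ‖L X‖ ^ 2 = Y.mulVec x ⬝ᵥ Y.mulVec x := by
    rw [← norm_toLp_sq]
    rfl
  have hσ : singularValue Y j ^ 2 = μ ⟨j - 1, hjm⟩ := L.sq_singularValues_of_lt hm hjm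
  have hup : ‖L X‖ ^ 2 ≤ singularValue Y j ^ 2 * ‖X‖ ^ 2 := by
    have h1 : ‖L X‖ ^ 2 = inner ℝ X ((LinearMap.adjoint L ∘ₗ L) X) := by
      rw [LinearMap.comp_apply, LinearMap.adjoint_inner_right, real_inner_self_eq_norm_sq]
    have h2 : ∀ i, inner ℝ (v i) ((LinearMap.adjoint L ∘ₗ L) X) = μ i * inner ℝ (v i) X := by
      intro i
      rw [← hsym (v i) X, show (LinearMap.adjoint L ∘ₗ L) (v i) = μ i • v i from
        hsym.apply_eigenvectorBasis hm i, inner_smul_left]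
      simp
    rw [h1, ← v.sum_inner_mul_inner X, ← v.sum_sq_inner_right X, Finset.mul_sum]
    refine Finset.sum_le_sum fun i _ => ?_
    rw [h2, real_inner_comm (v i) X]
    by_cases hi : (i : ℕ) < j - 1
    · have h3 : inner ℝ (v i) X = 0 := by
        rw [← hf]; exact hx i (by simpa using hi)
      rw [h3]; simp
    · have h4 : μ i ≤ singularValue Y j ^ 2 := by
        rw [hσ]
        exact hsym.eigenvalues_antitone hm (Fin.mk_le_of_le_val (not_lt.mp hi))
      nlinarith [sq_nonneg (inner ℝ (v i) X)]
  have h5 := (h x hxT).trans (hLX ▸ hup)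
  rw [hXX] at h5
  have h6 := le_of_mul_le_mul_right h5 hpos
  have h7 : 0 ≤ singularValue Y j := L.singularValues_nonneg _
  exact le_of_sq_le_sq h6 h7

section Hermitian

variable {n : ℕ} {A : Matrix (Fin n) (Fin n) ℝ}

lemma inner_eigenvectorBasis_mulVec (hA : A.IsHermitian) (i : Fin n) (x : Fin n → ℝ) :
    inner ℝ (hA.eigenvectorBasis i) (WithLp.toLp 2 (A.mulVec x)) =
      hA.eigenvalues i * inner ℝ (hA.eigenvectorBasis i) (WithLp.toLp 2 x) := by
  have h1 : ∀ u w : Fin n → ℝ, inner ℝ (WithLp.toLp 2 u) (WithLp.toLp 2 w) = u ⬝ᵥ w := by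
    intro u w
    simp [EuclideanSpace.inner_eq_star_dotProduct, dotProduct_comm]
  have h2 := hA.mulVec_eigenvectorBasis i
  have hAT : A.transpose = A := by simpa using hA.eq
  have h3 : ∀ w, inner ℝ (hA.eigenvectorBasis i) (WithLp.toLp 2 w) =
      WithLp.ofLp (hA.eigenvectorBasis i) ⬝ᵥ w := fun w => h1 _ w
  rw [h3, h3, Matrix.dotProduct_mulVec, ← Matrix.mulVec_transpose, hAT, h2, smul_dotProduct]
  simp

lemma mulVec_dotProduct_mulVec_eq_sum (hA : A.IsHermitian) (x : Fin n → ℝ) :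
    A.mulVec x ⬝ᵥ A.mulVec x = ∑ i, hA.eigenvalues i ^ 2 *
      inner ℝ (hA.eigenvectorBasis i) (WithLp.toLp 2 x) ^ 2 := by
  rw [← norm_toLp_sq, ← hA.eigenvectorBasis.sum_sq_inner_right]
  refine Finset.sum_congr rfl fun i _ => ?_
  rw [inner_eigenvectorBasis_mulVec, mul_pow]

/-- A symmetric matrix expanding a `d`-dimensional subspace has `d` large eigenvalues. -/
lemma exists_eigenvectors_of_subspace (hA : A.IsHermitian) {d : ℕ}
    (S : Submodule ℝ (Fin n → ℝ)) (hS : d ≤ Module.finrank ℝ S) {s : ℝ} (hs : 0 ≤ s)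
    (h : ∀ x ∈ S, s ^ 2 * (x ⬝ᵥ x) ≤ A.mulVec x ⬝ᵥ A.mulVec x) :
    ∃ (R : Matrix (Fin d) (Fin n) ℝ) (lam : Fin d → ℝ), R * R.transpose = 1 ∧
      R * A = Matrix.diagonal lam * R ∧ ∀ j, s ≤ |lam j| := by
  set v := hA.eigenvectorBasis with hv
  set J := Finset.univ.filter fun i : Fin n => s ≤ |hA.eigenvalues i| with hJ
  have hcard : d ≤ J.card := by
    -- With fewer than `d` eigenvalues of modulus at least `s`, some nonzero `x ∈ S` would be
    -- orthogonal to all their eigenvectors and hence be expanded by less than `s`.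
    by_contra hlt
    let f : Fin n → (Fin n → ℝ) →ₗ[ℝ] ℝ := fun i =>
      (innerₛₗ ℝ (v i)) ∘ₗ (WithLp.linearEquiv 2 ℝ (Fin n → ℝ)).symm.toLinearMap
    have hf : ∀ i x, f i x = inner ℝ (v i) (WithLp.toLp 2 x) := fun i x => rfl
    obtain ⟨x, hxS, hx0, hx⟩ := exists_mem_ne_zero_forall_eq_zero S f J (by omega)
    have h1 := h x hxS
    rw [mulVec_dotProduct_mulVec_eq_sum hA, ← norm_toLp_sq, ← v.sum_sq_inner_right,
      Finset.mul_sum] at h1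
    have hlt : ∑ i, hA.eigenvalues i ^ 2 * inner ℝ (v i) (WithLp.toLp 2 x) ^ 2 <
        ∑ i, s ^ 2 * inner ℝ (v i) (WithLp.toLp 2 x) ^ 2 := by
      have hle : ∀ i, hA.eigenvalues i ^ 2 * inner ℝ (v i) (WithLp.toLp 2 x) ^ 2 ≤
          s ^ 2 * inner ℝ (v i) (WithLp.toLp 2 x) ^ 2 := by
        intro i
        by_cases hi : i ∈ J
        · rw [← hf, hx i hi]; simp
        · have h2 : |hA.eigenvalues i| < s := by simpa [hJ] using hi
          exact mul_le_mul_of_nonneg_right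
            (sq_le_sq.mpr (by rw [abs_of_nonneg hs]; exact h2.le)) (sq_nonneg _)
      refine Finset.sum_lt_sum (fun i _ => hle i) ?_
      obtain ⟨i, hi⟩ : ∃ i, inner ℝ (v i) (WithLp.toLp 2 x) ≠ 0 := by
        by_contra hall
        push Not at hall
        have h3 := v.sum_sq_inner_right (WithLp.toLp 2 x)
        simp only [hall] at h3
        have h4 : WithLp.toLp 2 x = 0 := by simpa using h3.symm
        exact hx0 (by simpa using h4)
      have hiJ : i ∉ J := fun hiJ => hi (by rw [← hf]; exact hx i hiJ)
      have h2 : |hA.eigenvalues i| < s := by simpa [hJ] using hiJ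
      refine ⟨i, Finset.mem_univ i, mul_lt_mul_of_pos_right ?_ (by positivity)⟩
      exact sq_lt_sq.mpr (by rw [abs_of_nonneg hs]; exact h2)
    exact absurd h1 (not_le.mpr hlt)
  obtain ⟨J', hJ', hJ'c⟩ := Finset.exists_subset_card_eq hcard
  let e : Fin d ≃ J' := (J'.equivFinOfCardEq hJ'c).symm
  refine ⟨Matrix.of fun j i => v (e j) i, fun j => hA.eigenvalues (e j), ?_, ?_, ?_⟩
  · ext j l
    have h1 := orthonormal_iff_ite.mp v.orthonormal (e j) (e l)
    rw [EuclideanSpace.inner_eq_star_dotProduct] at h1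
    simp only [Matrix.mul_apply, Matrix.transpose_apply, Matrix.one_apply, Matrix.of_apply]
    rw [show (∑ i, v (e j) i * v (e l) i) = WithLp.ofLp (v (e l)) ⬝ᵥ star (WithLp.ofLp (v (e j)))
      from by rw [dotProduct_comm]; rfl, h1]
    simp only [Subtype.coe_inj, EmbeddingLike.apply_eq_iff_eq]
  · have hAT : A.transpose = A := by simpa using hA.eq
    ext j i
    rw [Matrix.diagonal_mul]
    have h1 := congrFun (hA.mulVec_eigenvectorBasis (e j)) i
    have h0 : ∀ w, A.mulVec w = Matrix.vecMul w A := by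
      intro w; rw [← Matrix.vecMul_transpose, hAT]
    rw [h0] at h1
    simpa [Matrix.mul_apply, Matrix.vecMul, dotProduct] using h1
  · intro j
    have := hJ' (e j).2
    simpa [hJ] using this

/-- The trace method: for a unit eigenvector `v` with eigenvalue `λ`, `λ ^ (2 g) = |A ^ g v| ^ 2` is
at most the squared Frobenius norm of `A ^ g`, which is the trace of `A ^ (2 g)`. -/
lemma dotProduct_mulVec_self_le_of_pow (hA : A.IsHermitian) {g : ℕ} (hg : g ≠ 0) {M : ℝ}
    (h : ∑ i, (A ^ (2 * g)) i i ≤ M ^ (2 * g)) (x : Fin n → ℝ) :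
    A.mulVec x ⬝ᵥ A.mulVec x ≤ M ^ 2 * (x ⬝ᵥ x) := by
  set v := hA.eigenvectorBasis with hv
  have hAT : A.transpose = A := by simpa using hA.eq
  have hpow : ∀ i m, (A ^ m).mulVec (WithLp.ofLp (v i)) =
      hA.eigenvalues i ^ m • WithLp.ofLp (v i) := by
    intro i m
    induction m with
    | zero => simp
    | succ m ih =>
      rw [pow_succ', ← Matrix.mulVec_mulVec, ih, Matrix.mulVec_smul, hA.mulVec_eigenvectorBasis i,
        smul_smul, pow_succ]
  have hdiag : ∀ i, (A ^ (2 * g)) i i = ∑ j, (A ^ g) i j ^ 2 := by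
    intro i
    have h1 : (A ^ g).transpose = A ^ g := by rw [Matrix.transpose_pow, hAT]
    rw [two_mul, pow_add, Matrix.mul_apply]
    refine Finset.sum_congr rfl fun j _ => ?_
    rw [sq]
    congr 1
    conv_lhs => rw [← h1]
    rfl
  have heig : ∀ i, hA.eigenvalues i ^ 2 ≤ M ^ 2 := by
    intro i
    have hnorm : WithLp.ofLp (v i) ⬝ᵥ WithLp.ofLp (v i) = 1 := by
      rw [← norm_toLp_sq]
      simp
    have h1 : (hA.eigenvalues i ^ 2) ^ g ≤ (M ^ 2) ^ g := by
      rw [← pow_mul, ← pow_mul]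
      refine le_trans ?_ h
      calc hA.eigenvalues i ^ (2 * g)
          = (A ^ g).mulVec (WithLp.ofLp (v i)) ⬝ᵥ (A ^ g).mulVec (WithLp.ofLp (v i)) := by
            rw [hpow, smul_dotProduct, dotProduct_smul, hnorm]
            simp only [smul_eq_mul, mul_one]
            ring
        _ = ∑ r, (∑ j, (A ^ g) r j * v i j) ^ 2 :=
            Finset.sum_congr rfl fun r _ => (sq _).symm
        _ ≤ ∑ r, (∑ j, (A ^ g) r j ^ 2) * ∑ j, v i j ^ 2 :=
            Finset.sum_le_sum fun r _ => Finset.sum_mul_sq_le_sq_mul_sq _ _ _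
        _ = ∑ r, (A ^ (2 * g)) r r := by
            have h2 : ∑ j, v i j ^ 2 = 1 := by
              rw [← hnorm]; simp [dotProduct, sq]
            simp only [h2, mul_one, hdiag]
    exact (pow_le_pow_iff_left₀ (sq_nonneg _) (sq_nonneg _) hg).mp h1
  rw [mulVec_dotProduct_mulVec_eq_sum hA, ← norm_toLp_sq, ← v.sum_sq_inner_right, Finset.mul_sum]
  exact Finset.sum_le_sum fun i _ => mul_le_mul_of_nonneg_right (heig i) (sq_nonneg _)

end Hermitian

/-! ### Deterministic analysis of the embedding -/

/-- `Rᵀ R` is an orthogonal projection; the claim is the nonnegativity of `|u - Rᵀ R u| ^ 2`. -/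
lemma mulVec_dotProduct_mulVec_le {n d : ℕ} {R : Matrix (Fin d) (Fin n) ℝ}
    (hR : R * R.transpose = 1) (u : Fin n → ℝ) : R.mulVec u ⬝ᵥ R.mulVec u ≤ u ⬝ᵥ u := by
  set w := R.transpose.mulVec (R.mulVec u) with hw
  have h1 : u ⬝ᵥ w = R.mulVec u ⬝ᵥ R.mulVec u := by
    rw [hw, Matrix.dotProduct_mulVec, Matrix.vecMul_transpose]
  have h2 : w ⬝ᵥ w = R.mulVec u ⬝ᵥ R.mulVec u := by
    conv_lhs => rw [hw]
    rw [Matrix.dotProduct_mulVec, Matrix.vecMul_transpose, Matrix.mulVec_mulVec, hR,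
      Matrix.one_mulVec]
  have h3 := dotProduct_self_nonneg_real (u - w)
  rw [sub_dotProduct, dotProduct_sub, dotProduct_sub, dotProduct_comm w u, h1, h2] at h3
  linarith

/-- The sketch `A ^ g G` inherits the `d` large eigenvalues of `A` if the compression of `G` to the
eigenvectors is well conditioned. -/
lemma mul_pow_le_singularValue {n k d g : ℕ} (hd : 1 ≤ d) {A : Matrix (Fin n) (Fin n) ℝ}
    {R : Matrix (Fin d) (Fin n) ℝ} {lam : Fin d → ℝ} (hR : R * R.transpose = 1)
    (hRA : R * A = Matrix.diagonal lam * R) {l s : ℝ} (hl : 0 ≤ l) (hlam : ∀ j, l ≤ |lam j|)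
    (hs : 0 < s) {G : Fin n → Fin k → ℝ}
    (hG : IsWellConditioned s (fun x q => ∑ i, R x i * G i q)) :
    s * l ^ g ≤ singularValue (A ^ g * Matrix.of G) d := by
  set X : Matrix (Fin d) (Fin k) ℝ := R * Matrix.of G with hX
  have hcond : ∀ y, s ^ 2 * (y ⬝ᵥ y) ≤ X.transpose.mulVec y ⬝ᵥ X.transpose.mulVec y := by
    intro y
    refine (hG y).trans (le_of_eq (Finset.sum_congr rfl fun q _ => ?_))
    rw [sq]
    have : ∑ x, y x * ∑ i, R x i * G i q = X.transpose.mulVec y q :=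
      Finset.sum_congr rfl fun x _ => mul_comm _ _
    rw [this]
  have hinj : Function.Injective X.transpose.mulVecLin := by
    refine (injective_iff_map_eq_zero _).mpr fun y hy => ?_
    have h1 := hcond y
    rw [Matrix.mulVecLin_apply] at hy
    rw [hy, dotProduct_zero] at h1
    have h2 := dotProduct_self_nonneg_real y
    have h3 : y ⬝ᵥ y = 0 := le_antisymm (nonpos_of_mul_nonpos_right h1 (by positivity)) h2
    exact dotProduct_self_eq_zero.mp h3
  -- The test subspace is the row space of `X = R G`. For `x = Xᵀ y` in it, `|x| ^ 2 = ⟨X x, y⟩ ≤ |X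
  -- x| |x| / s`, and `R A ^ g G x` is `X x` with coordinates multiplied by `lam j ^ g`.
  refine le_singularValue _ hd (LinearMap.range X.transpose.mulVecLin) ?_ ?_
  · rw [LinearMap.finrank_range_of_inj hinj]
    simp
  · rintro x ⟨y, rfl⟩
    rw [Matrix.mulVecLin_apply]
    set x := X.transpose.mulVec y with hx
    have hpow : R * A ^ g = Matrix.diagonal (fun j => lam j ^ g) * R := by
      induction g with
      | zero => simp
      | succ g ih =>
        rw [pow_succ, ← Matrix.mul_assoc, ih, Matrix.mul_assoc, hRA, ← Matrix.mul_assoc,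
          Matrix.diagonal_mul_diagonal]
        simp [pow_succ]
    have h1 : R.mulVec ((A ^ g * Matrix.of G).mulVec x) = fun j => lam j ^ g * X.mulVec x j := by
      rw [Matrix.mulVec_mulVec, ← Matrix.mul_assoc, hpow, Matrix.mul_assoc, ← hX,
        ← Matrix.mulVec_mulVec]
      funext j
      rw [Matrix.mulVec_diagonal]
    have h2 := mulVec_dotProduct_mulVec_le hR ((A ^ g * Matrix.of G).mulVec x)
    rw [h1] at h2
    refine le_trans ?_ h2
    have h3 : (l ^ g) ^ 2 * (X.mulVec x ⬝ᵥ X.mulVec x) ≤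
        (fun j => lam j ^ g * X.mulVec x j) ⬝ᵥ (fun j => lam j ^ g * X.mulVec x j) := by
      simp only [dotProduct, Finset.mul_sum]
      refine Finset.sum_le_sum fun j _ => ?_
      have h4 : (l ^ g) ^ 2 ≤ (lam j ^ g) ^ 2 := by
        rw [← pow_mul, mul_comm g 2, pow_mul, ← pow_mul (lam j), mul_comm g 2, pow_mul (lam j),
          ← sq_abs (lam j)]
        gcongr
        exact hlam j
      calc (l ^ g) ^ 2 * (X.mulVec x j * X.mulVec x j)
          ≤ (lam j ^ g) ^ 2 * (X.mulVec x j * X.mulVec x j) :=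
            mul_le_mul_of_nonneg_right h4 (mul_self_nonneg _)
        _ = _ := by ring
    have h5 : s ^ 2 * (x ⬝ᵥ x) ≤ X.mulVec x ⬝ᵥ X.mulVec x := by
      have h6 : x ⬝ᵥ x = X.mulVec x ⬝ᵥ y := by
        conv_lhs => rw [hx]
        rw [Matrix.dotProduct_mulVec, Matrix.vecMul_transpose]
      have h7 : (X.mulVec x ⬝ᵥ y) ^ 2 ≤ (X.mulVec x ⬝ᵥ X.mulVec x) * (y ⬝ᵥ y) := by
        have := Finset.sum_mul_sq_le_sq_mul_sq Finset.univ (X.mulVec x) y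
        simpa [dotProduct, sq] using this
      rw [← h6] at h7
      have h8 := hcond y
      rcases (dotProduct_self_nonneg_real x).eq_or_lt with h0 | h0
      · rw [← h0, mul_zero]; exact dotProduct_self_nonneg_real _
      · refine le_of_mul_le_mul_right ?_ h0
        have h9 := dotProduct_self_nonneg_real (X.mulVec x)
        calc s ^ 2 * (x ⬝ᵥ x) * (x ⬝ᵥ x) = s ^ 2 * (x ⬝ᵥ x) ^ 2 := by ring
          _ ≤ s ^ 2 * ((X.mulVec x ⬝ᵥ X.mulVec x) * (y ⬝ᵥ y)) := by gcongr
          _ = (X.mulVec x ⬝ᵥ X.mulVec x) * (s ^ 2 * (y ⬝ᵥ y)) := by ring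
          _ ≤ _ := mul_le_mul_of_nonneg_left h8 h9
    calc (s * l ^ g) ^ 2 * (x ⬝ᵥ x) = (l ^ g) ^ 2 * (s ^ 2 * (x ⬝ᵥ x)) := by ring
      _ ≤ (l ^ g) ^ 2 * (X.mulVec x ⬝ᵥ X.mulVec x) := by gcongr
      _ ≤ _ := h3

/-- Dividing the right singular vectors by the singular values gives `H`. Rows of `U` thereby become
linear in the sketch, and `H` contributes only its operator norm `1 / s`, although it depends on the
sketch. -/
lemma IsLeadingLeftSingular.exists_right_factor {n k d : ℕ} {Y : Matrix (Fin n) (Fin k) ℝ}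
    {U : Matrix (Fin n) (Fin d) ℝ} (h : IsLeadingLeftSingular Y U) {s : ℝ} (hs : 0 < s)
    (hY : s ≤ singularValue Y d) :
    ∃ H : Matrix (Fin k) (Fin d) ℝ, Y * H = U ∧
      ∀ w, ‖WithLp.toLp 2 (Matrix.vecMul w H)‖ ≤ ‖WithLp.toLp 2 w‖ / s := by
  obtain ⟨-, V, hV, hYV, -⟩ := h
  have hσ : ∀ j : Fin d, s ≤ singularValue Y (j + 1) := fun j =>
    hY.trans (LinearMap.singularValues_antitone _ (by omega))
  refine ⟨V * Matrix.diagonal fun j : Fin d => (singularValue Y (j + 1))⁻¹, ?_, fun w => ?_⟩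
  · rw [← Matrix.mul_assoc, hYV, Matrix.mul_assoc, Matrix.diagonal_mul_diagonal]
    have : (fun j : Fin d => singularValue Y (j + 1) * (singularValue Y (j + 1))⁻¹) = fun _ => 1 := by
      funext j
      exact mul_inv_cancel₀ (hs.trans_le (hσ j)).ne'
    rw [this, Matrix.diagonal_one, Matrix.mul_one]
  · rw [le_div_iff₀ hs]
    refine le_of_sq_le_sq ?_ (norm_nonneg _)
    rw [mul_pow, norm_toLp_sq, norm_toLp_sq]
    have h1 := mulVec_dotProduct_mulVec_le (R := V.transpose) (by simpa using hV) w
    refine le_trans ?_ h1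
    simp only [dotProduct, Finset.sum_mul]
    refine Finset.sum_le_sum fun j _ => ?_
    rw [← Matrix.vecMul_vecMul, Matrix.vecMul_diagonal, Matrix.mulVec_transpose]
    set c := Matrix.vecMul w V j
    have hj := hσ j
    have h2 : s * (singularValue Y (j + 1))⁻¹ ≤ 1 := by
      rw [mul_inv_le_iff₀ (hs.trans_le hj)]; linarith
    have h3 : 0 ≤ s * (singularValue Y (j + 1))⁻¹ :=
      mul_nonneg hs.le (inv_nonneg.mpr (hs.le.trans hj))
    have h4 : (s * (singularValue Y (j + 1))⁻¹) ^ 2 ≤ 1 := pow_le_one₀ h3 h2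
    calc c * (singularValue Y (j + 1))⁻¹ * (c * (singularValue Y (j + 1))⁻¹) * s ^ 2
        = (s * (singularValue Y (j + 1))⁻¹) ^ 2 * (c * c) := by ring
      _ ≤ 1 * (c * c) := mul_le_mul_of_nonneg_right h4 (mul_self_nonneg _)
      _ = c * c := one_mul _

/-- Telescoping from `A` to `E`. The powers of `E` are kept on the left, where they meet the fixed
block structure of `A - E` and can be bounded entry by entry. -/
lemma pow_eq_pow_add_sum {R : Type*} [Ring R] (A E : R) (g : ℕ) :
    A ^ g = E ^ g + ∑ j ∈ Finset.range g, E ^ j * (A - E) * A ^ (g - 1 - j) := by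
  induction g with
  | zero => simp
  | succ g ih =>
    rw [Finset.sum_range_succ]
    have h1 : ∑ j ∈ Finset.range g, E ^ j * (A - E) * A ^ (g + 1 - 1 - j) =
        (∑ j ∈ Finset.range g, E ^ j * (A - E) * A ^ (g - 1 - j)) * A := by
      rw [Finset.sum_mul]
      refine Finset.sum_congr rfl fun j hj => ?_
      rw [Finset.mem_range] at hj
      rw [mul_assoc _ _ A, ← pow_succ]
      congr 2
      omega
    rw [h1, pow_succ A g]
    conv_lhs => rw [ih]
    rw [add_mul, show g + 1 - 1 - g = 0 by omega, pow_zero, mul_one, pow_succ E g, mul_sub]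
    abel

/-- The membership matrix of a labelling: its column `l` is the indicator of block `l`. -/
def memberMatrix {n K : ℕ} (τ : Fin n → Fin K) : Matrix (Fin n) (Fin K) ℝ :=
  Matrix.of fun i l => if τ i = l then 1 else 0

/-- The expectation of the adjacency matrix of a blockmodel graph given the labels. -/
def meanMatrix {n K : ℕ} (ρ : ℝ) (B : Matrix (Fin K) (Fin K) ℝ) (τ : Fin n → Fin K) :
    Matrix (Fin n) (Fin n) ℝ :=
  Matrix.of fun i j => ρ * B (τ i) (τ j)

lemma memberMatrix_mul_apply {n K d : ℕ} (τ : Fin n → Fin K) (W : Matrix (Fin K) (Fin d) ℝ)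
    (i : Fin n) : (memberMatrix τ * W) i = W (τ i) := by
  funext j
  simp [Matrix.mul_apply, memberMatrix]

lemma meanMatrix_eq {n K : ℕ} (ρ : ℝ) (B : Matrix (Fin K) (Fin K) ℝ) (τ : Fin n → Fin K) :
    meanMatrix ρ B τ = memberMatrix τ * (ρ • B) * (memberMatrix τ).transpose := by
  ext i j
  rw [Matrix.mul_apply, memberMatrix_mul_apply]
  simp [memberMatrix, meanMatrix]

lemma norm_toLp_vecMul_le {K d : ℕ} (c : Fin K → ℝ) (M : Matrix (Fin K) (Fin d) ℝ) {a b : ℝ}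
    (hc : ∀ l, |c l| ≤ a) (hM : ∀ l, ‖WithLp.toLp 2 (M l)‖ ≤ b) (ha : 0 ≤ a) :
    ‖WithLp.toLp 2 (Matrix.vecMul c M)‖ ≤ K * (a * b) := by
  rw [Matrix.vecMul_eq_sum, WithLp.toLp_sum]
  refine (norm_sum_le _ _).trans ?_
  calc ∑ l, ‖WithLp.toLp 2 (c l • M l)‖ ≤ ∑ _l : Fin K, a * b := by
        refine Finset.sum_le_sum fun l _ => ?_
        rw [WithLp.toLp_smul, norm_smul, Real.norm_eq_abs]
        exact mul_le_mul (hc l) (hM l) (norm_nonneg _) ha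
    _ = _ := by simp

/-- The rows of `A ^ g F` are close to the block values of `ρ B Zᵀ A ^ (g - 1) F`, `Z` the
membership matrix. -/
lemma norm_row_sub_le {n K d g : ℕ} (hg : 1 ≤ g) {ρ : ℝ} (hρ : 0 ≤ ρ)
    {B : Matrix (Fin K) (Fin K) ℝ} (hB : ∀ k l, |B k l| ≤ 1) {τ : Fin n → Fin K}
    {A E : Matrix (Fin n) (Fin n) ℝ} (hAE : A - E = meanMatrix ρ B τ)
    (F : Matrix (Fin n) (Fin d) ℝ) {e b : ℕ → ℝ} {r : ℝ} (he : ∀ j, 0 ≤ e j)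
    (hE : ∀ j < g, ∀ i l, |(E ^ j * memberMatrix τ) i l| ≤ e j)
    (hb : ∀ m < g, ∀ l, ‖WithLp.toLp 2 (((memberMatrix τ).transpose * (A ^ m * F)) l)‖ ≤ b m)
    (hr : ∀ i, ‖WithLp.toLp 2 ((E ^ g * F) i)‖ ≤ r) (i : Fin n) :
    ‖WithLp.toLp 2 ((A ^ g * F) i) - WithLp.toLp 2
      (((ρ • B) * ((memberMatrix τ).transpose * (A ^ (g - 1) * F))) (τ i))‖ ≤
      (∑ j ∈ Finset.Ico 1 g, K * (e j * (K * (ρ * b (g - 1 - j))))) + r := by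
  set Z := memberMatrix τ with hZ
  let W : ℕ → Matrix (Fin K) (Fin d) ℝ := fun m => (ρ • B) * (Z.transpose * (A ^ m * F))
  have hdecomp : A ^ g * F = E ^ g * F + ∑ j ∈ Finset.range g, E ^ j * Z * W (g - 1 - j) := by
    conv_lhs => rw [pow_eq_pow_add_sum A E g]
    rw [Matrix.add_mul, Matrix.sum_mul]
    congr 1
    refine Finset.sum_congr rfl fun j _ => ?_
    rw [hAE, meanMatrix_eq]
    simp only [W, Matrix.mul_assoc, hZ]
  -- The term `j = 0` is split off: it is `Z W (g - 1)`, whose row `i` depends only on `τ i`.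
  have hrow : (A ^ g * F) i = (E ^ g * F) i + (∑ j ∈ Finset.Ico 1 g,
      Matrix.vecMul ((E ^ j * Z) i) (W (g - 1 - j)) + W (g - 1) (τ i)) := by
    rw [hdecomp, Finset.range_eq_Ico, Finset.sum_eq_sum_Ico_succ_bot (by omega)]
    simp only [pow_zero, Matrix.one_mul, Nat.sub_zero]
    have h1 : ∀ (S : Finset ℕ) (f : ℕ → Matrix (Fin n) (Fin d) ℝ), (∑ j ∈ S, f j) i =
        ∑ j ∈ S, f j i := fun S f => Finset.sum_apply _ _ _
    rw [show (E ^ g * F + (Z * W (g - 1) + ∑ k ∈ Finset.Ico (0 + 1) g,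
      E ^ k * Z * W (g - 1 - k))) i = (E ^ g * F) i + ((Z * W (g - 1)) i +
      (∑ k ∈ Finset.Ico (0 + 1) g, E ^ k * Z * W (g - 1 - k)) i) from rfl, h1,
      memberMatrix_mul_apply, zero_add]
    rw [add_comm (W (g - 1) (τ i))]
    rfl
  have hWb : ∀ m < g, ∀ l, ‖WithLp.toLp 2 (W m l)‖ ≤ K * (ρ * b m) := by
    intro m hm l
    have h1 : W m l = Matrix.vecMul ((ρ • B) l) (Z.transpose * (A ^ m * F)) := rfl
    rw [h1]
    refine norm_toLp_vecMul_le _ _ (fun l' => ?_) (hb m hm) hρ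
    rw [Matrix.smul_apply, smul_eq_mul, abs_mul, abs_of_nonneg hρ]
    exact mul_le_of_le_one_right hρ (hB _ _)
  change ‖WithLp.toLp 2 ((A ^ g * F) i) - WithLp.toLp 2 (W (g - 1) (τ i))‖ ≤ _
  rw [hrow, WithLp.toLp_add, WithLp.toLp_add, ← add_assoc, add_sub_cancel_right, add_comm,
    WithLp.toLp_sum]
  refine (norm_add_le _ _).trans (add_le_add ((norm_sum_le _ _).trans ?_) (hr i))
  refine Finset.sum_le_sum fun j hj => ?_
  rw [Finset.mem_Ico] at hj
  exact norm_toLp_vecMul_le _ _ (hE j hj.2 i) (hWb _ (by omega)) (he j)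

lemma exists_pos_forall_le {ι : Type*} [Finite ι] {f : ι → ℝ} (hf : ∀ i, 0 < f i) :
    ∃ D : ℝ, 0 < D ∧ ∀ i, D ≤ f i := by
  cases isEmpty_or_nonempty ι
  · exact ⟨1, one_pos, fun i => isEmptyElim i⟩
  · obtain ⟨i, hi⟩ := Finite.exists_min f
    exact ⟨f i, hf i, hi⟩

/-- A symmetric matrix is bounded below on its range. -/
lemma exists_pos_mul_dotProduct_le {K : ℕ} {B : Matrix (Fin K) (Fin K) ℝ} (hB : B.IsSymm) :
    ∃ c : ℝ, 0 < c ∧ ∀ w ∈ LinearMap.range B.mulVecLin,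
      c ^ 2 * (w ⬝ᵥ w) ≤ B.mulVec w ⬝ᵥ B.mulVec w := by
  set L := Matrix.toEuclideanLin B with hL
  have hLapp : ∀ w, L (WithLp.toLp 2 w) = WithLp.toLp 2 (B.mulVec w) := fun w => rfl
  set f := L.domRestrict (LinearMap.range L) with hf
  -- By symmetry `|B u| ^ 2 = ⟨u, B (B u)⟩`, so range and kernel of `B` meet only in zero.
  -- Injectivity on a finite-dimensional space then gives the lower bound.
  have hker : LinearMap.ker f = ⊥ := by
    refine LinearMap.ker_eq_bot'.mpr ?_
    rintro ⟨w, u, rfl⟩ hw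
    have h1 : L (L u) = 0 := hw
    have h2 : B.mulVec (B.mulVec (WithLp.ofLp u)) = 0 := by
      have : WithLp.toLp 2 (B.mulVec (B.mulVec (WithLp.ofLp u))) = 0 := h1
      simpa using this
    have h3 : B.mulVec (WithLp.ofLp u) ⬝ᵥ B.mulVec (WithLp.ofLp u) = 0 := by
      rw [Matrix.dotProduct_mulVec, ← Matrix.mulVec_transpose, hB.eq, h2, zero_dotProduct]
    have h4 : B.mulVec (WithLp.ofLp u) = 0 := dotProduct_self_eq_zero.mp h3
    have h5 : L u = 0 := by
      change WithLp.toLp 2 (B.mulVec (WithLp.ofLp u)) = 0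
      rw [h4]; rfl
    exact Subtype.ext h5
  obtain ⟨k, hk, hanti⟩ := LinearMap.exists_antilipschitzWith f hker
  have hk' : (0 : ℝ) < k := by exact_mod_cast hk
  refine ⟨(k : ℝ)⁻¹, by positivity, ?_⟩
  rintro w ⟨u, rfl⟩
  have h1 := hanti.le_mul_dist (⟨L (WithLp.toLp 2 u), LinearMap.mem_range_self _ _⟩ :
    LinearMap.range L) 0
  rw [map_zero, dist_zero_right, dist_zero_right] at h1
  have h2 : ‖WithLp.toLp 2 (B.mulVec u)‖ ≤ k * ‖WithLp.toLp 2 (B.mulVec (B.mulVec u))‖ := h1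
  have h3 := pow_le_pow_left₀ (norm_nonneg _) h2 2
  rw [mul_pow, norm_toLp_sq, norm_toLp_sq] at h3
  rw [Matrix.mulVecLin_apply, inv_pow, inv_mul_le_iff₀ (by positivity)]
  exact h3

/-- The rows of a matrix `W` in the column space of `B` that is close to an orthonormal embedding
are as separated as the rows of `B`. -/
lemma exists_pos_forall_row_separation {K : ℕ} {B : Matrix (Fin K) (Fin K) ℝ}
    (hrows : ∀ k l, k ≠ l → B k ≠ B l) (hB1 : ∀ k l, |B k l| ≤ 1) :
    ∃ D : ℝ, 0 < D ∧ ∀ (n : ℕ), 0 < n → ∀ (τ : Fin n → Fin K) (U : Matrix (Fin n) (Fin B.rank) ℝ)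
      (W₁ : Matrix (Fin K) (Fin B.rank) ℝ), U.transpose * U = 1 →
      (∀ i, ‖WithLp.toLp 2 (U i) - WithLp.toLp 2 ((B * W₁) (τ i))‖ ≤ 1 / 2 / √n) →
      ∀ k l, k ≠ l → D / √n ≤ ‖WithLp.toLp 2 ((B * W₁) k) - WithLp.toLp 2 ((B * W₁) l)‖ := by
  have hex : ∀ p : {p : Fin K × Fin K // p.1 ≠ p.2}, ∃ j, B p.1.1 j ≠ B p.1.2 j := by
    rintro ⟨⟨k, l⟩, hkl⟩
    exact Function.ne_iff.mp (hrows k l hkl)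
  choose J hJ using hex
  obtain ⟨D, hD, hDle⟩ := exists_pos_forall_le
    (f := fun p : {p : Fin K × Fin K // p.1 ≠ p.2} => |B p.1.1 (J p) - B p.1.2 (J p)|)
    fun p => abs_pos.mpr (sub_ne_zero.mpr (hJ p))
  refine ⟨D / (2 * √K + 1), by positivity, fun n hn τ U W₁ hU hUW k l hkl => ?_⟩
  have hn0 : (0 : ℝ) < n := by exact_mod_cast hn
  have hsn : 0 < √(n : ℝ) := Real.sqrt_pos.mpr hn0
  set W := B * W₁ with hW
  -- Since `U` is an isometry and its rows are within `1 / (2 √n)` of those of `W`, one has `|y| =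
  -- |U y| ≤ |y| / 2 + √n |W y|`.
  have hlow : ∀ y, ‖WithLp.toLp 2 y‖ ≤ 2 * √n * ‖WithLp.toLp 2 (W.mulVec y)‖ := by
    intro y
    have h1 : ‖WithLp.toLp 2 (U.mulVec y)‖ = ‖WithLp.toLp 2 y‖ := by
      rw [← sq_eq_sq₀ (norm_nonneg _) (norm_nonneg _), norm_toLp_sq, norm_toLp_sq,
        Matrix.dotProduct_mulVec, ← Matrix.mulVec_transpose, Matrix.mulVec_mulVec, hU,
        Matrix.one_mulVec]
    set v : Fin n → ℝ := fun i => W.mulVec y (τ i) with hv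
    have h2 : ‖WithLp.toLp 2 (U.mulVec y - v)‖ ≤ ‖WithLp.toLp 2 y‖ / 2 := by
      refine le_of_sq_le_sq ?_ (by positivity)
      rw [norm_toLp_sq]
      have hterm : ∀ i, (U.mulVec y - v) i * (U.mulVec y - v) i ≤
          (1 / 2 / √n) ^ 2 * ‖WithLp.toLp 2 y‖ ^ 2 := by
        intro i
        have h3 : (U.mulVec y - v) i = ∑ j, (U i j - W (τ i) j) * y j := by
          simp only [Pi.sub_apply, hv, Matrix.mulVec, dotProduct, sub_mul, Finset.sum_sub_distrib]
        have h4 := Finset.sum_mul_sq_le_sq_mul_sq Finset.univ (fun j => U i j - W (τ i) j) y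
        have h5 := pow_le_pow_left₀ (norm_nonneg _) (hUW i) 2
        rw [← WithLp.toLp_sub, norm_toLp_sq] at h5
        rw [← sq, h3]
        refine h4.trans ?_
        refine mul_le_mul ?_ (le_of_eq ?_) (Finset.sum_nonneg fun _ _ => sq_nonneg _)
          (sq_nonneg _)
        · simpa [dotProduct, sq] using h5
        · rw [norm_toLp_sq]; simp [dotProduct, sq]
      calc (U.mulVec y - v) ⬝ᵥ (U.mulVec y - v)
          ≤ ∑ _i : Fin n, (1 / 2 / √n) ^ 2 * ‖WithLp.toLp 2 y‖ ^ 2 :=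
            Finset.sum_le_sum fun i _ => hterm i
        _ = (‖WithLp.toLp 2 y‖ / 2) ^ 2 := by
            rw [Finset.sum_const, Finset.card_univ, Fintype.card_fin, nsmul_eq_mul, div_pow,
              Real.sq_sqrt hn0.le]
            field_simp
    have h3 : ‖WithLp.toLp 2 v‖ ≤ √n * ‖WithLp.toLp 2 (W.mulVec y)‖ := by
      refine le_of_sq_le_sq ?_ (by positivity)
      rw [mul_pow, Real.sq_sqrt hn0.le, norm_toLp_sq, norm_toLp_sq]
      calc v ⬝ᵥ v ≤ ∑ _i : Fin n, W.mulVec y ⬝ᵥ W.mulVec y :=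
            Finset.sum_le_sum fun i _ => Finset.single_le_sum (f := fun l =>
              W.mulVec y l * W.mulVec y l) (fun _ _ => mul_self_nonneg _) (Finset.mem_univ (τ i))
        _ = _ := by simp
    have h4 : ‖WithLp.toLp 2 (U.mulVec y)‖ ≤ ‖WithLp.toLp 2 (U.mulVec y - v)‖ +
        ‖WithLp.toLp 2 v‖ := by
      rw [WithLp.toLp_sub]
      simpa using norm_add_le (WithLp.toLp 2 (U.mulVec y) - WithLp.toLp 2 v) (WithLp.toLp 2 v)
    rw [h1] at h4
    linarith
  have hinj : Function.Injective W.mulVecLin := by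
    refine (injective_iff_map_eq_zero _).mpr fun y hy => ?_
    have h1 := hlow y
    rw [Matrix.mulVecLin_apply] at hy
    rw [hy, WithLp.toLp_zero, norm_zero, mul_zero] at h1
    have h2 : WithLp.toLp 2 y = 0 := norm_le_zero_iff.mp h1
    simpa using h2
  -- `W` has `B.rank` independent columns inside the column space of `B`. Hence every column of `B`
  -- is `W y` with `|y|` of order `√n`, and an entry distinguishing two rows of `B` forces the rows
  -- of `W` apart.
  have hrange : LinearMap.range W.mulVecLin = LinearMap.range B.mulVecLin := by
    refine Submodule.eq_of_le_of_finrank_eq ?_ ?_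
    · rw [hW, Matrix.mulVecLin_mul]
      exact LinearMap.range_comp_le_range _ _
    · rw [LinearMap.finrank_range_of_inj hinj]
      exact Module.finrank_fin_fun ℝ
  set j := J ⟨(k, l), hkl⟩ with hj
  obtain ⟨y, hy⟩ : B.mulVec (Pi.single j 1) ∈ LinearMap.range W.mulVecLin := by
    rw [hrange]; exact ⟨_, rfl⟩
  rw [Matrix.mulVecLin_apply] at hy
  have hcol : ∀ k, W.mulVec y k = B k j := by
    intro k; rw [hy]; simp
  have hynorm : ‖WithLp.toLp 2 y‖ ≤ 2 * √n * √K := by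
    refine (hlow y).trans ?_
    gcongr
    refine le_of_sq_le_sq ?_ (Real.sqrt_nonneg _)
    rw [norm_toLp_sq, Real.sq_sqrt (Nat.cast_nonneg K)]
    calc W.mulVec y ⬝ᵥ W.mulVec y ≤ ∑ _k : Fin K, (1 : ℝ) := by
          refine Finset.sum_le_sum fun k _ => ?_
          rw [hcol, ← sq, ← sq_abs]
          exact pow_le_one₀ (abs_nonneg _) (hB1 _ _)
      _ = K := by simp
  have hdiff : |B k j - B l j| ≤ ‖WithLp.toLp 2 (W k) - WithLp.toLp 2 (W l)‖ *
      ‖WithLp.toLp 2 y‖ := by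
    refine abs_le_of_sq_le_sq ?_ (by positivity)
    rw [mul_pow, ← WithLp.toLp_sub, norm_toLp_sq, norm_toLp_sq]
    have h3 : B k j - B l j = ∑ x, (W k x - W l x) * y x := by
      rw [← hcol, ← hcol]
      simp only [Matrix.mulVec, dotProduct, sub_mul, Finset.sum_sub_distrib]
    have h4 := Finset.sum_mul_sq_le_sq_mul_sq Finset.univ (fun x => W k x - W l x) y
    rw [h3]
    simpa [dotProduct, sq] using h4
  have hDle' := (hDle ⟨(k, l), hkl⟩).trans hdiff
  rw [div_div, div_le_iff₀ (by positivity)]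
  refine hDle'.trans ?_
  refine mul_le_mul_of_nonneg_left (hynorm.trans ?_) (norm_nonneg _)
  nlinarith

/-- The expectation of the adjacency matrix expands a subspace of dimension `rank B`. -/
lemma exists_subspace_meanMatrix {n K : ℕ} (hn : 0 < n) {ρ : ℝ}
    {B : Matrix (Fin K) (Fin K) ℝ} {c c₀ : ℝ} (hc₀ : 0 < c₀)
    (hB : ∀ w ∈ LinearMap.range B.mulVecLin, c ^ 2 * (w ⬝ᵥ w) ≤ B.mulVec w ⬝ᵥ B.mulVec w)
    {τ : Fin n → Fin K}
    (hsize : ∀ k, c₀ * n ≤ ((Finset.univ.filter fun i => τ i = k).card : ℝ)) :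
    ∃ S : Submodule ℝ (Fin n → ℝ), B.rank ≤ Module.finrank ℝ S ∧ ∀ x ∈ S,
      (c₀ * c * (n * ρ)) ^ 2 * (x ⬝ᵥ x) ≤
        (meanMatrix ρ B τ).mulVec x ⬝ᵥ (meanMatrix ρ B τ).mulVec x := by
  have hn0 : (0 : ℝ) < n := by exact_mod_cast hn
  set N : Fin K → ℝ := fun k => ((Finset.univ.filter fun i => τ i = k).card : ℝ) with hN
  have hNpos : ∀ k, 0 < N k := fun k => lt_of_lt_of_le (by positivity) (hsize k)
  have hsum : ∀ f : Fin K → ℝ, ∑ i, f (τ i) = ∑ k, N k * f k := by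
    intro f
    rw [← Finset.sum_fiberwise Finset.univ τ (fun i => f (τ i))]
    refine Finset.sum_congr rfl fun k _ => ?_
    rw [Finset.sum_congr rfl (g := fun _ => f k) (fun i hi => by
      rw [(Finset.mem_filter.mp hi).2]), Finset.sum_const, nsmul_eq_mul]
  -- Dividing by the block sizes makes the mean matrix act as `ρ B`: the image of `Q w` is the
  -- vector with entries `ρ (B w) (τ i)`.
  let Q : (Fin K → ℝ) →ₗ[ℝ] (Fin n → ℝ) :=
    { toFun := fun w i => w (τ i) / N (τ i)
      map_add' := by intro v w; funext i; simp [add_div]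
      map_smul' := by intro t w; funext i; simp [mul_div_assoc] }
  have hQ : ∀ w i, Q w i = w (τ i) / N (τ i) := fun _ _ => rfl
  have hQinj : Function.Injective Q := by
    refine (injective_iff_map_eq_zero _).mpr fun w hw => ?_
    funext k
    have hne : (Finset.univ.filter fun i => τ i = k).Nonempty := by
      have h0 := hNpos k
      simp only [hN] at h0
      rw [← Finset.card_pos]
      exact_mod_cast h0
    obtain ⟨i, hi⟩ := hne
    have hi' : τ i = k := by simpa using hi
    have h1 := congrFun hw i
    rw [hQ, hi', Pi.zero_apply, div_eq_zero_iff] at h1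
    exact h1.resolve_right (hNpos k).ne'
  refine ⟨(LinearMap.range B.mulVecLin).map Q, ?_, ?_⟩
  · exact (Submodule.equivMapOfInjective Q hQinj (LinearMap.range B.mulVecLin)).finrank_eq.le
  · rintro _ ⟨w, hw, rfl⟩
    have hP : ∀ i, (meanMatrix ρ B τ).mulVec (Q w) i = ρ * B.mulVec w (τ i) := by
      intro i
      simp only [Matrix.mulVec, dotProduct, meanMatrix, Matrix.of_apply, hQ]
      rw [hsum fun k => ρ * B (τ i) k * (w k / N k), Finset.mul_sum]
      refine Finset.sum_congr rfl fun k _ => ?_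
      have := (hNpos k).ne'
      field_simp
    have h1 : (meanMatrix ρ B τ).mulVec (Q w) ⬝ᵥ (meanMatrix ρ B τ).mulVec (Q w) =
        ∑ k, N k * (ρ ^ 2 * (B.mulVec w k * B.mulVec w k)) := by
      rw [← hsum fun k => ρ ^ 2 * (B.mulVec w k * B.mulVec w k)]
      refine Finset.sum_congr rfl fun i _ => ?_
      rw [hP]; ring
    have h2 : Q w ⬝ᵥ Q w = ∑ k, N k * ((w k / N k) * (w k / N k)) := by
      rw [← hsum fun k => (w k / N k) * (w k / N k)]
      rfl
    have h3 : c₀ * n * (Q w ⬝ᵥ Q w) ≤ w ⬝ᵥ w := by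
      rw [h2, Finset.mul_sum]
      refine Finset.sum_le_sum fun k _ => ?_
      have hk := hNpos k
      calc c₀ * n * (N k * (w k / N k * (w k / N k))) = (c₀ * n / N k) * (w k * w k) := by
            field_simp
        _ ≤ 1 * (w k * w k) := by
            refine mul_le_mul_of_nonneg_right ?_ (mul_self_nonneg _)
            rw [div_le_one hk]; exact hsize k
        _ = _ := one_mul _
    have h4 : c₀ * n * (ρ ^ 2 * (B.mulVec w ⬝ᵥ B.mulVec w)) ≤
        ∑ k, N k * (ρ ^ 2 * (B.mulVec w k * B.mulVec w k)) := by
      rw [dotProduct, Finset.mul_sum, Finset.mul_sum]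
      refine Finset.sum_le_sum fun k _ => mul_le_mul_of_nonneg_right (hsize k) ?_
      exact mul_nonneg (sq_nonneg _) (mul_self_nonneg _)
    rw [h1]
    refine le_trans ?_ h4
    have h5 := hB w hw
    calc (c₀ * c * (n * ρ)) ^ 2 * (Q w ⬝ᵥ Q w)
        = c₀ * n * (ρ ^ 2 * (c ^ 2 * (c₀ * n * (Q w ⬝ᵥ Q w)))) := by ring
      _ ≤ c₀ * n * (ρ ^ 2 * (c ^ 2 * (w ⬝ᵥ w))) := by gcongr
      _ ≤ _ := by gcongr

/-! ### Typical graphs: their spectrum and exact recovery on them. -/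

/-- The properties of a blockmodel graph with adjacency matrix `A` and labels `τ` on which exact
recovery rests: all blocks are large, and the powers of the noise matrix `A - 𝔼 A` have entries and
block sums of the expected order, up to the factor `D`. -/
structure IsTypical {n K : ℕ} (B : Matrix (Fin K) (Fin K) ℝ) (ρ : ℝ) (g : ℕ) (c₀ D : ℝ)
    (A : Fin n → Fin n → ℝ) (τ : Fin n → Fin K) : Prop where
  symm : ∀ i j, A i j = A j i
  nonneg : ∀ i j, 0 ≤ A i j
  size : ∀ k, c₀ * n ≤ ((Finset.univ.filter fun i => τ i = k).card : ℝ)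
  walk : ∀ j ≤ 2 * g, ∀ i l,
    |((Matrix.of A - meanMatrix ρ B τ) ^ j * memberMatrix τ) i l| ≤ √(n * ρ) ^ j * D
  closed : ∀ i, ((Matrix.of A - meanMatrix ρ B τ) ^ (2 * g)) i i ≤ √(n * ρ) ^ (2 * g) * D

section Typical

variable {n K g : ℕ} {B : Matrix (Fin K) (Fin K) ℝ} {ρ c₀ D : ℝ} {A : Fin n → Fin n → ℝ}
  {τ : Fin n → Fin K}

lemma sum_memberMatrix_apply (τ : Fin n → Fin K) (i : Fin n) : ∑ l, memberMatrix τ i l = 1 := by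
  simp [memberMatrix]

lemma IsTypical.isHermitian_sub (h : IsTypical B ρ g c₀ D A τ) (hB : B.IsSymm) :
    (Matrix.of A - meanMatrix ρ B τ).IsHermitian := by
  ext i j
  have h1 : B (τ i) (τ j) = B (τ j) (τ i) := by
    conv_lhs => rw [← hB.eq]
    rfl
  simp [meanMatrix, h.symm i j, h1]

/-- The mean contributes at most `n ρ` to a row sum. The noise is the sum over blocks of `walk` with
`j = 1`, hence at most `K D √(n ρ) ≤ n ρ`. -/
lemma IsTypical.sum_row_le (h : IsTypical B ρ g c₀ D A τ) (hg : 1 ≤ g) (hρ : 0 ≤ ρ)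
    (hB1 : ∀ k l, B k l ≤ 1) (hD : K * D ≤ √(n * ρ)) (i : Fin n) :
    ∑ j, A i j ≤ 2 * (n * ρ) := by
  have hq : 0 ≤ n * ρ := mul_nonneg (Nat.cast_nonneg n) hρ
  set E : Matrix (Fin n) (Fin n) ℝ := Matrix.of A - meanMatrix ρ B τ with hE
  have h1 : ∑ j, E i j = ∑ l : Fin K, (E ^ 1 * memberMatrix τ : Matrix (Fin n) (Fin K) ℝ) i l := by
    simp only [pow_one, Matrix.mul_apply]
    rw [Finset.sum_comm]
    refine Finset.sum_congr rfl fun j _ => ?_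
    rw [← Finset.mul_sum, sum_memberMatrix_apply, mul_one]
  have h2 : ∑ j, E i j ≤ n * ρ := by
    rw [h1]
    calc ∑ l : Fin K, (E ^ 1 * memberMatrix τ : Matrix (Fin n) (Fin K) ℝ) i l ≤ ∑ _l : Fin K, √(n * ρ) ^ 1 * D :=
          Finset.sum_le_sum fun l _ => (le_abs_self _).trans (h.walk 1 (by omega) i l)
      _ = √(n * ρ) * (K * D) := by
          simp only [pow_one, Finset.sum_const, Finset.card_univ, Fintype.card_fin, nsmul_eq_mul]
          ring
      _ ≤ √(n * ρ) * √(n * ρ) := by gcongr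
      _ = n * ρ := Real.mul_self_sqrt hq
  have h3 : ∑ j, meanMatrix ρ B τ i j ≤ n * ρ := by
    calc ∑ j, meanMatrix ρ B τ i j ≤ ∑ _j : Fin n, ρ :=
          Finset.sum_le_sum fun j _ => mul_le_of_le_one_right hρ (hB1 _ _)
      _ = n * ρ := by simp
  have h4 : ∑ j, A i j = ∑ j, E i j + ∑ j, meanMatrix ρ B τ i j := by
    rw [← Finset.sum_add_distrib]
    refine Finset.sum_congr rfl fun j _ => ?_
    simp [hE]
  linarith

/-- With `b = 2 n ρ` this bounds the norm of the columns of `A ^ m Z` by `√n (2 n ρ) ^ m`, the size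
of the block sums in the expansion. -/
lemma pow_mul_memberMatrix_mem_Icc (hA : ∀ i j, 0 ≤ A i j) {b : ℝ} (hrow : ∀ i, ∑ j, A i j ≤ b)
    (m : ℕ) (i : Fin n) (l : Fin K) :
    (Matrix.of A ^ m * memberMatrix τ) i l ∈ Set.Icc 0 (b ^ m) := by
  induction m generalizing i with
  | zero =>
    simp only [pow_zero, Matrix.one_mul, memberMatrix, Matrix.of_apply]
    split_ifs <;> simp
  | succ m ih =>
    rw [pow_succ' (Matrix.of A), Matrix.mul_assoc, Matrix.mul_apply]
    have hb : 0 ≤ b := (Finset.sum_nonneg fun j _ => hA i j).trans (hrow i)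
    refine ⟨Finset.sum_nonneg fun j _ => mul_nonneg (hA i j) (ih j).1, ?_⟩
    calc ∑ j, A i j * (Matrix.of A ^ m * memberMatrix τ) j l ≤ ∑ j, A i j * b ^ m :=
          Finset.sum_le_sum fun j _ => mul_le_mul_of_nonneg_left (ih j).2 (hA i j)
      _ = (∑ j, A i j) * b ^ m := by rw [Finset.sum_mul]
      _ ≤ b * b ^ m := by
          have := hrow i
          gcongr
      _ = b ^ (m + 1) := (pow_succ' b m).symm

/-- The mean expands a subspace of dimension `B.rank` by `c₀ c n ρ`, while the trace bound from
`closed` keeps the operator norm of the noise below half of that. So `A` still expands the subspace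
by the other half. -/
lemma IsTypical.exists_eigenvectors (h : IsTypical B ρ g c₀ D A τ) (hB : B.IsSymm) (hn : 0 < n)
    (hg : 1 ≤ g) (hρ : 0 ≤ ρ) (hc₀ : 0 < c₀) {c : ℝ} (hc : 0 < c)
    (hBc : ∀ w ∈ LinearMap.range B.mulVecLin, c ^ 2 * (w ⬝ᵥ w) ≤ B.mulVec w ⬝ᵥ B.mulVec w)
    (hD : n * D ≤ (c₀ * c / 2) ^ (2 * g) * (n * ρ) ^ g) :
    ∃ (R : Matrix (Fin B.rank) (Fin n) ℝ) (lam : Fin B.rank → ℝ), R * R.transpose = 1 ∧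
      R * Matrix.of A = Matrix.diagonal lam * R ∧ ∀ j, c₀ * c / 2 * (n * ρ) ≤ |lam j| := by
  have hq : 0 ≤ n * ρ := mul_nonneg (Nat.cast_nonneg n) hρ
  set q := n * ρ with hqdef
  set c₁ := c₀ * c / 2 with hc₁
  have hc₁0 : 0 < c₁ := by positivity
  have hA : (Matrix.of A).IsHermitian := by
    ext i j
    simp [h.symm i j]
  have hE := h.isHermitian_sub hB
  set E := Matrix.of A - meanMatrix ρ B τ with hEdef
  have hop : ∀ x, E.mulVec x ⬝ᵥ E.mulVec x ≤ (c₁ * q) ^ 2 * (x ⬝ᵥ x) := by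
    refine dotProduct_mulVec_self_le_of_pow hE (by omega : g ≠ 0) ?_
    calc ∑ i, (E ^ (2 * g)) i i ≤ ∑ _i : Fin n, √q ^ (2 * g) * D :=
          Finset.sum_le_sum fun i _ => h.closed i
      _ = q ^ g * (n * D) := by
          rw [Finset.sum_const, Finset.card_univ, Fintype.card_fin, nsmul_eq_mul, pow_mul,
            Real.sq_sqrt hq]
          ring
      _ ≤ q ^ g * (c₁ ^ (2 * g) * q ^ g) := by gcongr
      _ = (c₁ * q) ^ (2 * g) := by ring
  obtain ⟨S, hS, hSx⟩ := exists_subspace_meanMatrix hn (ρ := ρ) hc₀ hBc h.size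
  refine exists_eigenvectors_of_subspace hA S hS (by positivity) fun x hx => ?_
  have h1 := hSx x hx
  have h2 := hop x
  rw [← norm_toLp_sq, ← norm_toLp_sq, ← mul_pow] at h1 h2 ⊢
  have h3' : c₀ * c * q * ‖WithLp.toLp 2 x‖ ≤ ‖WithLp.toLp 2 ((meanMatrix ρ B τ).mulVec x)‖ :=
    le_of_sq_le_sq h1 (norm_nonneg _)
  have h4' : ‖WithLp.toLp 2 (E.mulVec x)‖ ≤ c₁ * q * ‖WithLp.toLp 2 x‖ :=
    le_of_sq_le_sq h2 (by positivity)
  have h5 : ‖WithLp.toLp 2 ((meanMatrix ρ B τ).mulVec x)‖ ≤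
      ‖WithLp.toLp 2 ((Matrix.of A).mulVec x)‖ + ‖WithLp.toLp 2 (E.mulVec x)‖ := by
    have : meanMatrix ρ B τ = Matrix.of A - E := by rw [hEdef]; abel
    rw [this, Matrix.sub_mulVec, WithLp.toLp_sub]
    exact norm_sub_le _ _
  refine pow_le_pow_left₀ (by positivity) ?_ 2
  have h6 : c₀ * c * q * ‖WithLp.toLp 2 x‖ = 2 * (c₁ * q * ‖WithLp.toLp 2 x‖) := by
    rw [hc₁]; ring
  linarith

end Typical

lemma one_le_of_one_le_mul {ε q : ℝ} (hε : 0 < ε) (hε1 : ε ≤ 1) (h : 1 ≤ ε * q) : 1 ≤ q := by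
  have : 0 ≤ q := by
    by_contra hq
    have := mul_neg_of_pos_of_neg hε (not_le.mp hq)
    linarith
  nlinarith

/-- The size of the `j`-th error term in the expansion of the embedding. -/
lemma expansion_term_le {n K q ρ D ε c T s : ℝ} {g j : ℕ} (hn : 0 < n) (hK : 0 ≤ K) (hc : 0 < c)
    (hs : 0 < s) (hTs : T ≤ D * s) (hD : 1 ≤ D) (hε : 0 < ε) (hε1 : ε ≤ 1)
    (hq : q = n * ρ) (hDq : D ^ 4 ≤ ε * q) (hj : 1 ≤ j) (hjg : j < g) :
    K * (√q ^ j * D * (K * (ρ * (T * (√n * (2 * q) ^ (g - 1 - j)) / (s * (c * q) ^ g))))) ≤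
      K ^ 2 * (2 ^ g / c ^ g) * √ε / √n := by
  have hD4 : 1 ≤ D ^ 4 := one_le_pow₀ hD
  have hq1 : 1 ≤ q := one_le_of_one_le_mul hε hε1 (hD4.trans hDq)
  have hq0 : 0 < q := by linarith
  have hρ : ρ = q / n := by rw [hq]; field_simp
  have hρ0 : 0 < ρ := by rw [hρ]; positivity
  have hsn : 0 < √n := Real.sqrt_pos.mpr hn
  have hsn2 : √n * √n = n := Real.mul_self_sqrt hn.le
  set h := √q with hh
  have hh2 : h * h = q := Real.mul_self_sqrt hq0.le
  have hh1 : 1 ≤ h := Real.one_le_sqrt.mpr hq1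
  -- One factor `D` comes from the noise power and one from `T ≤ D s`. Both are absorbed by a single
  -- `√q`, available because `j ≥ 1`.
  have hD2 : D ^ 2 ≤ √ε * h := by
    rw [hh, ← Real.sqrt_mul hε.le]
    refine Real.le_sqrt_of_sq_le ?_
    calc (D ^ 2) ^ 2 = D ^ 4 := by ring
      _ ≤ _ := hDq
  have hkey : h ^ j * D ^ 2 * q ^ (g - j) ≤ √ε * q ^ g := by
    have h1 : q ^ g = q ^ (g - j) * (h ^ j * h ^ j) := by
      rw [← mul_pow, hh2, ← pow_add]; congr 1; omega
    have h2 : h ≤ h ^ j := le_self_pow₀ hh1 (by omega)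
    calc h ^ j * D ^ 2 * q ^ (g - j) ≤ h ^ j * (√ε * h) * q ^ (g - j) := by gcongr
      _ ≤ h ^ j * (√ε * h ^ j) * q ^ (g - j) := by gcongr
      _ = √ε * q ^ g := by rw [h1]; ring
  have hpow : 2 ^ (g - 1 - j) ≤ (2 : ℝ) ^ g := pow_le_pow_right₀ (by norm_num) (by omega)
  have hqq : q * q ^ (g - 1 - j) = q ^ (g - j) := by
    rw [← pow_succ']; congr 1; omega
  calc K * (h ^ j * D * (K * (ρ * (T * (√n * (2 * q) ^ (g - 1 - j)) / (s * (c * q) ^ g)))))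
      ≤ K * (h ^ j * D * (K * (ρ * (D * s * (√n * (2 * q) ^ (g - 1 - j)) / (s * (c * q) ^ g))))) := by
        gcongr
    _ = K ^ 2 / c ^ g * 2 ^ (g - 1 - j) * (h ^ j * D ^ 2 * (q * q ^ (g - 1 - j))) *
          (√n / n) / q ^ g := by
        rw [hρ, mul_pow, mul_pow]
        field_simp
    _ = K ^ 2 / c ^ g * 2 ^ (g - 1 - j) * (h ^ j * D ^ 2 * q ^ (g - j)) * (1 / √n) / q ^ g := by
        rw [hqq]
        congr 2
        rw [div_eq_div_iff hn.ne' hsn.ne', hsn2, one_mul]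
    _ ≤ K ^ 2 / c ^ g * 2 ^ g * (√ε * q ^ g) * (1 / √n) / q ^ g := by gcongr
    _ = _ := by field_simp

/-- The size of the last error term in the expansion of the embedding. -/
lemma expansion_last_le {n q D ε c T s : ℝ} {g : ℕ} (hn : 0 < n) (hc : 0 < c) (hs : 0 < s)
    (hTs : T ≤ D * s) (hD : 1 ≤ D) (hε : 0 < ε) (hq0 : 0 < q)
    (hDq : n * D ^ 4 ≤ ε * q ^ g) :
    T * √(q ^ g * D) / (s * (c * q) ^ g) ≤ 1 / c ^ g * √ε / √n := by
  have hsn : 0 < √n := Real.sqrt_pos.mpr hn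
  -- After squaring this reads `n D ^ 3 ≤ ε q ^ g`; here the power `g` must make `q ^ g` larger than
  -- `n`.
  have hkey : D * √(q ^ g * D) ≤ √ε * q ^ g / √n := by
    rw [le_div_iff₀ hsn]
    refine le_of_sq_le_sq ?_ (by positivity)
    rw [mul_pow, mul_pow, mul_pow, Real.sq_sqrt (by positivity), Real.sq_sqrt hn.le,
      Real.sq_sqrt hε.le]
    calc D ^ 2 * (q ^ g * D) * n = q ^ g * (n * D ^ 3) := by ring
      _ ≤ q ^ g * (n * D ^ 4) := by
          gcongr
          norm_num
      _ ≤ q ^ g * (ε * q ^ g) := by gcongr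
      _ = _ := by ring
  calc T * √(q ^ g * D) / (s * (c * q) ^ g) ≤ D * s * √(q ^ g * D) / (s * (c * q) ^ g) := by
        gcongr
    _ = D * √(q ^ g * D) / (c * q) ^ g := by field_simp
    _ ≤ (√ε * q ^ g / √n) / (c * q) ^ g := by gcongr
    _ = _ := by rw [mul_pow]; field_simp

/-- Exact recovery for typical graphs and sketches. -/
theorem exists_forall_isTypical_exactlyRecovers {K : ℕ} {B : Matrix (Fin K) (Fin K) ℝ}
    (hB : B.IsSymm) (hB01 : ∀ k l, B k l ∈ Set.Icc (0 : ℝ) 1) (hrows : ∀ k l, k ≠ l → B k ≠ B l)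
    (hrank : 1 ≤ B.rank) {g : ℕ} (hg : 1 ≤ g) {c₀ : ℝ} (hc₀ : 0 < c₀) (hc₀1 : c₀ ≤ 1) :
    ∃ ε : ℝ, 0 < ε ∧ ∀ (n : ℕ), 0 < n → ∀ (ρ D : ℝ), 0 ≤ ρ → 1 ≤ D →
      D ^ 4 ≤ ε * (n * ρ) → n * D ^ 4 ≤ ε * (n * ρ) ^ g →
      ∀ (A : Fin n → Fin n → ℝ) (τ : Fin n → Fin K), IsTypical B ρ g c₀ D A τ →
      ∃ R : Matrix (Fin B.rank) (Fin n) ℝ, R * R.transpose = 1 ∧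
      ∃ vs : Finset (Fin n → ℝ), vs.card ≤ g * K + n ∧
      ∀ (a k : ℕ) (G : Fin a → Fin n → Fin k → ℝ) (T s : ℝ), 0 ≤ T → 0 < s → T ≤ D * s →
      (∀ b, ∀ v ∈ vs, ∑ q, (∑ i, v i * G b i q) ^ 2 ≤ T ^ 2 * (v ⬝ᵥ v)) →
      (∃ b, IsWellConditioned s (fun x q => ∑ i, R x i * G b i q)) →
      ∀ σ : Fin n → Fin K, IsRSVDClustering A B.rank g G σ → ExactlyRecovers σ τ := by
  have hB1 : ∀ k l, |B k l| ≤ 1 := fun k l => abs_le.mpr ⟨by linarith [(hB01 k l).1], (hB01 k l).2⟩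
  obtain ⟨c, hc, hBc⟩ := exists_pos_mul_dotProduct_le hB
  obtain ⟨Δ, hΔ, hsep⟩ := exists_pos_forall_row_separation hrows hB1
  set c₁ := c₀ * c / 2 with hc₁
  have hc₁0 : 0 < c₁ := by positivity
  set M : ℝ := g * ((K : ℝ) ^ 2 * (2 ^ g / c₁ ^ g)) + 1 / c₁ ^ g with hM
  have hM0 : 0 < M := by positivity
  -- The permitted row error in units of `1 / √n`: `1 / 2` is required by `hsep`, the other value by
  -- the clustering lemma.
  set η : ℝ := min (1 / 2) (c₀ * Δ / 16) with hη
  have hη0 : 0 < η := by positivity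
  -- The entries serve in turn `q ≥ 1`, the row-sum condition `K D ≤ √q`, the eigenvalue bound, and
  -- the total error `√ε M ≤ η`.
  set ε : ℝ := min (min 1 (1 / ((K : ℝ) ^ 2 + 1))) (min (c₁ ^ (2 * g)) ((η / M) ^ 2)) with hε
  have hε0 : 0 < ε := by positivity
  have hε1 : ε ≤ 1 := (min_le_left _ _).trans (min_le_left _ _)
  have hεK : ε * (K : ℝ) ^ 2 ≤ 1 := by
    have h1 : ε ≤ 1 / ((K : ℝ) ^ 2 + 1) := (min_le_left _ _).trans (min_le_right _ _)
    rw [le_div_iff₀ (by positivity)] at h1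
    linarith
  have hεc : ε ≤ c₁ ^ (2 * g) := (min_le_right _ _).trans (min_le_left _ _)
  have hεη : √ε * M ≤ η := by
    rw [← le_div_iff₀ hM0]
    refine Real.sqrt_le_iff.mpr ⟨by positivity, (min_le_right _ _).trans (min_le_right _ _)⟩
  refine ⟨ε, hε0, fun n hn ρ D hρ hD hD1 hD2 A τ htyp => ?_⟩
  have hn0 : (0 : ℝ) < n := by exact_mod_cast hn
  have hsn : 0 < √(n : ℝ) := Real.sqrt_pos.mpr hn0
  set q := (n : ℝ) * ρ with hq
  have hD4 : 1 ≤ D ^ 4 := one_le_pow₀ hD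
  have hDD4 : D ≤ D ^ 4 := le_self_pow₀ hD (by norm_num)
  have hq1 : 1 ≤ q := one_le_of_one_le_mul hε0 hε1 (hD4.trans hD1)
  have hq0 : 0 < q := by linarith
  have hKD : K * D ≤ √q := by
    refine Real.le_sqrt_of_sq_le ?_
    calc ((K : ℝ) * D) ^ 2 = (K : ℝ) ^ 2 * D ^ 2 := by ring
      _ ≤ (K : ℝ) ^ 2 * D ^ 4 := by
          gcongr
          norm_num
      _ ≤ (K : ℝ) ^ 2 * (ε * q) := by gcongr
      _ = (ε * (K : ℝ) ^ 2) * q := by ring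
      _ ≤ 1 * q := by gcongr
      _ = q := one_mul q
  have hrow := htyp.sum_row_le hg hρ (fun k l => (hB01 k l).2) hKD
  have hDn : n * D ≤ c₁ ^ (2 * g) * q ^ g := by
    calc n * D ≤ n * D ^ 4 := by gcongr
      _ ≤ ε * q ^ g := hD2
      _ ≤ _ := by gcongr
  obtain ⟨R, lam, hR, hRA, hlam⟩ := htyp.exists_eigenvectors hB hn hg hρ hc₀ hc hBc hDn
  set E := Matrix.of A - meanMatrix ρ B τ with hE
  have hAE : Matrix.of A - E = meanMatrix ρ B τ := by rw [hE]; abel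
  let v : ℕ → Fin K → Fin n → ℝ := fun m l i => (Matrix.of A ^ m * memberMatrix τ) i l
  classical
  -- The tested vectors are the columns of `A ^ m Z`, `m < g`, and the rows of `E ^ g`. They are
  -- fixed before the sketches are drawn, which is what permits a union bound over them.
  refine ⟨R, hR, ((Finset.range g ×ˢ Finset.univ).image fun p : ℕ × Fin K => v p.1 p.2) ∪
    Finset.univ.image fun i => (E ^ g) i, ?_, ?_⟩
  · refine (Finset.card_union_le _ _).trans (add_le_add ?_ ?_)
    · exact Finset.card_image_le.trans (by simp)
    · exact Finset.card_image_le.trans (by simp)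
  intro a k G T s hT hs hTs hnoise ⟨b, hwell⟩ σ hσ
  obtain ⟨U, ⟨t, htmax, hU⟩, hclust⟩ := hσ
  -- The selected sketch `t` need not be well conditioned itself; maximality gives it the singular
  -- value bound of sketch `b`.
  have hsig : s * (c₁ * q) ^ g ≤ singularValue (Matrix.of A ^ g * Matrix.of (G t)) B.rank :=
    (mul_pow_le_singularValue hrank hR hRA (by positivity) hlam hs hwell).trans (htmax b)
  obtain ⟨H, hYH, hH⟩ := hU.exists_right_factor (by positivity) hsig
  set s₀ := s * (c₁ * q) ^ g with hs₀
  have hs₀0 : 0 < s₀ := by positivity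
  set F := Matrix.of (G t) * H with hF
  have hUF : Matrix.of A ^ g * F = U := by rw [hF, ← Matrix.mul_assoc, hYH]
  have hGv : ∀ w, (∑ q, (∑ i, w i * G t i q) ^ 2 ≤ T ^ 2 * (w ⬝ᵥ w)) → ∀ x, 0 ≤ x → w ⬝ᵥ w ≤ x ^ 2 →
      ‖WithLp.toLp 2 (Matrix.vecMul (Matrix.vecMul w (Matrix.of (G t))) H)‖ ≤ T * x / s₀ := by
    intro w hw x hx hwx
    refine (hH _).trans ?_
    refine div_le_div_of_nonneg_right ?_ hs₀0.le
    refine le_of_sq_le_sq ?_ (by positivity)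
    rw [norm_toLp_sq, mul_pow]
    calc Matrix.vecMul w (Matrix.of (G t)) ⬝ᵥ Matrix.vecMul w (Matrix.of (G t))
        = ∑ q, (∑ i, w i * G t i q) ^ 2 := Finset.sum_congr rfl fun q _ => (sq _).symm
      _ ≤ T ^ 2 * (w ⬝ᵥ w) := hw
      _ ≤ T ^ 2 * x ^ 2 := by gcongr
  have hAT : (Matrix.of A).transpose = Matrix.of A := by
    ext i j; exact htyp.symm j i
  have hblock : ∀ m < g, ∀ l, ‖WithLp.toLp 2 (((memberMatrix τ).transpose *
      (Matrix.of A ^ m * F)) l)‖ ≤ T * (√n * (2 * q) ^ m) / s₀ := by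
    intro m hm l
    have h1 : ((memberMatrix τ).transpose * (Matrix.of A ^ m * F)) l =
        Matrix.vecMul (Matrix.vecMul (v m l) (Matrix.of (G t))) H := by
      have h2 : (memberMatrix τ).transpose * (Matrix.of A ^ m * F) =
          ((Matrix.of A ^ m * memberMatrix τ).transpose * Matrix.of (G t)) * H := by
        rw [Matrix.transpose_mul, Matrix.transpose_pow, hAT, hF]
        simp only [Matrix.mul_assoc]
      rw [h2]
      rfl
    rw [h1]
    refine hGv _ (hnoise t _ ?_) _ (by positivity) ?_
    · refine Finset.mem_union_left _ (Finset.mem_image.mpr ⟨(m, l), ?_, rfl⟩)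
      simpa using hm
    · rw [mul_pow, Real.sq_sqrt hn0.le]
      calc v m l ⬝ᵥ v m l ≤ ∑ _i : Fin n, ((2 * q) ^ m) ^ 2 := by
            refine Finset.sum_le_sum fun i _ => ?_
            rw [← sq]
            have h3 := pow_mul_memberMatrix_mem_Icc (τ := τ) htyp.nonneg hrow m i l
            exact pow_le_pow_left₀ h3.1 h3.2 2
        _ = _ := by simp
  have hET : E.transpose = E := by
    have h1 := (htyp.isHermitian_sub hB).eq
    rwa [Matrix.conjTranspose_eq_transpose_of_trivial] at h1
  have hlast : ∀ i, ‖WithLp.toLp 2 ((E ^ g * F) i)‖ ≤ T * √(q ^ g * D) / s₀ := by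
    intro i
    have h1 : (E ^ g * F) i = Matrix.vecMul (Matrix.vecMul ((E ^ g) i) (Matrix.of (G t))) H := by
      rw [hF, ← Matrix.mul_assoc]
      rfl
    rw [h1]
    refine hGv _ (hnoise t _ ?_) _ (Real.sqrt_nonneg _) ?_
    · exact Finset.mem_union_right _ (Finset.mem_image.mpr ⟨i, Finset.mem_univ i, rfl⟩)
    · rw [Real.sq_sqrt (by positivity)]
      have h2 : (E ^ g) i ⬝ᵥ (E ^ g) i = (E ^ (2 * g)) i i := by
        have h3 : (E ^ g).transpose = E ^ g := by rw [Matrix.transpose_pow, hET]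
        rw [two_mul, pow_add, Matrix.mul_apply]
        refine Finset.sum_congr rfl fun j _ => ?_
        congr 1
        conv_lhs => rw [← h3]
        rfl
      rw [h2]
      have h4 := htyp.closed i
      rw [← hq, pow_mul √q, Real.sq_sqrt hq0.le] at h4
      exact h4
  have hrows' := norm_row_sub_le hg hρ hB1 hAE F
    (e := fun j => √q ^ j * D) (b := fun m => T * (√n * (2 * q) ^ m) / s₀) (fun j => by positivity)
    (fun j hj i l => htyp.walk j (by omega) i l) hblock hlast
  rw [hUF] at hrows'
  set W₁ := ρ • ((memberMatrix τ).transpose * (Matrix.of A ^ (g - 1) * F)) with hW₁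
  have hW : (ρ • B) * ((memberMatrix τ).transpose * (Matrix.of A ^ (g - 1) * F)) = B * W₁ := by
    rw [hW₁, Matrix.smul_mul, Matrix.mul_smul]
  rw [hW] at hrows'
  have hclose : ∀ i, ‖WithLp.toLp 2 (U i) - WithLp.toLp 2 ((B * W₁) (τ i))‖ ≤ η / √n := by
    intro i
    refine (hrows' i).trans ?_
    calc _ ≤ (∑ _j ∈ Finset.Ico 1 g, (K : ℝ) ^ 2 * (2 ^ g / c₁ ^ g) * √ε / √n) +
          1 / c₁ ^ g * √ε / √n := by
          refine add_le_add (Finset.sum_le_sum fun j hj => ?_) ?_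
          · rw [Finset.mem_Ico] at hj
            exact expansion_term_le hn0 (Nat.cast_nonneg K) hc₁0 hs hTs hD hε0 hε1 hq hD1
              hj.1 hj.2
          · exact expansion_last_le hn0 hc₁0 hs hTs hD hε0 hq0 hD2
      _ ≤ g * ((K : ℝ) ^ 2 * (2 ^ g / c₁ ^ g) * √ε / √n) + 1 / c₁ ^ g * √ε / √n := by
          rw [Finset.sum_const, nsmul_eq_mul]
          gcongr
          simp
      _ = √ε * M / √n := by rw [hM]; ring
      _ ≤ η / √n := by gcongr
  have hsepW := hsep n hn τ U W₁ hU.1 fun i => (hclose i).trans (by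
    gcongr
    exact min_le_left _ _)
  have hη16 : η ≤ c₀ * Δ / 16 := min_le_right _ _
  have hlt : η / √n < c₀ * (Δ / √n / 8) := by
    rw [show c₀ * (Δ / √n / 8) = (c₀ * Δ / 8) / √n by ring]
    refine div_lt_div_of_pos_right ?_ hsn
    have : 0 < c₀ * Δ := by positivity
    linarith
  rcases hclust with ⟨ctr, hctr⟩ | ⟨ctr, hctr⟩
  · exact exactlyRecovers_of_separated (p := 2) (Or.inr rfl) hc₀ hc₀1 hn (by positivity) hlt
      (ν := fun k => WithLp.toLp 2 ((B * W₁) k)) hclose hsepW htyp.size hctr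
  · exact exactlyRecovers_of_separated (p := 1) (Or.inl rfl) hc₀ hc₀1 hn (by positivity) hlt
      (ν := fun k => WithLp.toLp 2 ((B * W₁) k)) hclose hsepW htyp.size
      (fun σ' c' => by simpa only [pow_one] using hctr σ' c')

/-! ### Probability of large blocks and of regular graphs. -/

section BlockLaw

variable {K : ℕ} {π : Fin K → ℝ}

lemma isProbabilityMeasure_blockLaw (hπ : ∀ l, 0 ≤ π l) (hsum : ∑ l, π l = 1) :
    IsProbabilityMeasure (blockLaw π) := by
  refine ⟨?_⟩
  simp only [blockLaw, Measure.coe_finsetSum, Finset.sum_apply, Measure.smul_apply, measure_univ,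
    smul_eq_mul, mul_one]
  rw [← ENNReal.ofReal_sum_of_nonneg fun l _ => hπ l, hsum, ENNReal.ofReal_one]

lemma integrable_blockLaw (f : Fin K → ℝ) : Integrable f (blockLaw π) := by
  rw [blockLaw]
  exact integrable_finsetSum_measure.mpr fun l _ =>
    (integrable_dirac (by finiteness)).smul_measure ENNReal.ofReal_ne_top

lemma integral_blockLaw (hπ : ∀ l, 0 ≤ π l) (f : Fin K → ℝ) :
    ∫ x, f x ∂blockLaw π = ∑ l, π l * f l := by
  rw [blockLaw, integral_finsetSum_measure fun l _ =>
    (integrable_dirac (by finiteness)).smul_measure ENNReal.ofReal_ne_top]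
  refine Finset.sum_congr rfl fun l _ => ?_
  rw [integral_smul_measure, integral_dirac, ENNReal.toReal_ofReal (hπ l), smul_eq_mul]

/-- A block of probability `π k` is unlikely to have fewer than `π k * n / 4` members. -/
lemma measure_card_filter_le (hπ : ∀ l, 0 ≤ π l) (hsum : ∑ l, π l = 1) (n : ℕ) (k : Fin K) :
    (Measure.pi fun _ : Fin n => blockLaw π).real
      {τ | ((Finset.univ.filter fun i => τ i = k).card : ℝ) ≤ π k / 4 * n} ≤
      Real.exp (-(π k / 4 * n)) := by
  have := isProbabilityMeasure_blockLaw hπ hsum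
  set f : Fin K → ℝ := fun x => if x = k then -1 else 0 with hf
  have h1 := measure_pi_sum_ge_le (ι := Fin n) (f := f) (μ := blockLaw π) (integrable_blockLaw _)
    (-(π k / 4 * n))
  have h2 : ∫ x, Real.exp (f x) ∂blockLaw π = 1 - π k * (1 - Real.exp (-1)) := by
    rw [integral_blockLaw hπ]
    have h3 : ∀ l, π l * Real.exp (f l) =
        π l - if l = k then π l * (1 - Real.exp (-1)) else 0 := by
      intro l
      simp only [hf]
      split_ifs
      · ring
      · simp
    simp only [h3, Finset.sum_sub_distrib, hsum, Finset.sum_ite_eq', Finset.mem_univ, if_true]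
  have he : Real.exp (-1) ≤ 1 / 2 := by
    rw [Real.exp_neg, inv_eq_one_div]
    refine one_div_le_one_div_of_le (by norm_num) ?_
    linarith [Real.add_one_le_exp 1]
  -- The Chernoff bound is then `exp (π k n / 4) * exp (-π k n / 2)`.
  have h4 : ∫ x, Real.exp (f x) ∂blockLaw π ≤ Real.exp (-(π k / 2)) := by
    rw [h2]
    have h5 := Real.add_one_le_exp (-(π k / 2))
    have h6 := mul_le_mul_of_nonneg_left he (hπ k)
    linarith
  have h7 : 0 ≤ ∫ x, Real.exp (f x) ∂blockLaw π := integral_nonneg fun x => (Real.exp_pos _).le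
  have h8 : {τ : Fin n → Fin K | ((Finset.univ.filter fun i => τ i = k).card : ℝ) ≤ π k / 4 * n} =
      {τ | -(π k / 4 * n) ≤ ∑ i, f (τ i)} := by
    ext τ
    have h9 : ∑ i, f (τ i) = -((Finset.univ.filter fun i => τ i = k).card : ℝ) := by
      simp [hf, Finset.sum_ite]
    simp only [Set.mem_ofPred_eq, h9, neg_le_neg_iff]
  rw [h8]
  refine h1.trans ?_
  calc Real.exp (-(-(π k / 4 * n))) * (∫ x, Real.exp (f x) ∂blockLaw π) ^ Fintype.card (Fin n)
      ≤ Real.exp (-(-(π k / 4 * n))) * Real.exp (-(π k / 2)) ^ Fintype.card (Fin n) := by gcongr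
    _ = Real.exp (-(π k / 4 * n)) := by
        rw [← Real.exp_nat_mul, ← Real.exp_add, Fintype.card_fin]
        congr 1
        ring

end BlockLaw

section Bernoulli

variable {p : ℝ}

instance (p : ℝ) : IsProbabilityMeasure (bernoulliReal p) := by
  unfold bernoulliReal
  infer_instance

lemma integrable_bernoulliReal (f : ℝ → ℝ) : Integrable f (bernoulliReal p) :=
  integrable_bernoulliMeasure _ _ _ _

lemma integral_bernoulliReal (hp : p ∈ Set.Icc (0 : ℝ) 1) (f : ℝ → ℝ) :
    ∫ x, f x ∂bernoulliReal p = p * f 1 + (1 - p) * f 0 := by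
  rw [bernoulliReal, integral_bernoulliMeasure, Set.projIcc_of_mem _ hp]
  simp

lemma ae_bernoulliReal (p : ℝ) : ∀ᵐ x ∂bernoulliReal p, x ∈ ({0, 1} : Set ℝ) := by
  have h : MeasurableSet ({0, 1} : Set ℝ) := (Set.toFinite _).measurableSet
  rw [ae_iff]
  exact bernoulliMeasure_apply_of_notMem_of_notMem _ h.compl (by simp) (by simp)

lemma integral_sub_bernoulliReal (hp : p ∈ Set.Icc (0 : ℝ) 1) :
    ∫ x, (x - p) ∂bernoulliReal p = 0 := by
  rw [integral_bernoulliReal hp]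
  ring

lemma abs_integral_sub_pow_bernoulliReal_le (hp : p ∈ Set.Icc (0 : ℝ) 1) {l : ℕ} (hl : 2 ≤ l) :
    |∫ x, (x - p) ^ l ∂bernoulliReal p| ≤ p := by
  obtain ⟨h0, h1⟩ := hp
  rw [integral_bernoulliReal ⟨h0, h1⟩]
  have h2 : |(1 - p) ^ l| ≤ 1 - p := by
    rw [abs_of_nonneg (by have : 0 ≤ 1 - p := by linarith
                          positivity)]
    exact pow_le_of_le_one (by linarith) (by linarith) (by omega)
  have h3 : |(0 - p) ^ l| ≤ p * p := by
    rw [abs_pow, zero_sub, abs_neg, abs_of_nonneg h0, ← sq]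
    exact pow_le_pow_of_le_one h0 h1 hl
  calc |p * (1 - p) ^ l + (1 - p) * (0 - p) ^ l|
      ≤ |p * (1 - p) ^ l| + |(1 - p) * (0 - p) ^ l| := abs_add_le _ _
    _ = p * |(1 - p) ^ l| + (1 - p) * |(0 - p) ^ l| := by
        rw [abs_mul, abs_mul, abs_of_nonneg h0, abs_of_nonneg (by linarith : 0 ≤ 1 - p)]
    _ ≤ p * (1 - p) + (1 - p) * (p * p) := by
        have : 0 ≤ 1 - p := by linarith
        gcongr
    _ ≤ p := by nlinarith [mul_nonneg h0 h0, mul_nonneg (mul_nonneg h0 h0) h0]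

end Bernoulli

section Adjacency

variable {n K : ℕ}

/-- Adjacency matrices for which the powers of the noise matrix are of the expected order, up to
the factor `D`. -/
def regularGraphs (B : Matrix (Fin K) (Fin K) ℝ) (ρ : ℝ) (g : ℕ) (D : ℝ) (τ : Fin n → Fin K) :
    Set (Fin n → Fin n → ℝ) :=
  {A | (∀ i j, A i j ∈ ({0, 1} : Set ℝ)) ∧ (∀ i j, A i j = A j i) ∧
    (∀ j ≤ 2 * g, ∀ i l,
      |((Matrix.of A - meanMatrix ρ B τ) ^ j * memberMatrix τ) i l| ≤ √(n * ρ) ^ j * D) ∧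
    ∀ i, ((Matrix.of A - meanMatrix ρ B τ) ^ (2 * g)) i i ≤ √(n * ρ) ^ (2 * g) * D}

/-- Finiteness, due to the entries being `0` or `1`, makes every set of regular graphs measurable.
-/
lemma finite_regularGraphs (B : Matrix (Fin K) (Fin K) ℝ) (ρ : ℝ) (g : ℕ) (D : ℝ)
    (τ : Fin n → Fin K) : (regularGraphs B ρ g D τ).Finite := by
  refine (Set.Finite.pi fun _ => Set.Finite.pi fun _ => Set.toFinite ({0, 1} : Set ℝ)).subset ?_
  intro A hA
  simpa only [Set.mem_pi, Set.mem_univ, true_implies] using hA.1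

lemma isTypical_of_mem_regularGraphs {B : Matrix (Fin K) (Fin K) ℝ} {ρ : ℝ} {g : ℕ} {c₀ D : ℝ}
    {τ : Fin n → Fin K} {A : Fin n → Fin n → ℝ}
    (hsize : ∀ k, c₀ * n ≤ ((Finset.univ.filter fun i => τ i = k).card : ℝ))
    (hA : A ∈ regularGraphs B ρ g D τ) : IsTypical B ρ g c₀ D A τ where
  symm := hA.2.1
  nonneg i j := by
    rcases hA.1 i j with h | h
    · exact h.ge
    · rw [Set.mem_singleton_iff.mp h]
      exact zero_le_one
  size := hsize
  walk := hA.2.2.1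
  closed := hA.2.2.2

lemma measurable_symmMatrix : Measurable (symmMatrix (n := n)) :=
  measurable_pi_lambda _ fun _ => measurable_pi_lambda _ fun _ => measurable_pi_apply _

instance (ρ : ℝ) (B : Matrix (Fin K) (Fin K) ℝ) (t : Fin n → Fin K) :
    IsProbabilityMeasure (adjacencyLaw ρ B t) :=
  Measure.isProbabilityMeasure_map measurable_symmMatrix.aemeasurable

lemma of_symmMatrix_sub_meanMatrix {B : Matrix (Fin K) (Fin K) ℝ} (hB : B.IsSymm) (ρ : ℝ)
    (t : Fin n → Fin K) (x : EdgeIndex n → ℝ) :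
    Matrix.of (symmMatrix x) - meanMatrix ρ B t =
      Matrix.of (symmMatrix fun p => x p - ρ * B (t p.1.1) (t p.1.2)) := by
  ext i j
  show symmMatrix x i j - ρ * B (t i) (t j) =
    symmMatrix x i j - ρ * B (t (min i j)) (t (max i j))
  rcases le_total i j with h | h
  · rw [min_eq_left h, max_eq_right h]
  · rw [min_eq_right h, max_eq_left h, hB.apply]

/-- Almost all graphs are regular. -/
lemma measure_compl_regularGraphs_le {B : Matrix (Fin K) (Fin K) ℝ} (hB : B.IsSymm)
    (hB01 : ∀ k l, B k l ∈ Set.Icc (0 : ℝ) 1) {ρ : ℝ} (hρ : 0 ≤ ρ) (hρB : ∀ k l, ρ * B k l ≤ 1)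
    (hr : 1 ≤ n * ρ) (g k : ℕ) {D : ℝ} (hD : 0 < D) (t : Fin n → Fin K) :
    (adjacencyLaw ρ B t).real (regularGraphs B ρ g D t)ᶜ ≤
      ((2 * g + 1 : ℕ) * (n * (K + n))) *
        ((((2 * (k * (2 * g)) : ℕ) : ℝ) + 1) ^ (2 * (k * (2 * g))) / D ^ (2 * k)) := by
  set T := 2 * (k * (2 * g)) with hT
  set m : EdgeIndex n → ℝ := fun p => ρ * B (t p.1.1) (t p.1.2) with hm
  set μ : EdgeIndex n → Measure ℝ := fun p => bernoulliReal (m p) with hμ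
  have hm01 : ∀ p, m p ∈ Set.Icc (0 : ℝ) 1 := fun p =>
    ⟨mul_nonneg hρ (hB01 _ _).1, hρB _ _⟩
  have hmρ : ∀ p, m p ≤ ρ := fun p => mul_le_of_le_one_right hρ (hB01 _ _).2
  -- Block indicators give the entries of `E ^ j Z`, and unit vectors give the diagonal of `E ^ (2
  -- g)`. One concentration bound covers both.
  set z : Fin K ⊕ Fin n → Fin n → ℝ :=
    Sum.elim (fun l i => memberMatrix t i l) (fun j => Pi.single j 1) with hz
  have hz1 : ∀ y i, |z y i| ≤ 1 := by
    rintro (l | j) i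
    · simp only [hz, Sum.elim_inl, memberMatrix, Matrix.of_apply]
      split_ifs <;> simp
    · simp only [hz, Sum.elim_inr, Pi.single_apply]
      split_ifs <;> simp
  let W : Fin (2 * g + 1) × Fin n × (Fin K ⊕ Fin n) → Set (EdgeIndex n → ℝ) := fun w =>
    {x | √(n * ρ) ^ (w.1 : ℕ) * D ≤
      |((Matrix.of (symmMatrix (fun p => x p - m p))) ^ (w.1 : ℕ)).mulVec (z w.2.2) w.2.1|}
  have hW : ∀ w, (Measure.pi μ).real (W w) ≤ ((T : ℝ) + 1) ^ T / D ^ (2 * k) := by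
    rintro ⟨j, i, y⟩
    refine measure_pow_mulVec_ge_le ?_ hr (fun p l => integrable_bernoulliReal _)
      (fun p => integral_sub_bernoulliReal (hm01 p))
      (fun p l hl => (abs_integral_sub_pow_bernoulliReal_le (hm01 p) hl).trans (hmρ p))
      _ (hz1 y) i hD
    rw [hT]
    have := j.2
    gcongr
    show (j : ℕ) ≤ 2 * g
    omega
  set N : Set (EdgeIndex n → ℝ) := {x | ¬ ∀ p, x p ∈ ({0, 1} : Set ℝ)} with hN
  have hN0 : (Measure.pi μ).real N = 0 := by
    have h1 : ∀ᵐ x ∂Measure.pi μ, ∀ p, x p ∈ ({0, 1} : Set ℝ) :=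
      eventually_all.2 fun p => Measure.tendsto_eval_ae_ae.eventually (ae_bernoulliReal (m p))
    rw [measureReal_def, ae_iff.mp h1, ENNReal.toReal_zero]
  have hsub : symmMatrix ⁻¹' (regularGraphs B ρ g D t)ᶜ ⊆ N ∪ ⋃ w, W w := by
    intro x hx
    by_contra hcon
    rw [Set.mem_union, Set.mem_iUnion, not_or, not_exists] at hcon
    obtain ⟨h1, h2⟩ := hcon
    rw [hN, Set.mem_ofPred_eq, not_not] at h1
    have hE := of_symmMatrix_sub_meanMatrix hB ρ t x
    have h3 : ∀ j ≤ 2 * g, ∀ i y,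
        |((Matrix.of (symmMatrix x) - meanMatrix ρ B t) ^ j).mulVec (z y) i| ≤
          √(n * ρ) ^ j * D := by
      intro j hj i y
      have h4 := h2 (⟨j, by omega⟩, i, y)
      rw [hE]
      exact (not_le.mp h4).le
    refine hx ⟨fun i j => h1 _, fun i j => ?_, fun j hj i l => h3 j hj i (Sum.inl l), fun i => ?_⟩
    · simp only [symmMatrix, min_comm, max_comm]
    · have h4 := (abs_le.mp (h3 (2 * g) le_rfl i (Sum.inr i))).2
      simpa [hz, Matrix.mulVec_single_one] using h4
  rw [adjacencyLaw, map_measureReal_apply measurable_symmMatrix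
    (finite_regularGraphs B ρ g D t).measurableSet.compl]
  calc (Measure.pi μ).real (symmMatrix ⁻¹' (regularGraphs B ρ g D t)ᶜ)
      ≤ (Measure.pi μ).real (N ∪ ⋃ w, W w) := measureReal_mono hsub
    _ ≤ (Measure.pi μ).real N + (Measure.pi μ).real (⋃ w, W w) := measureReal_union_le _ _
    _ ≤ 0 + ∑ w, (Measure.pi μ).real (W w) :=
        add_le_add hN0.le (measureReal_iUnion_fintype_le W)
    _ ≤ ∑ _w : Fin (2 * g + 1) × Fin n × (Fin K ⊕ Fin n),
          ((T : ℝ) + 1) ^ T / D ^ (2 * k) := by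
        rw [zero_add]
        exact Finset.sum_le_sum fun w _ => hW w
    _ = _ := by
        simp only [Finset.sum_const, Finset.card_univ, Fintype.card_prod, Fintype.card_sum,
          Fintype.card_fin, nsmul_eq_mul]
        push_cast
        ring

end Adjacency

section SBM

variable {n K : ℕ} {B : Matrix (Fin K) (Fin K) ℝ} {π : Fin K → ℝ} {ρ : ℝ}

lemma map_prodMk_apply (μ : Measure (Fin n → Fin n → ℝ)) (t : Fin n → Fin K)
    {s : Set ((Fin n → Fin n → ℝ) × (Fin n → Fin K))} (hs : MeasurableSet s) :
    (μ.map fun A => (A, t)) s = μ {A | (A, t) ∈ s} :=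
  Measure.map_apply measurable_prodMk_right hs

lemma isProbabilityMeasure_sbmLaw (hπ : ∀ l, 0 ≤ π l) (hsum : ∑ l, π l = 1) :
    IsProbabilityMeasure (sbmLaw n B π ρ) := by
  have := isProbabilityMeasure_blockLaw hπ hsum
  refine ⟨?_⟩
  rw [sbmLaw, Measure.bind_apply MeasurableSet.univ Measurable.of_discrete.aemeasurable]
  simp [map_prodMk_apply]

/-- A property of the graph and the labels fails with at most the probability that a property of
the labels fails, plus the largest conditional probability of failure. -/
lemma sbmLaw_real_le (hπ : ∀ l, 0 ≤ π l) (hsum : ∑ l, π l = 1) {L : Set (Fin n → Fin K)}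
    {s : Set ((Fin n → Fin n → ℝ) × (Fin n → Fin K))} (hs : MeasurableSet s) {e : ℝ} (he : 0 ≤ e)
    (h : ∀ t ∈ L, (adjacencyLaw ρ B t).real {A | (A, t) ∈ s} ≤ e) :
    (sbmLaw n B π ρ).real s ≤ (Measure.pi fun _ : Fin n => blockLaw π).real Lᶜ + e := by
  have := isProbabilityMeasure_blockLaw hπ hsum
  set P := Measure.pi fun _ : Fin n => blockLaw π with hP
  have h1 : sbmLaw n B π ρ s ≤ P Lᶜ + ENNReal.ofReal e := by
    calc sbmLaw n B π ρ s ≤ ∫⁻ t, ((adjacencyLaw ρ B t).map fun A => (A, t)) s ∂P :=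
          Measure.bind_apply_le _ hs
      _ ≤ ∫⁻ t, (Lᶜ.indicator 1 t + ENNReal.ofReal e) ∂P := by
          refine lintegral_mono fun t => ?_
          rw [map_prodMk_apply _ _ hs]
          by_cases ht : t ∈ L
          · refine le_add_left ?_
            rw [← ofReal_measureReal]
            exact ENNReal.ofReal_le_ofReal (h t ht)
          · refine le_add_right ?_
            rw [Set.indicator_of_mem (by exact ht), Pi.one_apply]
            exact prob_le_one
      _ = P Lᶜ + ENNReal.ofReal e := by
          rw [lintegral_add_right _ measurable_const, lintegral_const, measure_univ, mul_one,
            lintegral_indicator_one (Set.toFinite _).measurableSet]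
  calc (sbmLaw n B π ρ).real s ≤ (P Lᶜ + ENNReal.ofReal e).toReal :=
        ENNReal.toReal_mono (by finiteness) h1
    _ = P.real Lᶜ + e := by
        rw [ENNReal.toReal_add (by finiteness) (by finiteness), ENNReal.toReal_ofReal he]
        rfl

end SBM

/-- A finite set of likely values of `x`, together with a likely set of values of `y` for each of
them, gives a likely set of pairs. -/
lemma le_prod_of_finite {α β : Type*} [MeasurableSpace α] [MeasurableSpace β]
    [MeasurableSingletonClass α] {μ : Measure α} {ν : Measure β} [IsProbabilityMeasure μ]
    [IsProbabilityMeasure ν] {F : Set α} (hF : F.Finite) {S : α → Set β}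
    (hS : ∀ x ∈ F, MeasurableSet (S x)) {e e' : ℝ} (hμ : μ.real Fᶜ ≤ e) (he' : 0 ≤ e')
    (hν : ∀ x ∈ F, ν.real (S x)ᶜ ≤ e') :
    MeasurableSet {p : α × β | p.1 ∈ F ∧ p.2 ∈ S p.1} ∧
      ENNReal.ofReal (1 - (e + e')) ≤ (μ.prod ν) {p : α × β | p.1 ∈ F ∧ p.2 ∈ S p.1} := by
  have h1 : {p : α × β | p.1 ∈ F ∧ p.2 ∈ S p.1} = ⋃ x ∈ F, {x} ×ˢ S x := by
    ext ⟨x, y⟩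
    simp
  have hm : MeasurableSet {p : α × β | p.1 ∈ F ∧ p.2 ∈ S p.1} := by
    rw [h1]
    exact hF.measurableSet_biUnion fun x hx => (measurableSet_singleton x).prod (hS x hx)
  refine ⟨hm, ?_⟩
  set E := {p : α × β | p.1 ∈ F ∧ p.2 ∈ S p.1} with hE
  -- Over `F` the failure is a finite union of fibres. Their probabilities are weighted by `μ {x}`,
  -- so they contribute at most `e'` whatever the size of `F`.
  have hsub : Eᶜ ⊆ Fᶜ ×ˢ Set.univ ∪ ⋃ x ∈ hF.toFinset, {x} ×ˢ (S x)ᶜ := by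
    rintro ⟨x, y⟩ h
    by_cases hx : x ∈ F
    · right
      have hy : y ∉ S x := fun hy => h ⟨hx, hy⟩
      simp [hx, hy]
    · left
      simp [hx]
  have h2 : (μ.prod ν).real Eᶜ ≤ e + e' := by
    calc (μ.prod ν).real Eᶜ
        ≤ (μ.prod ν).real (Fᶜ ×ˢ Set.univ ∪ ⋃ x ∈ hF.toFinset, {x} ×ˢ (S x)ᶜ) :=
          measureReal_mono hsub
      _ ≤ (μ.prod ν).real (Fᶜ ×ˢ Set.univ) +
            (μ.prod ν).real (⋃ x ∈ hF.toFinset, {x} ×ˢ (S x)ᶜ) := measureReal_union_le _ _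
      _ ≤ μ.real Fᶜ + ∑ x ∈ hF.toFinset, (μ.prod ν).real ({x} ×ˢ (S x)ᶜ) := by
          refine add_le_add ?_ (measureReal_biUnion_finset_le _ _)
          rw [measureReal_prod_prod, probReal_univ, mul_one]
      _ ≤ e + ∑ x ∈ hF.toFinset, μ.real {x} * e' := by
          refine add_le_add hμ (Finset.sum_le_sum fun x hx => ?_)
          rw [measureReal_prod_prod]
          exact mul_le_mul_of_nonneg_left (hν x (hF.mem_toFinset.mp hx)) measureReal_nonneg
      _ ≤ e + e' := by
          rw [← Finset.sum_mul, sum_measureReal_singleton]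
          exact add_le_add le_rfl (mul_le_of_le_one_left he' measureReal_le_one)
  rw [← ofReal_measureReal]
  refine ENNReal.ofReal_le_ofReal ?_
  have h3 := probReal_compl_eq_one_sub (μ := μ.prod ν) hm
  linarith

/-- The graphs and labels for which all blocks are large and the graph is regular are likely. -/
lemma sbmLaw_real_compl_regular_le {n K : ℕ} {B : Matrix (Fin K) (Fin K) ℝ} {π : Fin K → ℝ} {ρ : ℝ}
    (hB : B.IsSymm) (hB01 : ∀ k l, B k l ∈ Set.Icc (0 : ℝ) 1) (hπ : ∀ l, 0 ≤ π l)
    (hsum : ∑ l, π l = 1) (hρ : 0 ≤ ρ) (hρB : ∀ k l, ρ * B k l ≤ 1) (hr : 1 ≤ n * ρ) (g k : ℕ)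
    {c₀ D : ℝ} (hc₀ : ∀ l, c₀ ≤ π l / 4) (hD : 0 < D) :
    {p : (Fin n → Fin n → ℝ) × (Fin n → Fin K) | (∀ l, c₀ * n ≤
      ((Finset.univ.filter fun i => p.2 i = l).card : ℝ)) ∧
      p.1 ∈ regularGraphs B ρ g D p.2}.Finite ∧
    (sbmLaw n B π ρ).real {p : (Fin n → Fin n → ℝ) × (Fin n → Fin K) | (∀ l, c₀ * n ≤
      ((Finset.univ.filter fun i => p.2 i = l).card : ℝ)) ∧ p.1 ∈ regularGraphs B ρ g D p.2}ᶜ ≤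
      K * Real.exp (-(c₀ * n)) + ((2 * g + 1 : ℕ) * (n * (K + n))) *
        ((((2 * (k * (2 * g)) : ℕ) : ℝ) + 1) ^ (2 * (k * (2 * g))) / D ^ (2 * k)) := by
  set F := {p : (Fin n → Fin n → ℝ) × (Fin n → Fin K) | (∀ l, c₀ * n ≤
      ((Finset.univ.filter fun i => p.2 i = l).card : ℝ)) ∧ p.1 ∈ regularGraphs B ρ g D p.2} with hF
  have hfin : F.Finite := by
    have h1 : (⋃ τ : Fin n → Fin K, regularGraphs B ρ g D τ).Finite :=
      Set.finite_iUnion fun τ => finite_regularGraphs B ρ g D τ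
    refine (h1.prod Set.finite_univ).subset fun p hp => ⟨Set.mem_iUnion.mpr ⟨p.2, hp.2⟩, trivial⟩
  refine ⟨hfin, ?_⟩
  have := isProbabilityMeasure_blockLaw hπ hsum
  set L : Set (Fin n → Fin K) :=
    {τ | ∀ l, c₀ * n ≤ ((Finset.univ.filter fun i => τ i = l).card : ℝ)} with hL
  refine (sbmLaw_real_le hπ hsum (L := L) hfin.measurableSet.compl (by positivity)
    fun t ht => ?_).trans (add_le_add ?_ le_rfl)
  · refine le_trans (measureReal_mono fun A hA hA' => hA ⟨ht, hA'⟩)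
      (measure_compl_regularGraphs_le hB hB01 hρ hρB hr g k hD t)
  · have hsub : Lᶜ ⊆ ⋃ l, {τ : Fin n → Fin K |
        ((Finset.univ.filter fun i => τ i = l).card : ℝ) ≤ π l / 4 * n} := by
      intro τ hτ
      rw [hL, Set.mem_compl_iff, Set.mem_ofPred_eq, not_forall] at hτ
      obtain ⟨l, hl⟩ := hτ
      refine Set.mem_iUnion.mpr ⟨l, (not_le.mp hl).le.trans ?_⟩
      have := hc₀ l
      gcongr
    refine (measureReal_mono hsub).trans ((measureReal_iUnion_fintype_le _).trans ?_)
    calc ∑ l, (Measure.pi fun _ : Fin n => blockLaw π).real {τ : Fin n → Fin K |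
          ((Finset.univ.filter fun i => τ i = l).card : ℝ) ≤ π l / 4 * n}
        ≤ ∑ _l : Fin K, Real.exp (-(c₀ * n)) := by
          refine Finset.sum_le_sum fun l _ => (measure_card_filter_le hπ hsum n l).trans ?_
          have := hc₀ l
          gcongr
      _ = K * Real.exp (-(c₀ * n)) := by simp

/-! ### Choice of exponents and conclusion. -/

/-- Eventually the failure probabilities add up to at most `n ^ (-5)`. -/
lemma eventually_failure_le (K g k : ℕ) (P : ℝ) {c₀ δ : ℝ} (hc₀ : 0 < c₀) (hP : 0 ≤ P)
    (hk : 8 ≤ δ * (2 * k : ℕ)) :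
    ∀ᶠ n : ℕ in atTop, K * Real.exp (-(c₀ * n)) + ((2 * g + 1 : ℕ) * (n * (K + n))) *
      (P / ((n : ℝ) ^ δ) ^ (2 * k)) + 2 / (n : ℝ) ^ 7 ≤ 1 / (n : ℝ) ^ 5 := by
  filter_upwards [eventually_const_mul_log_le_rpow (6 / c₀) one_pos,
    eventually_ge_atTop (3 * K + 3), tendsto_natCast_atTop_atTop.eventually_ge_atTop
      (6 * ((2 * g + 1 : ℕ) : ℝ) * P)] with n h1 h2 h3
  have h2' : 3 * (K : ℝ) + 3 ≤ n := by exact_mod_cast h2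
  have hK : (0 : ℝ) ≤ K := Nat.cast_nonneg K
  have hn1 : (1 : ℝ) ≤ n := by linarith
  have hn0 : (0 : ℝ) < n := by linarith
  rw [Real.rpow_one, div_mul_eq_mul_div, div_le_iff₀ hc₀] at h1
  have hexp : Real.exp (-(c₀ * n)) ≤ 1 / (n : ℝ) ^ 6 := by
    rw [Real.exp_neg, inv_eq_one_div]
    refine one_div_le_one_div_of_le (by positivity) ?_
    calc (n : ℝ) ^ 6 = Real.exp (Real.log ((n : ℝ) ^ 6)) := (Real.exp_log (by positivity)).symm
      _ ≤ Real.exp (c₀ * n) := by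
          rw [Real.log_pow]
          refine Real.exp_le_exp.mpr ?_
          push_cast
          linarith
  have hpow : (n : ℝ) ^ 8 ≤ ((n : ℝ) ^ δ) ^ (2 * k) := by
    rw [← Real.rpow_natCast ((n : ℝ) ^ δ), ← Real.rpow_mul hn0.le, ← Real.rpow_natCast]
    exact Real.rpow_le_rpow_of_exponent_le hn1 (by exact_mod_cast hk)
  have e1 : K * Real.exp (-(c₀ * n)) ≤ 1 / 3 * (1 / (n : ℝ) ^ 5) := by
    calc K * Real.exp (-(c₀ * n)) ≤ (n / 3) * (1 / (n : ℝ) ^ 6) := by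
          gcongr
          linarith
      _ = _ := by field_simp
  have e2 : ((2 * g + 1 : ℕ) * (n * (K + n))) * (P / ((n : ℝ) ^ δ) ^ (2 * k)) ≤
      1 / 3 * (1 / (n : ℝ) ^ 5) := by
    calc ((2 * g + 1 : ℕ) * (n * (K + n))) * (P / ((n : ℝ) ^ δ) ^ (2 * k))
        ≤ ((2 * g + 1 : ℕ) * (n * (n + n))) * (P / (n : ℝ) ^ 8) := by
          gcongr
          linarith
      _ = (6 * ((2 * g + 1 : ℕ) : ℝ) * P) * (1 / 3 * (1 / (n : ℝ) ^ 6)) := by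
          field_simp
          ring
      _ ≤ n * (1 / 3 * (1 / (n : ℝ) ^ 6)) := by gcongr
      _ = _ := by field_simp
  have e3 : 2 / (n : ℝ) ^ 7 ≤ 1 / 3 * (1 / (n : ℝ) ^ 5) := by
    rw [div_mul_div_comm, div_le_div_iff₀ (by positivity) (by positivity)]
    have : (6 : ℝ) ≤ (n : ℝ) ^ 2 := by nlinarith
    calc 2 * (3 * (n : ℝ) ^ 5) = (n : ℝ) ^ 5 * 6 := by ring
      _ ≤ (n : ℝ) ^ 5 * (n : ℝ) ^ 2 := by gcongr
      _ = _ := by ring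
  linarith

/-- The density conditions hold eventually with `D = n ^ δ` for small `δ`. -/
lemma eventually_density {ρ : ℕ → ℝ} {β δ c ε : ℝ} {g : ℕ} (hβ : 0 < β) (hρ : ∀ n, 0 ≤ ρ n)
    (hc : ∀ᶠ n : ℕ in atTop, (n : ℝ) ^ β ≤ c * (n * ρ n)) (hε : 0 < ε) (hδ1 : 4 * δ < β)
    (hδ2 : 1 + 4 * δ < β * g) :
    ∀ᶠ n : ℕ in atTop, 1 ≤ n * ρ n ∧ ((n : ℝ) ^ δ) ^ 4 ≤ ε * (n * ρ n) ∧
      n * ((n : ℝ) ^ δ) ^ 4 ≤ ε * (n * ρ n) ^ g := by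
  -- The constant `c` carries no sign condition; enlarging it makes it positive and divisible by.
  set c' := max c 1 with hc'
  have hc0 : 0 < c' := lt_of_lt_of_le one_pos (le_max_right _ _)
  filter_upwards [hc, eventually_le_natCast_rpow c' hβ,
    eventually_le_natCast_rpow (c' / ε) (sub_pos.mpr hδ1),
    eventually_le_natCast_rpow (c' ^ g / ε) (sub_pos.mpr hδ2), eventually_gt_atTop 0]
    with n h0 h1 h2 h3 hn
  have hn0 : (0 : ℝ) < n := by exact_mod_cast hn
  have hq : 0 ≤ n * ρ n := mul_nonneg hn0.le (hρ n)
  have h4 : (n : ℝ) ^ β ≤ c' * (n * ρ n) :=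
    h0.trans (mul_le_mul_of_nonneg_right (le_max_left _ _) hq)
  have hpow : ((n : ℝ) ^ δ) ^ 4 = (n : ℝ) ^ (4 * δ) := by
    rw [← Real.rpow_natCast, ← Real.rpow_mul hn0.le]
    congr 1
    push_cast
    ring
  refine ⟨?_, ?_, ?_⟩
  · have := h1.trans h4
    exact le_of_mul_le_mul_left (by simpa using this) hc0
  · rw [hpow]
    have h5 : (n : ℝ) ^ (4 * δ) * (c' / ε) ≤ c' * (n * ρ n) := by
      calc (n : ℝ) ^ (4 * δ) * (c' / ε) ≤ (n : ℝ) ^ (4 * δ) * (n : ℝ) ^ (β - 4 * δ) := by gcongr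
        _ = (n : ℝ) ^ β := by rw [← Real.rpow_add hn0]; congr 1; ring
        _ ≤ _ := h4
    have h6 : (n : ℝ) ^ (4 * δ) * (c' / ε) = c' * ((n : ℝ) ^ (4 * δ) / ε) := by ring
    rw [h6] at h5
    have h7 := le_of_mul_le_mul_left h5 hc0
    rw [div_le_iff₀ hε] at h7
    linarith
  · rw [hpow]
    have h8 : n * (n : ℝ) ^ (4 * δ) = (n : ℝ) ^ (1 + 4 * δ) := by
      rw [Real.rpow_add hn0, Real.rpow_one]
    have h5 : n * (n : ℝ) ^ (4 * δ) * (c' ^ g / ε) ≤ c' ^ g * (n * ρ n) ^ g := by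
      calc n * (n : ℝ) ^ (4 * δ) * (c' ^ g / ε)
          ≤ n * (n : ℝ) ^ (4 * δ) * (n : ℝ) ^ (β * g - (1 + 4 * δ)) := by gcongr
        _ = ((n : ℝ) ^ β) ^ g := by
            rw [h8, ← Real.rpow_add hn0,
              ← Real.rpow_natCast ((n : ℝ) ^ β), ← Real.rpow_mul hn0.le]
            congr 1
            ring
        _ ≤ (c' * (n * ρ n)) ^ g := by gcongr
        _ = _ := mul_pow _ _ _
    have h6 : n * (n : ℝ) ^ (4 * δ) * (c' ^ g / ε) =
      c' ^ g * (n * (n : ℝ) ^ (4 * δ) / ε) := by ring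
    rw [h6] at h5
    have h7 := le_of_mul_le_mul_left h5 (by positivity)
    rw [div_le_iff₀ hε] at h7
    linarith

instance (a n k : ℕ) : IsProbabilityMeasure (sketchLaw a n k) := by
  unfold sketchLaw
  infer_instance

lemma one_le_rank_of_ne {K : ℕ} {B : Matrix (Fin K) (Fin K) ℝ} {k l : Fin K} (h : B k ≠ B l) :
    1 ≤ B.rank := by
  rw [Nat.one_le_iff_ne_zero]
  intro h0
  have h1 : B.mulVecLin = 0 := by
    rw [← LinearMap.range_eq_bot]
    exact Submodule.finrank_eq_zero.mp h0
  have h2 : B = 0 := by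
    ext i j
    have h3 := congrFun (LinearMap.congr_fun h1 (Pi.single j 1)) i
    simpa [Matrix.mulVecLin_apply] using h3
  exact h (by rw [h2]; rfl)

lemma exists_pos_forall_le_div {K : ℕ} {π : Fin K → ℝ} (hπ : ∀ l, 0 < π l) :
    ∃ c₀ : ℝ, 0 < c₀ ∧ c₀ ≤ 1 ∧ ∀ l, c₀ ≤ π l / 4 := by
  refine ⟨(insert 1 (Finset.univ.image fun l => π l / 4)).min' (Finset.insert_nonempty _ _), ?_, ?_, fun l => ?_⟩
  · rw [Finset.lt_min'_iff]
    intro y hy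
    rw [Finset.mem_insert, Finset.mem_image] at hy
    rcases hy with rfl | ⟨l, -, rfl⟩
    · exact one_pos
    · have := hπ l
      positivity
  · exact Finset.min'_le _ _ (by simp)
  · exact Finset.min'_le _ _ (by simp)

theorem theorem6 :
    ∃ C : ℝ, 0 < C ∧
      ∀ (K : ℕ) (B : Matrix (Fin K) (Fin K) ℝ) (π : Fin K → ℝ) (ρ : ℕ → ℝ) (β : ℝ)
        (kt a : ℕ → ℕ) (g : ℕ),
        -- the parameters of the blockmodel
        B.IsSymm → (∀ k l, B k l ∈ Set.Icc (0 : ℝ) 1) →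
        (∀ k l, k ≠ l → B k ≠ B l) →
        (∀ l, 0 < π l) → ∑ l, π l = 1 →
        -- the sparsity factor
        (∀ n, 0 ≤ ρ n) → (∀ n k l, ρ n * B k l ≤ 1) →
        β ∈ Set.Ioc (0 : ℝ) 1 →
        (∃ c : ℝ, ∀ᶠ n : ℕ in atTop, (n : ℝ) ^ β ≤ c * (n * ρ n)) →
        -- the choices made in the algorithm
        (∀ n, B.rank ≤ kt n) →
        (∀ n, max (C * (kt n : ℝ)⁻¹ * Real.log n) 1 ≤ (a n : ℝ)) →
        β⁻¹ < (g : ℝ) →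
        ∀ᶠ n : ℕ in atTop,
          ∃ S : Set (((Fin n → Fin n → ℝ) × (Fin n → Fin K)) ×
              (Fin (a n) → Fin n → Fin (kt n) → ℝ)),
            MeasurableSet S ∧
            ENNReal.ofReal (1 - 1 / (n : ℝ) ^ 5) ≤
              ((sbmLaw n B π (ρ n)).prod (sketchLaw (a n) n (kt n))) S ∧
            ∀ (A : Fin n → Fin n → ℝ) (τ : Fin n → Fin K)
              (G : Fin (a n) → Fin n → Fin (kt n) → ℝ), ((A, τ), G) ∈ S →
              ∀ σ : Fin n → Fin K, IsRSVDClustering A B.rank g G σ → ExactlyRecovers σ τ := by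
  -- With `C = 7` the event that no sketch is well conditioned has probability at most `n ^ (-7)`.
  refine ⟨7, by norm_num, ?_⟩
  intro K B π ρ β kt a g hB hB01 hrows hπ hsum hρ hρB hβ ⟨c, hc⟩ hkt ha hg
  have hprob : ∀ n, IsProbabilityMeasure (sbmLaw n B π (ρ n)) := fun n =>
    isProbabilityMeasure_sbmLaw (fun l => (hπ l).le) hsum
  -- A single block is recovered trivially, and there `B` may vanish. With two blocks, distinct rows
  -- force rank at least one.
  rcases subsingleton_or_nontrivial (Fin K) with hK | hK
  · refine Eventually.of_forall fun n => ⟨Set.univ, MeasurableSet.univ, ?_, ?_⟩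
    · rw [measure_univ]
      exact ENNReal.ofReal_le_one.mpr (sub_le_self _ (by positivity))
    · exact fun A τ G _ σ _ => ⟨1, fun i => Subsingleton.elim _ _⟩
  obtain ⟨k₁, k₂, hk₁₂⟩ := exists_pair_ne (Fin K)
  have hrank : 1 ≤ B.rank := one_le_rank_of_ne (hrows k₁ k₂ hk₁₂)
  have hg1 : 1 < β * g := by rwa [inv_lt_iff_one_lt_mul₀' hβ.1] at hg
  have hg0 : 1 ≤ g := by
    rw [Nat.one_le_iff_ne_zero]
    rintro rfl
    norm_num at hg1
  obtain ⟨c₀, hc₀, hc₀1, hc₀π⟩ := exists_pos_forall_le_div hπ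
  obtain ⟨ε, hε, hdet⟩ := exists_forall_isTypical_exactlyRecovers hB hB01 hrows hrank hg0 hc₀ hc₀1
  -- For `D = n ^ δ` the two inequalities make `D ^ 4` negligible against `n ρ` and `n D ^ 4`
  -- negligible against `(n ρ) ^ g`; the second has room since `β g > 1`.
  obtain ⟨δ, hδ, hδ1, hδ2⟩ : ∃ δ : ℝ, 0 < δ ∧ 4 * δ < β ∧ 1 + 4 * δ < β * g := by
    refine ⟨min β (β * g - 1) / 8, ?_, ?_, ?_⟩
    · have : 0 < min β (β * g - 1) := lt_min hβ.1 (by linarith)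
      positivity
    · linarith [min_le_left β (β * g - 1), hβ.1]
    · linarith [min_le_right β (β * g - 1)]
  -- Here `k` is the moment order: `D ^ (2 k) ≥ n ^ 8` outweighs the union over order `n ^ 2` walk
  -- sums.
  obtain ⟨k, hk⟩ := exists_nat_ge (4 / δ)
  have hk8 : 8 ≤ δ * (2 * k : ℕ) := by
    rw [div_le_iff₀ hδ] at hk
    push_cast
    linarith
  filter_upwards [eventually_density hβ.1 hρ hc hε hδ1 hδ2,
    eventually_exists_sketch_set (d := B.rank) hrank hδ,
    eventually_failure_le K g k ((((2 * (k * (2 * g)) : ℕ) : ℝ) + 1) ^ (2 * (k * (2 * g)))) hc₀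
      (by positivity) hk8,
    eventually_ge_atTop (g * K + 1)] with n hden hsketch hfail hn
  obtain ⟨hr, hD1, hD2⟩ := hden
  have hn0 : 0 < n := by omega
  have hn1 : (1 : ℝ) ≤ n := by exact_mod_cast hn0
  set D := (n : ℝ) ^ δ with hD
  have hD0 : 1 ≤ D := Real.one_le_rpow hn1 hδ.le
  have hk0 : (0 : ℝ) < kt n := by exact_mod_cast hrank.trans (hkt n)
  have ha1 : 1 ≤ a n := by exact_mod_cast (le_max_right _ _).trans (ha n)
  have hak : 7 * Real.log n ≤ a n * kt n := by
    have h1 := (le_max_left _ _).trans (ha n)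
    rw [← div_le_iff₀ hk0]
    calc 7 * Real.log n / kt n = 7 * (kt n : ℝ)⁻¹ * Real.log n := by ring
      _ ≤ a n := h1
  obtain ⟨T, s, hT, hs, hTs, hsk⟩ := hsketch (kt n) (a n) (hkt n) ha1 hak
  obtain ⟨hfin, hFle⟩ := sbmLaw_real_compl_regular_le (n := n) hB hB01 (fun l => (hπ l).le) hsum
    (hρ n) (hρB n) hr g k hc₀π (by linarith : 0 < D)
  set F := {p : (Fin n → Fin n → ℝ) × (Fin n → Fin K) | (∀ l, c₀ * n ≤
      ((Finset.univ.filter fun i => p.2 i = l).card : ℝ)) ∧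
      p.1 ∈ regularGraphs B (ρ n) g D p.2} with hF
  -- The good sketches depend on the graph and the labels through `R` and `vs`, whereas the levels
  -- `T` and `s` and the failure bound do not. The membership `p ∈ F` stands inside the existential
  -- so that `S` can be chosen as a total function.
  have hS : ∀ p : (Fin n → Fin n → ℝ) × (Fin n → Fin K),
      ∃ S : Set (Fin (a n) → Fin n → Fin (kt n) → ℝ), p ∈ F → MeasurableSet S ∧
        (sketchLaw (a n) n (kt n)).real Sᶜ ≤ 2 / (n : ℝ) ^ 7 ∧
        ∀ G ∈ S, ∀ σ : Fin n → Fin K, IsRSVDClustering p.1 B.rank g G σ →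
          ExactlyRecovers σ p.2 := by
    intro p
    by_cases hp : p ∈ F
    · obtain ⟨R, hR, vs, hvs, hrec⟩ := hdet n hn0 (ρ n) D (hρ n) hD0 hD1 hD2 p.1 p.2
        (isTypical_of_mem_regularGraphs hp.1 hp.2)
      have hcard : vs.card ≤ n ^ 2 := by
        have : (g * K + 1) * n ≤ n * n := Nat.mul_le_mul_right n hn
        have : g * K ≤ g * K * n := Nat.le_mul_of_pos_right _ hn0
        nlinarith
      obtain ⟨S, hSm, hSle, hSG⟩ := hsk R hR vs hcard
      exact ⟨S, fun _ => ⟨hSm, hSle, fun G hG => hrec (a n) (kt n) G T s hT hs hTs (hSG G hG).1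
        (hSG G hG).2⟩⟩
    · exact ⟨∅, fun h => absurd h hp⟩
  choose S hS using hS
  obtain ⟨hm, hle⟩ := le_prod_of_finite (ν := sketchLaw (a n) n (kt n)) hfin
    (fun p hp => (hS p hp).1) hFle (by positivity : 0 ≤ 2 / (n : ℝ) ^ 7)
    (fun p hp => (hS p hp).2.1)
  refine ⟨_, hm, le_trans (ENNReal.ofReal_le_ofReal ?_) hle,
    fun A τ G hG => (hS (A, τ) hG.1).2.2 G hG.2⟩
  linarith
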